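/- **Setting.** Let $N\ge 1$, let $q\in\mathbb C^*$ not be a root of unity, and let $\alpha_0,\dots,\alpha_{N+2}\in\mathbb C^*$. Write $(a;p)_n=\prod_{k=0}^{n-1}(1-ap^k)$ and $[X,Y]_q=qXY-q^{-1}YX$. The $q$-Onsager algebra with parameter $\rho$ is the unital associative $\mathbb C$-algebra with generators $\mathsf W_0,\mathsf W_1$ and relations $$[\mathsf W_0,[\mathsf W_0,[\mathsf W_0,\mathsf W_1]_q]_{q^{-1}}]=\rho[\mathsf W_0,\mathsf W_1],\qquad [\mathsf W_1,[\mathsf W_1,[\mathsf W_1,\mathsf W_0]_q]_{q^{-1}}]=\rho[\mathsf W_1,\mathsf W_0].$$ **Polynomials.** Let ${\tt p}_n(x;a,b,c,d)$, $x=\frac12(z+z^{-1})$, be the Askey–Wilson polynomial in base $q^2$, i.e. $${\tt p}_n=\frac{(ab,ac,ad;q^2)_n}{a^n}\,{}_4\phi_3\!\left(q^{-2n},abcdq^{2n-2},az,az^{-1};ab,ac,ad;q^2,q^2\right)$$ (the prefactor multiplied into the sum, so that this is polynomial in $ab,ac,ad$). For $n\in\mathbb N^N$ put $|n|=n_1+\dots+n_N$,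 $\mathsf N_k=n_1+\dots+n_k$, $z_{N+1}=\alpha_{N+2}$, $x_j=\frac12(z_j+z_j^{-1})$. The normalized Gasper–Rahman polynomial is $$\widehat Q_n(z)=\frac{(\alpha_{N+1}\alpha_{N+2})^{|n|}}{(\alpha_{N+1}\alpha_{N+2},\,\alpha_{N+1}\alpha_{N+2}/\alpha_0^2;q^2)_{|n|}}\prod_{j=1}^N\frac{{\tt p}_{n_j}\!\left(x_j;\alpha_jq^{2\mathsf N_{j-1}},\frac{\alpha_j}{\alpha_0^2}q^{2\mathsf N_{j-1}},\frac{\alpha_{j+1}}{\alpha_j}z_{j+1},\frac{\alpha_{j+1}}{\alpha_j}z_{j+1}^{-1}\right)}{\alpha_j^{n_j}(\alpha_{j+1}^2/\alpha_j^2;q^2)_{n_j}} .$$ **Operator.** Let $E_{z_j}$ be the shift $z_j\mapsto q^2z_j$, $\Delta_{z_j}=E_{z_j}-1$, $\nabla_{z_j}=1-E_{z_j}^{-1}$. For $\nu\in\{0,1\}^N\setminus\{0\}$ with support $\{i_1<\dots<i_s\}$ let $$\Phi_\nu(z)=(1-\alpha_{i_1}z_{i_1})\Big(1-\tfrac{\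alpha_{i_1}z_{i_1}}{\alpha_0^2}\Big)\frac{\prod_{k=2}^s\big(1-\frac{\alpha_{i_k}z_{i_k}z_{i_{k-1}}}{\alpha_{i_{k-1}}}\big)\big(1-\frac{q^2\alpha_{i_k}z_{i_k}z_{i_{k-1}}}{\alpha_{i_{k-1}}}\big)}{\prod_{k=1}^s(1-z_{i_k}^2)(1-q^2z_{i_k}^2)}\Big(1-\tfrac{\alpha_{N+1}\alpha_{N+2}z_{i_s}}{\alpha_{i_s}}\Big)\Big(1-\tfrac{\alpha_{N+1}z_{i_s}}{\alpha_{i_s}\alpha_{N+2}}\Big).$$ For $\nu\in\{-1,0,1\}^N\setminus\{0\}$, with positive and negative parts $\nu^\pm$, let $\Phi_\nu$ be $\Phi_{\nu^++\nu^-}$ with $z_i$ replaced by $z_i^{-1}$ wherever $\nu_i=-1$. Put $$\mathbb D^{*(N)}=\frac{\alpha_0q}{\alpha_{N+1}}\Big(\sum_{\nu\ne0}(-1)^{|\nu^-|}\Phi_\nu(z)\,\Delta_z^{\nu^+}\nabla_z^{\nu^-}+1+\frac{\alpha_{N+1}^2}{q^2\alpha_0^2}\Big).$$ **Discrete support.**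 Let $j_1,\dots,j_N$ be positive integers or half-integers, put $d_N=2(j_1+\dots+j_N)$, and assume $\alpha_{k+1}/\alpha_k=q^{-2j_k}$ for $k=1,\dots,N$. Let $n$ range over $B=\{n\in\mathbb N^N:0\le n_k\le 2j_k\}$ and $\tilde n$ over $\tilde B=\{\tilde n\in\mathbb N^N:0\le\tilde n_{N+1-k}\le2j_k\}$. Let $z(\tilde n)$ be the point with $z_k=\frac{\alpha_{N+1}\alpha_{N+2}}{\alpha_k}q^{2(\tilde n_1+\dots+\tilde n_{N+1-k})}$, let $x_1(\tilde n)$ be the value of $x_1$ there, and put $\tilde Q(n,\tilde n)=\widehat Q_n(z(\tilde n))$. Assume the parameters are non-degenerate: $(\alpha_{N+1}\alpha_{N+2};q^2)_{d_N}\ne0$ and $(\alpha_{N+1}\alpha_{N+2}/\alpha_0^2;q^2)_{d_N}\neq0$, and neither $\alpha_{N+2}^2$ nor $\alpha_{N+1}^2/\alpha_0^2$ is an integral power of $q^2$. For $0\le p\le d_N$ let $$\mathcal V^*_p=\mathrm{Span}\{\tilde Q(n,\cdot):n\in B,\ |n|=p\}\subset\mathbb C^{\tilde B},\qquad \mathcal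 V_p=\mathrm{Span}\{\tilde Q(\cdot,\tilde n):\tilde n\in\tilde B,\ |\tilde n|=p\}\subset\mathbb C^{B},$$ and $\mathcal V^*=\sum_{p=0}^{d_N}\mathcal V^*_p$, $\mathcal V=\sum_{p=0}^{d_N}\mathcal V_p$. **Proposition.** Both sums are direct. With $\rho=-\frac{(q^2-q^{-2})^2}{4}$, the maps $\mathsf W_0\mapsto x_1$ and $\mathsf W_1\mapsto\frac12\mathbb D^{*(N)}$ make each of $\mathcal V^*$ and $\mathcal V$ a module over the $q$-Onsager algebra. Precisely, there are unital algebra homomorphisms from the $q$-Onsager algebra to $\mathrm{End}(\mathcal V^*)$ and to $\mathrm{End}(\mathcal V)$ such that, for all $n\in B$ and $\tilde n\in\tilde B$, $$(\mathsf W_0\,\tilde Q(n,\cdot))(\tilde n)=x_1(\tilde n)\tilde Q(n,\tilde n)=(\mathsf W_0\,\tilde Q(\cdot,\tilde n))(n),$$ $$(\mathsf W_1\,\tilde Q(n,\cdot))(\tilde n)=\tfrac12\big(\mathbb D^{*(N)}\widehat Q_n\big)(z(\tilde n))=(\mathsf W_1\,\tilde Q(\cdot,\tilde n))(n).$$ Both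 modules are finite dimensional, of dimension $\prod_{k=1}^N(2j_k+1)$. -/

import Mathlib

open scoped BigOperators

noncomputable section

namespace GasperRahman

/-! ### The `q`-Onsager algebra -/

/-- The commutator `[X, Y] = X Y - Y X`. -/
def comm {A : Type*} [Ring A] (X Y : A) : A := X * Y - Y * X

/-- The `q`-commutator `[X, Y]_q = q X Y - q⁻¹ Y X`. -/
def qComm {A : Type*} [Ring A] [Algebra ℂ A] (q : ℂ) (X Y : A) : A :=
  q • (X * Y) - q⁻¹ • (Y * X)

/-- The defining relations of the `q`-Onsager algebra on two free generators. -/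
inductive OnsagerRel (q ρ : ℂ) : FreeAlgebra ℂ (Fin 2) → FreeAlgebra ℂ (Fin 2) → Prop
  | rel (i j : Fin 2) (hij : i ≠ j) :
      OnsagerRel q ρ
        (comm (FreeAlgebra.ι ℂ i) (qComm q⁻¹ (FreeAlgebra.ι ℂ i)
          (qComm q (FreeAlgebra.ι ℂ i) (FreeAlgebra.ι ℂ j))))
        (ρ • comm (FreeAlgebra.ι ℂ i) (FreeAlgebra.ι ℂ j))

/-- The `q`-Onsager algebra with parameter `ρ`: the unital associative `ℂ`-algebra with
generators `W₀, W₁` and relations `[W₀,[W₀,[W₀,W₁]_q]_{q⁻¹}] = ρ [W₀,W₁]` and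
`[W₁,[W₁,[W₁,W₀]_q]_{q⁻¹}] = ρ [W₁,W₀]`. -/
abbrev QOnsager (q ρ : ℂ) : Type := RingQuot (OnsagerRel q ρ)

/-- The standard generators `W₀`, `W₁`. -/
def QOnsager.W (q ρ : ℂ) (i : Fin 2) : QOnsager q ρ :=
  RingQuot.mkAlgHom ℂ (OnsagerRel q ρ) (FreeAlgebra.ι ℂ i)

/-! ### Askey-Wilson and Gasper-Rahman polynomials -/

/-- The `q`-shifted factorial `(a; q)_n`. -/
def qPoch (a q : ℂ) (n : ℕ) : ℂ := ∏ k ∈ Finset.range n, (1 - a * q ^ k)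

/-- The Askey-Wilson polynomial `p_n(x; a, b, c, d)` in base `q`, at `x = (z + z⁻¹) / 2`.
The prefactor `(ab, ac, ad; q)_n` has been multiplied into the terminating `₄φ₃` series, so that
this is a polynomial in `ab, ac, ad`; see `awPoly_eq`. -/
def awPoly (q : ℂ) (n : ℕ) (z a b c d : ℂ) : ℂ :=
  (a ^ n)⁻¹ * ∑ k ∈ Finset.range (n + 1),
    qPoch (q ^ (-(n : ℤ))) q k * qPoch (a * b * c * d * q ^ ((n : ℤ) - 1)) q k
      * qPoch (a * z) q k * qPoch (a * z⁻¹) q k / qPoch q q k * q ^ k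
      * (qPoch (a * b * q ^ k) q (n - k) * qPoch (a * c * q ^ k) q (n - k)
        * qPoch (a * d * q ^ k) q (n - k))

theorem qPoch_split (a q : ℂ) {k n : ℕ} (h : k ≤ n) :
    qPoch a q n = qPoch a q k * qPoch (a * q ^ k) q (n - k) := by
  obtain ⟨m, rfl⟩ := Nat.exists_eq_add_of_le h
  simp only [qPoch, Finset.prod_range_add, Nat.add_sub_cancel_left]
  congr 1
  exact Finset.prod_congr rfl fun i _ => by rw [pow_add, mul_assoc]

/-- Whenever the usual `₄φ₃` formula makes sense, `awPoly` agrees with it: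
`p_n = (ab, ac, ad; q)_n a⁻ⁿ ₄φ₃(q⁻ⁿ, abcdqⁿ⁻¹, az, az⁻¹; ab, ac, ad; q, q)`. -/
theorem awPoly_eq (q : ℂ) (n : ℕ) (z a b c d : ℂ)
    (hb : qPoch (a * b) q n ≠ 0) (hc : qPoch (a * c) q n ≠ 0) (hd : qPoch (a * d) q n ≠ 0) :
    awPoly q n z a b c d =
      qPoch (a * b) q n * qPoch (a * c) q n * qPoch (a * d) q n / a ^ n *
        ∑ k ∈ Finset.range (n + 1),
          qPoch (q ^ (-(n : ℤ))) q k * qPoch (a * b * c * d * q ^ ((n : ℤ) - 1)) q k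
            * qPoch (a * z) q k * qPoch (a * z⁻¹) q k
            / (qPoch (a * b) q k * qPoch (a * c) q k * qPoch (a * d) q k * qPoch q q k)
            * q ^ k := by
  rw [awPoly, Finset.mul_sum, Finset.mul_sum]
  refine Finset.sum_congr rfl fun k hk => ?_
  have hkn : k ≤ n := Nat.lt_succ_iff.mp (Finset.mem_range.mp hk)
  rw [qPoch_split _ _ hkn] at hb hc hd
  rw [qPoch_split (a * b) q hkn, qPoch_split (a * c) q hkn, qPoch_split (a * d) q hkn]
  have h1 := left_ne_zero_of_mul hb
  have h2 := left_ne_zero_of_mul hc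
  have h3 := left_ne_zero_of_mul hd
  generalize qPoch (a * b) q k = u at *
  generalize qPoch (a * c) q k = v at *
  generalize qPoch (a * d) q k = w at *
  have h4 : (u * v * w * qPoch q q k)⁻¹ * (u * v * w) = (qPoch q q k)⁻¹ := by
    rw [mul_inv, mul_right_comm, inv_mul_cancel₀ (mul_ne_zero (mul_ne_zero h1 h2) h3), one_mul]
  simp only [div_eq_mul_inv]
  rw [← h4]
  ring

/-! In what follows the parameters `α₀, …, α_{N+2}` are the values `α 0, …, α (N + 2)` of a
sequence `α : ℕ → ℂ`. A variable indexed by `1, …, N` is a function on `Fin N`; the index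
`i : Fin N` stands for `i + 1`, so that its parameter `α_{i+1}` is `α (i + 1)`. -/

variable {N : ℕ}

/-- The variable following `z i`, where the last one is followed by `z_{N+1} = α_{N+2}`. -/
def nextVar (α : ℕ → ℂ) (z : Fin N → ℂ) (i : Fin N) : ℂ :=
  if h : (i : ℕ) + 1 < N then z ⟨(i : ℕ) + 1, h⟩ else α (N + 2)

/-- The sum of those `n l` that precede index `i`. -/
def partialSum (n : Fin N → ℕ) (i : ℕ) : ℕ := ∑ l : Fin N, if (l : ℕ) < i then n l else 0

/-- The Gasper-Rahman polynomial `Q^{(N)}({n}, {x}, {α})`, as a function of `z`, where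
`x_j = (z_j + z_j⁻¹) / 2`; the Askey-Wilson factors are in base `q²`. -/
def gasperRahman (q : ℂ) (α : ℕ → ℂ) (n : Fin N → ℕ) (z : Fin N → ℂ) : ℂ :=
  ∏ i : Fin N, awPoly (q ^ 2) (n i) (z i)
    (α (i + 1) * q ^ (2 * partialSum n i))
    (α (i + 1) / α 0 ^ 2 * q ^ (2 * partialSum n i))
    (α (i + 2) / α (i + 1) * nextVar α z i)
    (α (i + 2) / α (i + 1) * (nextVar α z i)⁻¹)

/-- The normalized Gasper-Rahman polynomial. -/
def normGasperRahman (q : ℂ) (α : ℕ → ℂ) (n : Fin N → ℕ) (z : Fin N → ℂ) : ℂ :=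
  (α (N + 1) * α (N + 2)) ^ (∑ i, n i)
    / (qPoch (α (N + 1) * α (N + 2)) (q ^ 2) (∑ i, n i)
      * qPoch (α (N + 1) * α (N + 2) / α 0 ^ 2) (q ^ 2) (∑ i, n i))
    * (∏ i : Fin N, α (i + 1) ^ n i * qPoch (α (i + 2) ^ 2 / α (i + 1) ^ 2) (q ^ 2) (n i))⁻¹
    * gasperRahman q α n z

/-! ### The `q`-difference operator -/

/-- The shift `f(z) ↦ f(…, c z_i, …)`. -/
def scaleVar (c : ℂ) (i : Fin N) : Module.End ℂ ((Fin N → ℂ) → ℂ) where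
  toFun f z := f (Function.update z i (c * z i))
  map_add' _ _ := rfl
  map_smul' _ _ := rfl

/-- The forward difference `E_{z_i} - 1`, where `E_{z_i}` sends `z_i` to `q² z_i`. -/
def forwardDiff (q : ℂ) (i : Fin N) : Module.End ℂ ((Fin N → ℂ) → ℂ) :=
  scaleVar (q ^ 2) i - 1

/-- The backward difference `1 - E_{z_i}⁻¹`. -/
def backwardDiff (q : ℂ) (i : Fin N) : Module.End ℂ ((Fin N → ℂ) → ℂ) :=
  1 - scaleVar (q ^ 2)⁻¹ i

/-- The operator `Δ^{ν⁺} ∇^{ν⁻}` for `ν ∈ {-1, 0, 1}^N` (the factors commute). -/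
def mixedDiff (q : ℂ) (ν : Fin N → SignType) : Module.End ℂ ((Fin N → ℂ) → ℂ) :=
  (List.ofFn fun i =>
    if ν i = 1 then forwardDiff q i else if ν i = -1 then backwardDiff q i else 1).prod

/-- The coefficient `Φ_ν` for `ν ∈ {0, 1}^N` with support `S = {i₁ < ⋯ < i_s}`. The first product
is over `i = i₁`, the second over consecutive pairs of elements of `S`, the last over `i = i_s`. -/
def phiSupp (q : ℂ) (α : ℕ → ℂ) (S : Finset (Fin N)) (z : Fin N → ℂ) : ℂ :=
  (∏ i ∈ S with ∀ k ∈ S, i ≤ k,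
      (1 - α (i + 1) * z i) * (1 - α (i + 1) * z i / α 0 ^ 2))
    * (∏ p ∈ S ×ˢ S with p.1 < p.2 ∧ ∀ k ∈ S, k ≤ p.1 ∨ p.2 ≤ k,
      (1 - α (p.2 + 1) * z p.2 * z p.1 / α (p.1 + 1))
        * (1 - q ^ 2 * α (p.2 + 1) * z p.2 * z p.1 / α (p.1 + 1)))
    / (∏ i ∈ S, (1 - z i ^ 2) * (1 - q ^ 2 * z i ^ 2))
    * ∏ i ∈ S with ∀ k ∈ S, k ≤ i,
      (1 - α (N + 1) * α (N + 2) * z i / α (i + 1))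
        * (1 - α (N + 1) * z i / (α (i + 1) * α (N + 2)))

/-- The coefficient `Φ_ν` for `ν ∈ {-1, 0, 1}^N`: in `Φ_{ν⁺ + ν⁻}`, invert `z_i` if `ν_i = -1`. -/
def phi (q : ℂ) (α : ℕ → ℂ) (ν : Fin N → SignType) (z : Fin N → ℂ) : ℂ :=
  phiSupp q α (Finset.univ.filter fun i => ν i ≠ 0) (fun i => if ν i = -1 then (z i)⁻¹ else z i)

/-- The `N`-variable `q`-difference operator `𝔻*^{(N)}`, acting on functions of `z`:
`(α₀ q / α_{N+1}) (∑_{ν ≠ 0} (-1)^{|ν⁻|} Φ_ν Δ^{ν⁺} ∇^{ν⁻} + 1 + α_{N+1}² / (q² α₀²))`. -/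
def qDiffOp (q : ℂ) (α : ℕ → ℂ) (f : (Fin N → ℂ) → ℂ) (z : Fin N → ℂ) : ℂ :=
  α 0 * q / α (N + 1) *
    ((∑ ν : Fin N → SignType with ν ≠ 0,
        (-1) ^ (Finset.univ.filter fun i => ν i = -1).card * phi q α ν z * mixedDiff q ν f z)
      + (1 + α (N + 1) ^ 2 / (q ^ 2 * α 0 ^ 2)) * f z)

/-! ### The discrete support and the two families of spaces -/

/-- Multi-indices `n` with `0 ≤ n_k ≤ 2 j_k`, where `twoJ k = 2 j_k`. -/
abbrev Box (twoJ : Fin N → ℕ) : Type := (k : Fin N) → Fin (twoJ k + 1)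

/-- Multi-indices `ñ` with `0 ≤ ñ_{N+1-k} ≤ 2 j_k`. -/
abbrev DualBox (twoJ : Fin N → ℕ) : Type := (k : Fin N) → Fin (twoJ k.rev + 1)

/-- The point of the discrete support labelled by `ñ`:
`z_k = (α_{N+1} α_{N+2} / α_k) q^{2 (ñ_1 + ⋯ + ñ_{N+1-k})}`. -/
def supportPt (q : ℂ) (α : ℕ → ℂ) (m : Fin N → ℕ) : Fin N → ℂ := fun i =>
  α (N + 1) * α (N + 2) / α (i + 1) * q ^ (2 * partialSum m (N - i))

/-- The discretized polynomial `Q̃^{(N)}({n}, {ñ}, {α})`. -/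
def discPoly (q : ℂ) (α : ℕ → ℂ) (n m : Fin N → ℕ) : ℂ :=
  normGasperRahman q α n (supportPt q α m)

/-- The value of `x_1 = (z_1 + z_1⁻¹) / 2` at the support point labelled by `ñ`. -/
def x1 [NeZero N] (q : ℂ) (α : ℕ → ℂ) (m : Fin N → ℕ) : ℂ :=
  (supportPt q α m 0 + (supportPt q α m 0)⁻¹) / 2

variable (q : ℂ) (α : ℕ → ℂ) (twoJ : Fin N → ℕ)

/-- `d_N = 2 (j_1 + ⋯ + j_N)`. -/
def diam : ℕ := ∑ k, twoJ k

/-- The discretized polynomial with label `n`, as a function of `ñ`. -/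
def polyOfLabel (n : Box twoJ) : DualBox twoJ → ℂ :=
  fun m => discPoly q α (fun k => n k) (fun k => m k)

/-- The discretized polynomial with label `ñ`, as a function of `n`. -/
def polyOfDualLabel (m : DualBox twoJ) : Box twoJ → ℂ :=
  fun n => discPoly q α (fun k => n k) (fun k => m k)

/-- `𝒱*_p`, spanned by the discretized polynomials with `n_1 + ⋯ + n_N = p`, as functions of
`ñ`. -/
def starDegree (p : Fin (diam twoJ + 1)) : Submodule ℂ (DualBox twoJ → ℂ) :=
  Submodule.span ℂ {f | ∃ n : Box twoJ, ∑ k, (n k : ℕ) = p ∧ f = polyOfLabel q α twoJ n}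

/-- `𝒱_p`, spanned by the discretized polynomials with `ñ_1 + ⋯ + ñ_N = p`, as functions of
`n`. -/
def dualDegree (p : Fin (diam twoJ + 1)) : Submodule ℂ (Box twoJ → ℂ) :=
  Submodule.span ℂ {f | ∃ m : DualBox twoJ, ∑ k, (m k : ℕ) = p ∧ f = polyOfDualLabel q α twoJ m}

/-- `𝒱*`, the sum of the `𝒱*_p` for `0 ≤ p ≤ d_N`. -/
def starSpace : Submodule ℂ (DualBox twoJ → ℂ) := ⨆ p, starDegree q α twoJ p

/-- `𝒱`, the sum of the `𝒱_p` for `0 ≤ p ≤ d_N`. -/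
def dualSpace : Submodule ℂ (Box twoJ → ℂ) := ⨆ p, dualDegree q α twoJ p

theorem polyOfLabel_mem (n : Box twoJ) : polyOfLabel q α twoJ n ∈ starSpace q α twoJ := by
  have h : ∑ k, (n k : ℕ) < diam twoJ + 1 :=
    Nat.lt_succ_of_le (Finset.sum_le_sum fun k _ => Nat.lt_succ_iff.mp (n k).isLt)
  exact Submodule.mem_iSup_of_mem ⟨_, h⟩ (Submodule.subset_span ⟨n, rfl, rfl⟩)

theorem polyOfDualLabel_mem (m : DualBox twoJ) :
    polyOfDualLabel q α twoJ m ∈ dualSpace q α twoJ := by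
  have h : ∑ k, (m k : ℕ) < diam twoJ + 1 := by
    refine Nat.lt_succ_of_le ((Finset.sum_le_sum fun k _ =>
      Nat.lt_succ_iff.mp (m k).isLt).trans (le_of_eq ?_))
    exact Equiv.sum_comp Fin.revPerm twoJ
  exact Submodule.mem_iSup_of_mem ⟨_, h⟩ (Submodule.subset_span ⟨m, rfl, rfl⟩)

/-- The generator of `𝒱*` with label `n`. -/
def starVec (n : Box twoJ) : starSpace q α twoJ := ⟨_, polyOfLabel_mem q α twoJ n⟩

/-- The generator of `𝒱` with label `ñ`. -/
def dualVec (m : DualBox twoJ) : dualSpace q α twoJ := ⟨_, polyOfDualLabel_mem q α twoJ m⟩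

/-- The function `½ 𝔻*^{(N)} Q̂({n}, ·)` evaluated at the support point labelled by `ñ`. -/
def halfQDiff (n m : Fin N → ℕ) : ℂ :=
  1 / 2 * qDiffOp q α (normGasperRahman q α n) (supportPt q α m)

end GasperRahman

end

open scoped BigOperators

noncomputable section

namespace GasperRahman

/-! ### One-variable Askey-Wilson polynomials -/

/-! The discretized polynomials form a square matrix indexed by degree labels `n` and support labels
`ñ`; the two modules are the spans of its rows and of its columns. The q-Onsager relations are a
consequence of bispectrality. If `A` is diagonal with eigenvalues `θ` and `B` has matrix `b` in an
eigenbasis of `A`, the relation cubic in `A` holds as soon as every nonzero entry of `b` joins two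
eigenvalues satisfying a cubic condition (`onsager_relation_of_tridiagonal`). For `θ_k = (u q^{-2k}
+ u⁻¹ q^{2k}) / 2` the condition holds, with the given `ρ`, whenever the two indices differ by at
most one (`isOnsagerPair_eigenvalue`). Hence two facts suffice: the difference operator has an
eigenvalue depending on `|n|` and moves `|ñ|` by at most one; multiplication by `x₁` depends on
`|ñ|` and moves `|n|` by at most one.

For the first fact the operator is rewritten as a nested sum over shifts, `transfer`, in which a
site sees its left neighbour only through a pair `(s, s')`. The dependence on that pair lies in the
span of `1`, `s + s'`, `s s'`, so three evaluations determine it (`IsPairLinear.decompose`); this is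
what converts differences into shifts (`sum_chainWeight`). The Askey-Wilson difference equation and
contiguous relations let the factor at the first site pass through the operator, at the price of
scaling `(s, s')` by `Q^n` with `Q = q²` (`transfer_siteFactor_mul`), and iteration gives the
eigenvalue. At a support point the coefficients of all shifts leaving the box vanish
(`transfer_gridPt`).

The second fact is the first one for dual parameters. At a support point each factor is a
terminating q-Racah series symmetric in degree and node, so exchanging `n` and `ñ` amounts to
replacing `α` by `dualParam` (`discPoly_dual`). These parameters are again admissible, and the dual
eigenvalue is `2 x₁` (`eigenvalue_dual`).

The dimension comes from linear independence, proved by a triangular factorization in one variable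
and induction on the number of variables (`grPoly_independent`). The sums are direct because the
graded pieces lie in eigenspaces with distinct eigenvalues. -/

theorem qPoch_zero (a Q : ℂ) : qPoch a Q 0 = 1 := by simp [qPoch]

theorem qPoch_succ (a Q : ℂ) (n : ℕ) : qPoch a Q (n + 1) = qPoch a Q n * (1 - a * Q ^ n) := by
  rw [qPoch, qPoch, Finset.prod_range_succ]

theorem qPoch_succ' (a Q : ℂ) (n : ℕ) : qPoch a Q (n + 1) = (1 - a) * qPoch (a * Q) Q n := by
  rw [qPoch, qPoch, Finset.prod_range_succ', mul_comm]
  congr 1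
  · simp
  · exact Finset.prod_congr rfl fun i _ => by rw [pow_succ']; ring

theorem qPoch_ne_zero {a Q : ℂ} {n : ℕ} (h : ∀ k < n, 1 - a * Q ^ k ≠ 0) : qPoch a Q n ≠ 0 :=
  Finset.prod_ne_zero_iff.mpr fun k hk => h k (Finset.mem_range.mp hk)

theorem qPoch_neg_eq_zero {Q : ℂ} (hQ : Q ≠ 0) {n k : ℕ} (h : n < k) :
    qPoch (Q ^ (-(n : ℤ))) Q k = 0 :=
  Finset.prod_eq_zero (Finset.mem_range.mpr h) (by
    rw [← zpow_natCast, ← zpow_add₀ hQ]; simp)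

/-- The product `(ab q^k, ac q^k, ad q^k; q)_{n - k}`. -/
def awTail (Q : ℂ) (n k : ℕ) (a b c d : ℂ) : ℂ :=
  qPoch (a * b * Q ^ k) Q (n - k) * qPoch (a * c * Q ^ k) Q (n - k)
    * qPoch (a * d * Q ^ k) Q (n - k)

/-- The basis `(az, a/z; q)_k`. -/
def awBasis (Q a z : ℂ) (k : ℕ) : ℂ := qPoch (a * z) Q k * qPoch (a * z⁻¹) Q k

/-- The coefficient of `(az, a/z; q)_k` in `aⁿ p_n`. -/
def awCoeff (Q : ℂ) (n k : ℕ) (a b c d : ℂ) : ℂ :=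
  qPoch (Q ^ (-(n : ℤ))) Q k * qPoch (a * b * c * d * Q ^ ((n : ℤ) - 1)) Q k / qPoch Q Q k * Q ^ k
    * awTail Q n k a b c d

theorem awPoly_eq_sum (Q : ℂ) (n : ℕ) (z a b c d : ℂ) :
    awPoly Q n z a b c d
      = (a ^ n)⁻¹ * ∑ k ∈ Finset.range (n + 1), awCoeff Q n k a b c d * awBasis Q a z k := by
  rw [awPoly]
  congr 1
  refine Finset.sum_congr rfl fun k _ => ?_
  rw [awCoeff, awBasis, awTail]
  ring

theorem awPoly_swap_right (Q : ℂ) (n : ℕ) (z a b c d : ℂ) :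
    awPoly Q n z a b c d = awPoly Q n z a b d c := by
  rw [awPoly, awPoly]
  congr 1
  refine Finset.sum_congr rfl fun k _ => ?_
  rw [show a * b * c * d = a * b * d * c by ring]
  ring

theorem awCoeff_eq_zero {Q : ℂ} (hQ : Q ≠ 0) {n k : ℕ} (h : n < k) (a b c d : ℂ) :
    awCoeff Q n k a b c d = 0 := by
  rw [awCoeff, qPoch_neg_eq_zero hQ h]; ring

theorem awBasis_succ (Q a z : ℂ) (k : ℕ) :
    awBasis Q a z (k + 1) = awBasis Q a z k * ((1 - a * Q ^ k * z) * (1 - a * Q ^ k * z⁻¹)) := by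
  rw [awBasis, awBasis, qPoch_succ, qPoch_succ]; ring

theorem awTail_step (Q : ℂ) {n k : ℕ} (h : k < n) (a b c d : ℂ) :
    awTail Q n k a b c d = (1 - a * b * Q ^ k) * (1 - a * c * Q ^ k) * (1 - a * d * Q ^ k)
      * awTail Q n (k + 1) a b c d := by
  obtain ⟨m, rfl⟩ := Nat.exists_eq_add_of_lt h
  rw [awTail, awTail, show k + m + 1 - k = m + 1 by omega, show k + m + 1 - (k + 1) = m by omega,
    qPoch_succ', qPoch_succ', qPoch_succ']
  simp only [pow_succ, ← mul_assoc]
  ring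

/-- A symmetric combination of four linear factors. -/
theorem bracket_identity {z : ℂ} (hz : z ≠ 0) (hz2 : z ^ 2 ≠ 1) {X : ℂ} (hX : X ≠ 0) (b c d : ℂ) :
    (z⁻¹ ^ 2 * ((1 - X * z) * (1 - b * z) * (1 - c * z) * (1 - d * z))
      - z ^ 2 * ((1 - X * z⁻¹) * (1 - b * z⁻¹) * (1 - c * z⁻¹) * (1 - d * z⁻¹))) / (z - z⁻¹)
    = X⁻¹ * ((1 - X * b * c * d) * ((1 - X * z) * (1 - X * z⁻¹))
      - (1 - X * b) * (1 - X * c) * (1 - X * d)) := by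
  have h : z - z⁻¹ ≠ 0 := by
    intro h
    apply hz2
    field_simp at h
    linear_combination h
  rw [div_eq_iff h]
  field_simp
  ring

/-- The parameter-raising expression, with the shift `z ↦ q^{±1} z`. -/
def raise (q : ℂ) (a b c d : ℂ) (f : ℂ → ℂ) (z : ℂ) : ℂ :=
  (z⁻¹ ^ 2 * ((1 - a * z) * (1 - b * z) * (1 - c * z) * (1 - d * z)) * f (q * z)
    - z ^ 2 * ((1 - a * z⁻¹) * (1 - b * z⁻¹) * (1 - c * z⁻¹) * (1 - d * z⁻¹)) * f (q⁻¹ * z))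
    / (z - z⁻¹)

/-- The linear factors in `a` complete the shifted products to a common multiple of `(az, a/z;
q²)_k`, with `a` replaced by `a q^{2k}` in the remaining factor. What is left is the antisymmetric
combination of `bracket_identity`, hence only two neighbouring basis elements appear. -/
theorem raise_awBasis {q : ℂ} (hq : q ≠ 0) {z : ℂ} (hz : z ≠ 0) (hz2 : z ^ 2 ≠ 1) {a : ℂ}
    (ha : a ≠ 0) (b c d : ℂ) (k : ℕ) :
    raise q a b c d (fun y => awBasis (q ^ 2) (q * a) y k) z
      = (a * (q ^ 2) ^ k)⁻¹ * ((1 - a * b * c * d * (q ^ 2) ^ k) * awBasis (q ^ 2) a z (k + 1)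
        - (1 - a * b * (q ^ 2) ^ k) * (1 - a * c * (q ^ 2) ^ k) * (1 - a * d * (q ^ 2) ^ k)
          * awBasis (q ^ 2) a z k) := by
  have hX : a * (q ^ 2) ^ k ≠ 0 := mul_ne_zero ha (pow_ne_zero _ (pow_ne_zero _ hq))
  have h1 : (1 - a * z) * awBasis (q ^ 2) (q * a) (q * z) k
      = (1 - a * (q ^ 2) ^ k * z) * awBasis (q ^ 2) a z k := by
    have e1 : q * a * (q * z) = a * z * q ^ 2 := by ring
    have e2 : q * a * (q * z)⁻¹ = a * z⁻¹ := by field_simp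
    have := (qPoch_succ' (a * z) (q ^ 2) k).symm.trans (qPoch_succ (a * z) (q ^ 2) k)
    rw [awBasis, awBasis, e1, e2, ← mul_assoc, this]
    ring
  have h2 : (1 - a * z⁻¹) * awBasis (q ^ 2) (q * a) (q⁻¹ * z) k
      = (1 - a * (q ^ 2) ^ k * z⁻¹) * awBasis (q ^ 2) a z k := by
    have e1 : q * a * (q⁻¹ * z)⁻¹ = a * z⁻¹ * q ^ 2 := by field_simp
    have e2 : q * a * (q⁻¹ * z) = a * z := by field_simp
    have := (qPoch_succ' (a * z⁻¹) (q ^ 2) k).symm.trans (qPoch_succ (a * z⁻¹) (q ^ 2) k)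
    rw [awBasis, awBasis, e1, e2, mul_left_comm, this]
    ring
  have h3 := bracket_identity hz hz2 hX b c d
  rw [awBasis_succ]
  calc raise q a b c d (fun y => awBasis (q ^ 2) (q * a) y k) z
      = (z⁻¹ ^ 2 * ((1 - b * z) * (1 - c * z) * (1 - d * z))
            * ((1 - a * z) * awBasis (q ^ 2) (q * a) (q * z) k)
          - z ^ 2 * ((1 - b * z⁻¹) * (1 - c * z⁻¹) * (1 - d * z⁻¹))
            * ((1 - a * z⁻¹) * awBasis (q ^ 2) (q * a) (q⁻¹ * z) k)) / (z - z⁻¹) := by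
        rw [raise]; ring
    _ = awBasis (q ^ 2) a z k *
        ((z⁻¹ ^ 2 * ((1 - a * (q ^ 2) ^ k * z) * (1 - b * z) * (1 - c * z) * (1 - d * z))
      - z ^ 2 * ((1 - a * (q ^ 2) ^ k * z⁻¹) * (1 - b * z⁻¹) * (1 - c * z⁻¹) * (1 - d * z⁻¹)))
        / (z - z⁻¹)) := by rw [h1, h2]; ring
    _ = _ := by rw [h3]; ring

theorem raise_sum (q a b c d z : ℂ) (n : ℕ) (w : ℂ) (x : ℕ → ℂ) (f : ℕ → ℂ → ℂ) :
    raise q a b c d (fun y => w * ∑ k ∈ Finset.range n, x k * f k y) z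
      = w * ∑ k ∈ Finset.range n, x k * raise q a b c d (f k) z := by
  simp only [raise, Finset.mul_sum, ← Finset.sum_sub_distrib, Finset.sum_div]
  exact Finset.sum_congr rfl fun k _ => by ring

theorem zpow_ne_one_of_pow {Q : ℂ} (h : ∀ k : ℕ, 0 < k → Q ^ k ≠ 1) {e : ℤ} (he : e ≠ 0) :
    Q ^ e ≠ 1 := by
  rcases lt_or_gt_of_ne he with h1 | h1
  · obtain ⟨k, hk⟩ := Int.exists_eq_neg_ofNat h1.le
    rw [hk, zpow_neg, zpow_natCast]
    intro h2
    exact h k (by omega) (inv_eq_one.mp h2)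
  · obtain ⟨k, hk⟩ := Int.eq_ofNat_of_zero_le h1.le
    rw [hk, zpow_natCast]
    exact h k (by omega)

theorem qPoch_self_ne_zero {Q : ℂ} (hQ : ∀ k : ℕ, 0 < k → Q ^ k ≠ 1) (k : ℕ) :
    qPoch Q Q k ≠ 0 :=
  qPoch_ne_zero fun j _ h => hQ (j + 1) j.succ_pos (by rw [pow_succ']; linear_combination -h)

/-- Comparison of the coefficients of the basis element of index `k + 1` in the raising relation:
one contribution comes from index `k`, one from index `k + 1`. -/
theorem awCoeff_raise {q : ℂ} (hq : q ≠ 0) (hroot : ∀ k : ℕ, 0 < k → (q ^ 2) ^ k ≠ 1)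
    (n k : ℕ) (hk : k ≤ n) (a b c d : ℂ) :
    awCoeff (q ^ 2) n k (q * a) (q * b) (q * c) (q * d) * ((q ^ 2) ^ k)⁻¹
        * (1 - a * b * c * d * (q ^ 2) ^ k)
      - awCoeff (q ^ 2) n (k + 1) (q * a) (q * b) (q * c) (q * d) * ((q ^ 2) ^ (k + 1))⁻¹
        * ((1 - a * b * (q ^ 2) ^ (k + 1)) * (1 - a * c * (q ^ 2) ^ (k + 1))
          * (1 - a * d * (q ^ 2) ^ (k + 1)))
      = - awCoeff (q ^ 2) (n + 1) (k + 1) a b c d := by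
  have hQ : q ^ 2 ≠ 0 := pow_ne_zero _ hq
  have hP := qPoch_self_ne_zero hroot k
  have hP' := qPoch_self_ne_zero hroot (k + 1)
  have hT0 : awTail (q ^ 2) n k (q * a) (q * b) (q * c) (q * d)
      = awTail (q ^ 2) (n + 1) (k + 1) a b c d := by
    rw [awTail, awTail, show n + 1 - (k + 1) = n - k by omega]
    congr 2 <;> [congr 1; skip; skip] <;> ring_nf
  have hT1 : k < n → awTail (q ^ 2) n (k + 1) (q * a) (q * b) (q * c) (q * d)
      * ((1 - a * b * (q ^ 2) ^ (k + 1)) * (1 - a * c * (q ^ 2) ^ (k + 1))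
          * (1 - a * d * (q ^ 2) ^ (k + 1)))
      = awTail (q ^ 2) (n + 1) (k + 1) a b c d := by
    intro h
    rw [awTail_step (q ^ 2) (by omega : k + 1 < n + 1), awTail, awTail,
      show n + 1 - (k + 1 + 1) = n - (k + 1) by omega, mul_comm]
    congr 1
    congr 2 <;> [congr 1; skip; skip] <;> ring_nf
  have hg1 : q * a * (q * b) * (q * c) * (q * d) * (q ^ 2) ^ ((n : ℤ) - 1)
      = a * b * c * d * (q ^ 2) ^ n * q ^ 2 := by
    rw [zpow_sub₀ hQ, zpow_natCast]; field_simp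
  have hg2 : a * b * c * d * (q ^ 2) ^ (((n + 1 : ℕ) : ℤ) - 1) = a * b * c * d * (q ^ 2) ^ n := by
    simp
  have hn : (q ^ 2) ^ (-((n + 1 : ℕ) : ℤ)) * q ^ 2 = (q ^ 2) ^ (-(n : ℤ)) := by
    rw [← zpow_add_one₀ hQ]; congr 1; push_cast; ring
  have hn' : (q ^ 2) ^ (-(n : ℤ)) = ((q ^ 2) ^ n)⁻¹ := by rw [zpow_neg, zpow_natCast]
  have hn'' : (q ^ 2) ^ (-((n + 1 : ℕ) : ℤ)) = ((q ^ 2) ^ n * q ^ 2)⁻¹ := by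
    rw [zpow_neg, zpow_natCast, pow_succ]
  have hQn : (q ^ 2) ^ n ≠ 0 := pow_ne_zero _ hQ
  have hQk : (q ^ 2) ^ k ≠ 0 := pow_ne_zero _ hQ
  have e2 : awCoeff (q ^ 2) (n + 1) (k + 1) a b c d
      = (1 - ((q ^ 2) ^ n * q ^ 2)⁻¹) * qPoch ((q ^ 2) ^ (-(n : ℤ))) (q ^ 2) k
        * ((1 - a * b * c * d * (q ^ 2) ^ n)
          * qPoch (a * b * c * d * (q ^ 2) ^ n * q ^ 2) (q ^ 2) k)
        / qPoch (q ^ 2) (q ^ 2) (k + 1) * (q ^ 2) ^ (k + 1)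
        * awTail (q ^ 2) (n + 1) (k + 1) a b c d := by
    rw [awCoeff, hg2, qPoch_succ', hn, hn'', qPoch_succ' (a * b * c * d * (q ^ 2) ^ n)]
  have e0 : awCoeff (q ^ 2) n k (q * a) (q * b) (q * c) (q * d)
      = qPoch ((q ^ 2) ^ (-(n : ℤ))) (q ^ 2) k
        * qPoch (a * b * c * d * (q ^ 2) ^ n * q ^ 2) (q ^ 2) k / qPoch (q ^ 2) (q ^ 2) k
        * (q ^ 2) ^ k * awTail (q ^ 2) (n + 1) (k + 1) a b c d := by
    rw [awCoeff, hg1, hT0]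
  have e1 : awCoeff (q ^ 2) n (k + 1) (q * a) (q * b) (q * c) (q * d)
        * ((1 - a * b * (q ^ 2) ^ (k + 1)) * (1 - a * c * (q ^ 2) ^ (k + 1))
          * (1 - a * d * (q ^ 2) ^ (k + 1)))
      = qPoch ((q ^ 2) ^ (-(n : ℤ))) (q ^ 2) (k + 1)
        * qPoch (a * b * c * d * (q ^ 2) ^ n * q ^ 2) (q ^ 2) (k + 1)
          / qPoch (q ^ 2) (q ^ 2) (k + 1)
        * (q ^ 2) ^ (k + 1) * awTail (q ^ 2) (n + 1) (k + 1) a b c d := by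
    rcases hk.lt_or_eq with h | h
    · rw [awCoeff, hg1, mul_assoc, hT1 h]
    -- At `k = n` the truncated subtraction in the tail product spoils the tail relation, but both
    -- sides vanish because `(Q^{-n}; Q)_{n+1} = 0`.
    · subst h
      rw [awCoeff_eq_zero hQ (Nat.lt_succ_self _), qPoch_neg_eq_zero hQ (Nat.lt_succ_self _)]
      ring
  rw [show ∀ x y z : ℂ, x * y * z = x * z * y from fun x y z => by ring, mul_right_comm _ _
    ((1 - a * b * (q ^ 2) ^ (k + 1)) * _ * _), e1, e2, e0,
    qPoch_succ ((q ^ 2) ^ (-(n : ℤ))), qPoch_succ (a * b * c * d * (q ^ 2) ^ n * q ^ 2), hn']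
  rw [qPoch_succ (q ^ 2)] at hP' ⊢
  have hlast := right_ne_zero_of_mul hP'
  rw [pow_succ (q ^ 2) k]
  generalize qPoch ((q ^ 2) ^ n)⁻¹ (q ^ 2) k = A
  generalize qPoch (a * b * c * d * (q ^ 2) ^ n * q ^ 2) (q ^ 2) k = B
  generalize awTail (q ^ 2) (n + 1) (k + 1) a b c d = C
  generalize qPoch (q ^ 2) (q ^ 2) k = P at *
  generalize (q ^ 2) ^ n = x at *
  generalize (q ^ 2) ^ k = y at *
  generalize q ^ 2 = Q at *
  have hlast' : 1 - y * Q ≠ 0 := by rwa [mul_comm]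
  rw [mul_comm Q y]
  field_simp
  ring

theorem awCoeff_raise_zero (q : ℂ) (n : ℕ) (a b c d : ℂ) :
    awCoeff (q ^ 2) n 0 (q * a) (q * b) (q * c) (q * d)
      * ((1 - a * b) * (1 - a * c) * (1 - a * d)) = awCoeff (q ^ 2) (n + 1) 0 a b c d := by
  rw [awCoeff, awCoeff, awTail_step _ n.succ_pos, awTail, awTail]
  simp only [qPoch_zero, pow_zero, Nat.sub_zero, mul_one, div_one, one_mul, zero_add,
    Nat.succ_eq_add_one, Nat.add_sub_cancel, pow_one]
  rw [mul_comm]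
  congr 1
  congr 2 <;> [congr 1; skip; skip] <;> ring_nf

/-- The raising relation for Askey-Wilson polynomials. -/
theorem raise_awPoly {q : ℂ} (hq : q ≠ 0) (hroot : ∀ k : ℕ, 0 < k → (q ^ 2) ^ k ≠ 1)
    (n : ℕ) {z : ℂ} (hz : z ≠ 0) (hz2 : z ^ 2 ≠ 1) {a : ℂ} (ha : a ≠ 0) (b c d : ℂ) :
    awPoly (q ^ 2) (n + 1) z a b c d
      = -q ^ n * raise q a b c d
        (fun y => awPoly (q ^ 2) n y (q * a) (q * b) (q * c) (q * d)) z := by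
  simp only [awPoly_eq_sum (q ^ 2) n]
  rw [raise_sum, awPoly_eq_sum, Finset.sum_range_succ']
  simp only [raise_awBasis hq hz hz2 ha]
  set x : ℕ → ℂ := fun k => awCoeff (q ^ 2) n k (q * a) (q * b) (q * c) (q * d) with hx
  set t : ℕ → ℂ := fun k => x k * ((q ^ 2) ^ k)⁻¹ * ((1 - a * b * (q ^ 2) ^ k)
    * (1 - a * c * (q ^ 2) ^ k) * (1 - a * d * (q ^ 2) ^ k)) * awBasis (q ^ 2) a z k with ht
  have h0 : awCoeff (q ^ 2) (n + 1) 0 a b c d * awBasis (q ^ 2) a z 0 = t 0 := by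
    rw [← awCoeff_raise_zero q, ht, hx]; simp
  -- The vanishing top term allows the summation index to be shifted without a boundary contribution
  -- at the upper end.
  have hlast : t (n + 1) = 0 := by
    simp only [ht, hx]
    rw [awCoeff_eq_zero (pow_ne_zero _ hq) (Nat.lt_succ_self n)]; ring
  have h1 : ∑ k ∈ Finset.range (n + 1), t (k + 1) = ∑ k ∈ Finset.range (n + 1), t k - t 0 := by
    have := Finset.sum_range_succ t (n + 1)
    rw [Finset.sum_range_succ'] at this
    rw [hlast] at this
    linear_combination this
  have h2 : ∑ k ∈ Finset.range (n + 1),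
      awCoeff (q ^ 2) (n + 1) (k + 1) a b c d * awBasis (q ^ 2) a z (k + 1)
      = ∑ k ∈ Finset.range (n + 1), (t (k + 1) - x k * ((q ^ 2) ^ k)⁻¹
          * (1 - a * b * c * d * (q ^ 2) ^ k) * awBasis (q ^ 2) a z (k + 1)) := by
    refine Finset.sum_congr rfl fun k hk => ?_
    have := awCoeff_raise hq hroot n k (Nat.lt_succ_iff.mp (Finset.mem_range.mp hk)) a b c d
    rw [← neg_eq_iff_eq_neg] at this
    rw [← this]
    simp only [ht, hx]
    ring
  rw [h0, h2, Finset.sum_sub_distrib, h1, mul_pow, mul_inv]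
  have h3 : ∑ k ∈ Finset.range (n + 1), x k * ((a * (q ^ 2) ^ k)⁻¹
        * ((1 - a * b * c * d * (q ^ 2) ^ k) * awBasis (q ^ 2) a z (k + 1)
        - (1 - a * b * (q ^ 2) ^ k) * (1 - a * c * (q ^ 2) ^ k) * (1 - a * d * (q ^ 2) ^ k)
          * awBasis (q ^ 2) a z k))
      = a⁻¹ * (∑ k ∈ Finset.range (n + 1), x k * ((q ^ 2) ^ k)⁻¹
          * (1 - a * b * c * d * (q ^ 2) ^ k) * awBasis (q ^ 2) a z (k + 1)
        - ∑ k ∈ Finset.range (n + 1), t k) := by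
    rw [← Finset.sum_sub_distrib, Finset.mul_sum]
    refine Finset.sum_congr rfl fun k _ => ?_
    simp only [ht, mul_inv]
    ring
  rw [h3, pow_succ, mul_inv]
  have hqn : q ^ n ≠ 0 := pow_ne_zero _ hq
  generalize ∑ k ∈ Finset.range (n + 1), t k = S
  generalize (∑ k ∈ Finset.range (n + 1), _ : ℂ) = S'
  field_simp
  ring

/-- A nonzero number none of whose multiples by `q^{2e}` squares to one. -/
def Generic (q z : ℂ) : Prop := z ≠ 0 ∧ ∀ e : ℤ, z ^ 2 * (q ^ 2) ^ e ≠ 1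

theorem Generic.mul_zpow {q z : ℂ} (hq : q ≠ 0) (h : Generic q z) (k : ℤ) :
    Generic q (q ^ k * z) := by
  refine ⟨mul_ne_zero (zpow_ne_zero _ hq) h.1, fun e he => h.2 (k + e) ?_⟩
  have h2 : (q ^ 2) ^ k = (q ^ k) ^ 2 := by
    rw [← zpow_natCast, ← zpow_natCast, ← zpow_mul, ← zpow_mul, mul_comm]
  rw [← he, mul_pow, zpow_add₀ (pow_ne_zero 2 hq), h2]
  ring

theorem Generic.inv {q z : ℂ} (h : Generic q z) : Generic q z⁻¹ := by
  refine ⟨inv_ne_zero h.1, fun e he => h.2 (-e) ?_⟩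
  rw [zpow_neg, ← inv_inv (z ^ 2), ← mul_inv, ← inv_pow, he, inv_one]

/-- The symmetry of the Askey-Wilson polynomials that is hidden by the choice of base. -/
theorem awPoly_swap {q : ℂ} (hq : q ≠ 0) (hroot : ∀ k : ℕ, 0 < k → (q ^ 2) ^ k ≠ 1)
    (n : ℕ) {z : ℂ} (hz : Generic q z) {a c : ℂ} (ha : a ≠ 0) (hc : c ≠ 0) (b d : ℂ) :
    awPoly (q ^ 2) n z a b c d = awPoly (q ^ 2) n z c b a d := by
  -- The expression `raise` is visibly symmetric in its four parameters, so the raising relation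
  -- carries symmetry from degree `n` to `n + 1`. The variable is generalized because `raise`
  -- evaluates at `q z` and `q⁻¹ z`.
  induction n generalizing z a b c d with
  | zero => simp [awPoly, qPoch]
  | succ n ih =>
    have hz2 : z ^ 2 ≠ 1 := by simpa using hz.2 0
    rw [raise_awPoly hq hroot n hz.1 hz2 ha, raise_awPoly hq hroot n hz.1 hz2 hc]
    have h1 := ih (z := q * z) (by simpa using hz.mul_zpow hq 1) (mul_ne_zero hq ha)
      (mul_ne_zero hq hc) (q * b) (q * d)
    have h2 := ih (z := q⁻¹ * z) (by simpa using hz.mul_zpow hq (-1)) (mul_ne_zero hq ha)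
      (mul_ne_zero hq hc) (q * b) (q * d)
    simp only [raise, h1, h2]
    ring

/-! ### The Askey-Wilson difference equation -/

/-- The coefficient of the Askey-Wilson operator. -/
def awPhi (Q a b c d z : ℂ) : ℂ :=
  (1 - a * z) * (1 - b * z) * (1 - c * z) * (1 - d * z) / ((1 - z ^ 2) * (1 - Q * z ^ 2))

theorem awBasis_inv (Q a z : ℂ) (k : ℕ) : awBasis Q a z⁻¹ k = awBasis Q a z k := by
  rw [awBasis, awBasis, inv_inv, mul_comm]

/-- The factor `1 - a z`, supplied by the operator's coefficient, makes both terms multiples of the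
basis element of index `j`; their difference also contains `1 - Q z²`, which cancels a denominator
of `awPhi`. -/
theorem awBasis_shift {Q z : ℂ} (hQ : Q ≠ 0) (hz : z ≠ 0) (a : ℂ) (j : ℕ) :
    (1 - a * z) * (awBasis Q a (Q * z) (j + 1) - awBasis Q a z (j + 1))
      = awBasis Q a z j * ((1 - a * Q ^ j * z) * (Q ^ (j + 1) - 1) * (a * Q⁻¹ * z⁻¹)
        * (1 - Q * z ^ 2)) := by
  have h1 : (1 - a * z) * qPoch (a * (Q * z)) Q (j + 1)
      = qPoch (a * z) Q j * (1 - a * z * Q ^ j) * (1 - a * z * Q ^ (j + 1)) := by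
    rw [← qPoch_succ, ← qPoch_succ, qPoch_succ' _ _ (j + 1)]
    congr 2; ring
  have h2 : qPoch (a * (Q * z)⁻¹) Q (j + 1) = (1 - a * (Q * z)⁻¹) * qPoch (a * z⁻¹) Q j := by
    rw [qPoch_succ']; congr 2; field_simp
  rw [mul_sub, awBasis_succ Q a z j]
  simp only [awBasis]
  rw [← mul_assoc, h1, h2]
  field_simp
  ring

theorem awPhi_mul_shift {Q z : ℂ} (hQ : Q ≠ 0) (hz : z ≠ 0) (h : 1 - Q * z ^ 2 ≠ 0)
    (a b c d : ℂ) (j : ℕ) :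
    awPhi Q a b c d z * (awBasis Q a (Q * z) (j + 1) - awBasis Q a z (j + 1))
      = awBasis Q a z j * (Q ^ (j + 1) - 1) * (a * Q⁻¹)
        * (z⁻¹ * ((1 - a * Q ^ j * z) * (1 - b * z) * (1 - c * z) * (1 - d * z)) / (1 - z ^ 2)) := by
  calc _ = (1 - b * z) * (1 - c * z) * (1 - d * z) / ((1 - z ^ 2) * (1 - Q * z ^ 2))
      * ((1 - a * z) * (awBasis Q a (Q * z) (j + 1) - awBasis Q a z (j + 1))) := by
        rw [awPhi]; ring
    _ = _ := by
      rw [awBasis_shift hQ hz, div_mul_eq_mul_div, ← mul_assoc (awBasis Q a z j), ← mul_assoc,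
        mul_div_mul_right _ _ h]
      ring

/-- The operator is lower bidiagonal in the basis `(az, a/z; Q)_k`, again through
`bracket_identity`; the eigenvalue equation thereby becomes a two-term recursion for coefficients.
-/
theorem awOperator_awBasis {Q z : ℂ} (hQ : Q ≠ 0) (hz : z ≠ 0) (h1 : 1 - z ^ 2 ≠ 0)
    (h2 : 1 - Q * z ^ 2 ≠ 0) (h3 : 1 - Q * z⁻¹ ^ 2 ≠ 0) {a : ℂ} (ha : a ≠ 0) (b c d : ℂ) (j : ℕ) :
    awPhi Q a b c d z * (awBasis Q a (Q * z) (j + 1) - awBasis Q a z (j + 1))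
      + awPhi Q a b c d z⁻¹ * (awBasis Q a (Q⁻¹ * z) (j + 1) - awBasis Q a z (j + 1))
    = ((Q ^ (j + 1))⁻¹ - 1) * ((1 - a * b * c * d * Q ^ j) * awBasis Q a z (j + 1)
      - (1 - a * b * Q ^ j) * (1 - a * c * Q ^ j) * (1 - a * d * Q ^ j) * awBasis Q a z j) := by
  -- The backward shift is the forward one with `z` inverted, since the basis is invariant under `z
  -- ↦ z⁻¹`.
  have e := awPhi_mul_shift hQ (inv_ne_zero hz) h3 a b c d j
  rw [awBasis_inv, awBasis_inv, ← awBasis_inv Q a (Q * z⁻¹), mul_inv, inv_inv] at e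
  rw [awPhi_mul_shift hQ hz h2, e, awBasis_succ]
  have hX : a * Q ^ j ≠ 0 := mul_ne_zero ha (pow_ne_zero _ hQ)
  have hb := bracket_identity hz (fun h => h1 (by rw [h]; ring)) hX b c d
  have h4 : z - z⁻¹ ≠ 0 := by
    intro h; apply h1; field_simp at h; linear_combination -h
  have h5 : 1 - z⁻¹ ^ 2 ≠ 0 := by
    intro h; apply h1; field_simp at h; linear_combination -h
  have hQj : Q ^ j ≠ 0 := pow_ne_zero _ hQ
  have e1 : ∀ t : ℂ, z⁻¹ * t / (1 - z ^ 2) = - (z⁻¹ ^ 2 * t / (z - z⁻¹)) := by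
    intro t; rw [← neg_div, div_eq_div_iff h1 h4]; field_simp; ring
  have e2 : ∀ t : ℂ, z * t / (1 - z⁻¹ ^ 2) = z ^ 2 * t / (z - z⁻¹) := by
    intro t; rw [div_eq_div_iff h5 h4]; field_simp
  rw [e1, e2]
  rw [sub_div] at hb
  generalize (1 - a * Q ^ j * z) * (1 - b * z) * (1 - c * z) * (1 - d * z) = P at *
  generalize (1 - a * Q ^ j * z⁻¹) * (1 - b * z⁻¹) * (1 - c * z⁻¹) * (1 - d * z⁻¹) = P' at *
  rw [show ∀ u v : ℂ, awBasis Q a z j * (Q ^ (j + 1) - 1) * (a * Q⁻¹) * -u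
      + awBasis Q a z j * (Q ^ (j + 1) - 1) * (a * Q⁻¹) * v
      = - (awBasis Q a z j * (Q ^ (j + 1) - 1) * (a * Q⁻¹) * (u - v)) from fun u v => by ring, hb,
    pow_succ]
  generalize Q ^ j = y at *
  generalize (1 - a * y * z) * (1 - a * y * z⁻¹) = R
  field_simp
  ring

/-- This is the two-term recursion that characterizes the hypergeometric coefficients, read off at
the basis element of index `k`. -/
theorem awOperator_coeff {Q : ℂ} (hQ : Q ≠ 0) (hroot : ∀ k : ℕ, 0 < k → Q ^ k ≠ 1)
    {n k : ℕ} (hk : k ≤ n) {a : ℂ} (b c d : ℂ) :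
    awCoeff Q n k a b c d * ((Q ^ k)⁻¹ - 1) * (1 - a * b * c * d * Q ^ ((k : ℤ) - 1))
      - awCoeff Q n (k + 1) a b c d * ((Q ^ (k + 1))⁻¹ - 1)
        * ((1 - a * b * Q ^ k) * (1 - a * c * Q ^ k) * (1 - a * d * Q ^ k))
      = ((Q ^ n)⁻¹ - 1) * (1 - a * b * c * d * Q ^ ((n : ℤ) - 1)) * awCoeff Q n k a b c d := by
  have hP' := qPoch_self_ne_zero hroot (k + 1)
  have hn' : Q ^ (-(n : ℤ)) = (Q ^ n)⁻¹ := by rw [zpow_neg, zpow_natCast]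
  have e1 : awCoeff Q n (k + 1) a b c d
        * ((1 - a * b * Q ^ k) * (1 - a * c * Q ^ k) * (1 - a * d * Q ^ k))
      = qPoch (Q ^ (-(n : ℤ))) Q (k + 1) * qPoch (a * b * c * d * Q ^ ((n : ℤ) - 1)) Q (k + 1)
          / qPoch Q Q (k + 1) * Q ^ (k + 1) * awTail Q n k a b c d := by
    rcases hk.lt_or_eq with h | h
    · rw [awCoeff, awTail_step Q h]; ring
    · subst h
      rw [awCoeff_eq_zero hQ (Nat.lt_succ_self _), qPoch_neg_eq_zero hQ (Nat.lt_succ_self _)]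
      ring
  rw [mul_right_comm (awCoeff Q n (k + 1) a b c d), e1, awCoeff, qPoch_succ (Q ^ (-(n : ℤ))),
    qPoch_succ (a * b * c * d * Q ^ ((n : ℤ) - 1)), hn', zpow_sub₀ hQ, zpow_sub₀ hQ,
    zpow_natCast, zpow_natCast, zpow_one]
  rw [qPoch_succ Q] at hP' ⊢
  have hlast := right_ne_zero_of_mul hP'
  have hP := left_ne_zero_of_mul hP'
  have hx : Q ^ n ≠ 0 := pow_ne_zero _ hQ
  have hy : Q ^ k ≠ 0 := pow_ne_zero _ hQ
  rw [pow_succ Q k]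
  clear e1 hn'
  generalize qPoch (Q ^ n)⁻¹ Q k = A
  generalize qPoch (a * b * c * d * (Q ^ n / Q)) Q k = B
  generalize awTail Q n k a b c d = C
  generalize qPoch Q Q k = P at *
  generalize Q ^ n = x at *
  generalize Q ^ k = y at *
  have hlast' : 1 - y * Q ≠ 0 := by rwa [mul_comm]
  rw [mul_comm Q y]
  field_simp
  ring

/-- The Askey-Wilson difference equation. -/
theorem awOperator_awPoly {Q z : ℂ} (hQ : Q ≠ 0) (hroot : ∀ k : ℕ, 0 < k → Q ^ k ≠ 1)
    (hz : z ≠ 0) (h1 : 1 - z ^ 2 ≠ 0)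
    (h2 : 1 - Q * z ^ 2 ≠ 0) (h3 : 1 - Q * z⁻¹ ^ 2 ≠ 0) {a : ℂ} (ha : a ≠ 0) (b c d : ℂ) (n : ℕ) :
    awPhi Q a b c d z * (awPoly Q n (Q * z) a b c d - awPoly Q n z a b c d)
      + awPhi Q a b c d z⁻¹ * (awPoly Q n (Q⁻¹ * z) a b c d - awPoly Q n z a b c d)
    = ((Q ^ n)⁻¹ - 1) * (1 - a * b * c * d * Q ^ ((n : ℤ) - 1)) * awPoly Q n z a b c d := by
  simp only [awPoly_eq_sum]
  set x : ℕ → ℂ := fun k => awCoeff Q n k a b c d with hx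
  set t : ℕ → ℂ := fun k => x (k + 1) * ((Q ^ (k + 1))⁻¹ - 1) * ((1 - a * b * Q ^ k)
    * (1 - a * c * Q ^ k) * (1 - a * d * Q ^ k)) * awBasis Q a z k with ht
  set r : ℕ → ℂ := fun k => x k * ((Q ^ k)⁻¹ - 1) * (1 - a * b * c * d * Q ^ ((k : ℤ) - 1))
    * awBasis Q a z k with hr
  have hlast : t n = 0 := by
    simp only [ht, hx]
    rw [awCoeff_eq_zero hQ (Nat.lt_succ_self n)]; ring
  -- The element of index `0` is constant and therefore annihilated, so `t (k - 1)` is used for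
  -- positive `k` only.
  have key : ∀ k, x k * (awPhi Q a b c d z * (awBasis Q a (Q * z) k - awBasis Q a z k)
      + awPhi Q a b c d z⁻¹ * (awBasis Q a (Q⁻¹ * z) k - awBasis Q a z k))
      = r k - if k = 0 then 0 else t (k - 1) := by
    intro k
    rcases k with _ | j
    · simp [hr, awBasis, qPoch_zero]
    · rw [awOperator_awBasis hQ hz h1 h2 h3 ha]
      simp only [hr, ht, Nat.succ_ne_zero, if_false, Nat.add_sub_cancel]
      rw [show ((j + 1 : ℕ) : ℤ) - 1 = j by push_cast; ring, zpow_natCast]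
      ring
  have hsum : ∑ k ∈ Finset.range (n + 1), (if k = 0 then 0 else t (k - 1))
      = ∑ k ∈ Finset.range (n + 1), t k := by
    rw [Finset.sum_range_succ', Finset.sum_range_succ t, hlast]
    simp
  calc _ = (a ^ n)⁻¹ * ∑ k ∈ Finset.range (n + 1),
        x k * (awPhi Q a b c d z * (awBasis Q a (Q * z) k - awBasis Q a z k)
      + awPhi Q a b c d z⁻¹ * (awBasis Q a (Q⁻¹ * z) k - awBasis Q a z k)) := by
        simp only [mul_add, mul_sub, Finset.sum_add_distrib, Finset.sum_sub_distrib, Finset.mul_sum]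
        congr 2 <;> refine Finset.sum_congr rfl fun k _ => by simp only [hx]; ring
    _ = (a ^ n)⁻¹ * ∑ k ∈ Finset.range (n + 1),
          (((Q ^ n)⁻¹ - 1) * (1 - a * b * c * d * Q ^ ((n : ℤ) - 1)) * (x k * awBasis Q a z k)) := by
        rw [Finset.sum_congr rfl fun k _ => key k, Finset.sum_sub_distrib, hsum,
          ← Finset.sum_sub_distrib]
        congr 1
        refine Finset.sum_congr rfl fun k hk => ?_
        have := awOperator_coeff hQ hroot (Nat.lt_succ_iff.mp (Finset.mem_range.mp hk))
          (a := a) b c d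
        simp only [hr, ht, hx]
        linear_combination awBasis Q a z k * this
    _ = _ := by rw [← Finset.mul_sum]; ring

/-! ### Decomposition of symmetric bilinear functionals -/

/-- The end weight; a multiple of the coefficient of `E⁰` at a site with parameter `A` and
variable `w`. -/
def hEnd (Q A w s s' : ℂ) : ℂ :=
  1 - (s + s') * (A * (w + w⁻¹) / (1 + Q)) + s * s' * (A ^ 2 / Q)

/-- The coefficient of the shift `z ↦ Q z` at a site with parameter `β`. -/
def cShift (Q β z s s' : ℂ) : ℂ :=
  (1 - β * z * s) * (1 - β * z * s') / ((1 - z ^ 2) * (1 - Q * z ^ 2))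

/-- The coefficient of the trivial shift at a site with parameter `β`. -/
def cStay (Q β z s s' : ℂ) : ℂ :=
  hEnd Q β z s s' * (Q * (1 + Q) / ((1 - Q * z ^ 2) * (1 - Q * z⁻¹ ^ 2)))

/-- A function of the form `x₀ - (s + s') x₁ + s s' x₂`. -/
def IsPairLinear (F : ℂ → ℂ → ℂ) : Prop :=
  ∃ x₀ x₁ x₂ : ℂ, ∀ s s', F s s' = x₀ - (s + s') * x₁ + s * s' * x₂

/-- Lagrange interpolation on the three-dimensional space spanned by `1`, `s + s'`, `s s'`. Each of
the three coefficients vanishes at two of the pairs `(z/β, Qz/β)`, `(z⁻¹/β, Qz⁻¹/β)`, `(z/β, z⁻¹/β)`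
and equals one at the third. -/
theorem IsPairLinear.decompose {F : ℂ → ℂ → ℂ} (hF : IsPairLinear F) {Q β z : ℂ} (hQ : Q ≠ 0)
    (hQ1 : 1 + Q ≠ 0) (hβ : β ≠ 0) (hz : z ≠ 0) (h1 : 1 - z ^ 2 ≠ 0)
    (h2 : 1 - Q * z ^ 2 ≠ 0) (h3 : 1 - Q * z⁻¹ ^ 2 ≠ 0) (s s' : ℂ) :
    cShift Q β z s s' * F (z / β) (Q * z / β) + cShift Q β z⁻¹ s s' * F (z⁻¹ / β) (Q * z⁻¹ / β)
      + cStay Q β z s s' * F (z / β) (z⁻¹ / β) = F s s' := by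
  obtain ⟨x₀, x₁, x₂, hF⟩ := hF
  have h3' : z ^ 2 - Q ≠ 0 := by
    intro h; apply h3; field_simp; linear_combination h
  have h1' : z ^ 2 - 1 ≠ 0 := by
    intro h; apply h1; linear_combination -h
  have e1 : (1 - z⁻¹ ^ 2) = (z ^ 2 - 1) / z ^ 2 := by field_simp
  have e2 : (1 - Q * z⁻¹ ^ 2) = (z ^ 2 - Q) / z ^ 2 := by field_simp
  have e3 : 1 - z ^ 2 = -(z ^ 2 - 1) := by ring
  have h2' : 1 - z ^ 2 * Q ≠ 0 := by rwa [mul_comm]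
  rw [hF, hF, hF, hF, cShift, cShift, cStay, hEnd, e1, e2, e3, mul_comm Q (z ^ 2)]
  field_simp
  ring

/-! ### The difference operator as a transfer operator -/

/-- The value of the first variable, or `w` when there is none. -/
def headVar (w : ℂ) : {N : ℕ} → (Fin N → ℂ) → ℂ
  | 0, _ => w
  | _ + 1, z => z 0

/-- The transfer operator: the difference operator written as a sum over shifts, with boundary
data `s, s'` to the left of the first variable. -/
def transfer (Q w : ℂ) : (N : ℕ) → (ℕ → ℂ) → ℂ → ℂ → ((Fin N → ℂ) → ℂ) → (Fin N → ℂ) → ℂ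
  | 0, β, s, s', f, z => hEnd Q (β 0) w s s' * f z
  | N + 1, β, s, s', f, z =>
    cShift Q (β 0) (z 0) s s' * transfer Q w N (fun i => β (i + 1)) (z 0 / β 0) (Q * z 0 / β 0)
        (fun y => f (Fin.cons (Q * z 0) y)) (Fin.tail z)
      + cShift Q (β 0) (z 0)⁻¹ s s'
        * transfer Q w N (fun i => β (i + 1)) ((z 0)⁻¹ / β 0) (Q * (z 0)⁻¹ / β 0)
          (fun y => f (Fin.cons (Q⁻¹ * z 0) y)) (Fin.tail z)
      + cStay Q (β 0) (z 0) s s' * transfer Q w N (fun i => β (i + 1)) (z 0 / β 0) ((z 0)⁻¹ / β 0)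
        (fun y => f (Fin.cons (z 0) y)) (Fin.tail z)

theorem transfer_const_mul (Q w : ℂ) {N : ℕ} (β : ℕ → ℂ) (s s' r : ℂ) (f : (Fin N → ℂ) → ℂ)
    (z : Fin N → ℂ) : transfer Q w N β s s' (fun y => r * f y) z
      = r * transfer Q w N β s s' f z := by
  induction N generalizing β s s' with
  | zero => simp only [transfer]; ring
  | succ N ih =>
    simp only [transfer]
    rw [ih _ _ _ (fun y => f (Fin.cons (Q * z 0) y)), ih _ _ _ (fun y => f (Fin.cons (z 0) y)),
      ih _ _ _ (fun y => f (Fin.cons (Q⁻¹ * z 0) y))]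
    ring

theorem isPairLinear_hEnd (Q A w : ℂ) : IsPairLinear (hEnd Q A w) :=
  ⟨1, _, _, fun _ _ => rfl⟩

theorem isPairLinear_cShift (Q β z : ℂ) : IsPairLinear (cShift Q β z) := by
  set D := ((1 - z ^ 2) * (1 - Q * z ^ 2))⁻¹ with hD
  refine ⟨D, β * z * D, (β * z) ^ 2 * D, fun s s' => ?_⟩
  rw [cShift, div_eq_mul_inv, ← hD]
  ring

theorem IsPairLinear.mul_const {F : ℂ → ℂ → ℂ} (h : IsPairLinear F) (r : ℂ) :
    IsPairLinear fun s s' => F s s' * r := by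
  obtain ⟨x₀, x₁, x₂, h⟩ := h
  exact ⟨x₀ * r, x₁ * r, x₂ * r, fun s s' => by simp only [h]; ring⟩

theorem IsPairLinear.add {F G : ℂ → ℂ → ℂ} (h : IsPairLinear F) (h' : IsPairLinear G) :
    IsPairLinear fun s s' => F s s' + G s s' := by
  obtain ⟨x₀, x₁, x₂, h⟩ := h
  obtain ⟨y₀, y₁, y₂, h'⟩ := h'
  exact ⟨x₀ + y₀, x₁ + y₁, x₂ + y₂, fun s s' => by simp only [h, h']; ring⟩

/-- Only the coefficients of the outermost site involve the boundary pair, so no induction is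
needed. -/
theorem isPairLinear_transfer (Q w : ℂ) {N : ℕ} (β : ℕ → ℂ) (f : (Fin N → ℂ) → ℂ)
    (z : Fin N → ℂ) : IsPairLinear fun s s' => transfer Q w N β s s' f z := by
  cases N with
  | zero => exact (isPairLinear_hEnd Q (β 0) w).mul_const _
  | succ N =>
    exact (((isPairLinear_cShift Q (β 0) (z 0)).mul_const _).add
      ((isPairLinear_cShift Q (β 0) (z 0)⁻¹).mul_const _)).add
      (((isPairLinear_hEnd Q (β 0) (z 0)).mul_const _).mul_const _)

/-! ### Local exchange relations -/

/-- The factor of a Gasper-Rahman polynomial in the variable `z` followed by `w`, with parameters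
`β`, `β'`. -/
def siteFactor (Q : ℂ) (n : ℕ) (β β' s s' z w : ℂ) : ℂ :=
  awPoly Q n z (β * s) (β * s') (β' / β * w) (β' / β * w⁻¹)

theorem siteFactor_inv (Q : ℂ) (n : ℕ) (β β' s s' z w : ℂ) :
    siteFactor Q n β β' s s' z w⁻¹ = siteFactor Q n β β' s s' z w := by
  rw [siteFactor, siteFactor, inv_inv, awPoly_swap_right]

/-- The three-term combination of shifts at a site, applied to `F` and `p`. -/
def siteSum (Q β z s s' : ℂ) (F : ℂ → ℂ → ℂ) (p : ℂ → ℂ) : ℂ :=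
  cShift Q β z s s' * F (z / β) (Q * z / β) * p (Q * z)
    + cShift Q β z⁻¹ s s' * F (z⁻¹ / β) (Q * z⁻¹ / β) * p (Q⁻¹ * z)
    + cStay Q β z s s' * F (z / β) (z⁻¹ / β) * p z

/-- At the pairs `(y/β, Qy/β)` the end weight factors into the two Askey-Wilson factors containing
`w`, so the shift terms are those of the Askey-Wilson operator. Interpolation accounts for the part
without shift. -/
theorem siteSum_hEnd {Q : ℂ} (hQ : Q ≠ 0) (hQ1 : 1 + Q ≠ 0) (hroot : ∀ k : ℕ, 0 < k → Q ^ k ≠ 1)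
    {β β' s s' z w : ℂ} (hβ : β ≠ 0) (hs : s ≠ 0) (hz : z ≠ 0) (hw : w ≠ 0) (h1 : 1 - z ^ 2 ≠ 0)
    (h2 : 1 - Q * z ^ 2 ≠ 0) (h3 : 1 - Q * z⁻¹ ^ 2 ≠ 0) (n : ℕ) :
    siteSum Q β z s s' (hEnd Q β' w) (fun y => siteFactor Q n β β' s s' y w)
      = (Q ^ n)⁻¹ * hEnd Q β' w (s * Q ^ n) (s' * Q ^ n) * siteFactor Q n β β' s s' z w := by
  have hd := (isPairLinear_hEnd Q β' w).decompose hQ hQ1 hβ hz h1 h2 h3 s s'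
  have ho := awOperator_awPoly hQ hroot hz h1 h2 h3 (mul_ne_zero hβ hs) (β * s')
    (β' / β * w) (β' / β * w⁻¹) n
  have hh : ∀ y, y ≠ 0 → hEnd Q β' w (y / β) (Q * y / β)
      = (1 - β' / β * w * y) * (1 - β' / β * w⁻¹ * y) := by
    intro y hy; rw [hEnd]; field_simp; ring
  have hphi : ∀ y, y ≠ 0 → cShift Q β y s s' * hEnd Q β' w (y / β) (Q * y / β)
      = awPhi Q (β * s) (β * s') (β' / β * w) (β' / β * w⁻¹) y := by
    intro y hy; rw [hh y hy, awPhi, cShift]; ring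
  rw [← hphi z hz, ← hphi _ (inv_ne_zero hz)] at ho
  -- The Askey-Wilson eigenvalue together with the constant from the interpolation is the end weight
  -- at scaled boundary data.
  have hval : ((Q ^ n)⁻¹ - 1) * (1 - β * s * (β * s') * (β' / β * w) * (β' / β * w⁻¹)
      * Q ^ ((n : ℤ) - 1)) + hEnd Q β' w s s'
      = (Q ^ n)⁻¹ * hEnd Q β' w (s * Q ^ n) (s' * Q ^ n) := by
    rw [zpow_sub₀ hQ, zpow_natCast, zpow_one, hEnd, hEnd]
    have := pow_ne_zero n hQ
    field_simp
    ring
  rw [← hval, siteSum]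
  simp only [siteFactor]
  linear_combination ho + hd * awPoly Q n z (β * s) (β * s') (β' / β * w) (β' / β * w⁻¹)

/-- Replacing `(c, d)` by `(Qc, d/Q)` preserves `cd` and the product of all four parameters, so only
the tails in `ca` and `cb` change, each by a ratio of two linear factors. -/
theorem awCoeff_contiguous {Q : ℂ} (hQ : Q ≠ 0) {n k : ℕ} (hk : k ≤ n) (c b a d : ℂ) :
    awCoeff Q n k (Q * c) b a (Q⁻¹ * d) * ((1 - c * Q ^ k * a) * (1 - c * Q ^ k * b))
      = (1 - c * Q ^ n * a) * (1 - c * Q ^ n * b) * awCoeff Q n k c b a d := by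
  have e : ∀ x, qPoch (Q * c * x * Q ^ k) Q (n - k) * (1 - c * Q ^ k * x)
      = qPoch (c * x * Q ^ k) Q (n - k) * (1 - c * Q ^ n * x) := by
    intro x
    have h1 := qPoch_succ (c * x * Q ^ k) Q (n - k)
    have h2 : Q ^ n = Q ^ k * Q ^ (n - k) := by rw [← pow_add, Nat.add_sub_cancel' hk]
    rw [qPoch_succ'] at h1
    rw [h2, show Q * c * x * Q ^ k = c * x * Q ^ k * Q by ring]
    linear_combination h1
  have hc : Q * c * (Q⁻¹ * d) * Q ^ k = c * d * Q ^ k := by field_simp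
  have hg : Q * c * b * a * (Q⁻¹ * d) = c * b * a * d := by field_simp
  rw [awCoeff, awCoeff, awTail, awTail, hc, hg]
  linear_combination (qPoch (Q ^ (-(n : ℤ))) Q k * qPoch (c * b * a * d * Q ^ ((n : ℤ) - 1)) Q k
    / qPoch Q Q k * Q ^ k * qPoch (c * d * Q ^ k) Q (n - k))
    * (qPoch (Q * c * b * Q ^ k) Q (n - k) * (1 - c * Q ^ k * b) * e a
      + qPoch (c * a * Q ^ k) Q (n - k) * (1 - c * Q ^ n * a) * e b)

theorem awBasis_contiguous {Q : ℂ} (hQ : Q ≠ 0) {c z : ℂ} (hz : z ≠ 0) (k : ℕ) :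
    (1 - c * z) * (1 - c * (Q * z)) * awBasis Q (Q * c) (Q * z) k
      = awBasis Q c z k * ((1 - c * Q ^ k * z) * (1 - c * Q ^ k * (Q * z))) := by
  have h := (qPoch_succ' (c * z) Q (k + 1)).symm.trans (qPoch_succ (c * z) Q (k + 1))
  rw [qPoch_succ' (c * z * Q), qPoch_succ (c * z)] at h
  have e : Q * c * (Q * z)⁻¹ = c * z⁻¹ := by field_simp
  rw [awBasis, awBasis, e, show Q * c * (Q * z) = c * z * Q * Q by ring]
  rw [pow_succ] at h
  linear_combination qPoch (c * z⁻¹) Q k * h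

theorem awBasis_contiguous_stay (Q c z : ℂ) (k : ℕ) :
    (1 - c * z) * (1 - c * z⁻¹) * awBasis Q (Q * c) z k
      = awBasis Q c z k * ((1 - c * Q ^ k * z) * (1 - c * Q ^ k * z⁻¹)) := by
  have h := qPoch_succ (c * z) Q k
  have h' := qPoch_succ (c * z⁻¹) Q k
  rw [qPoch_succ'] at h h'
  rw [awBasis, awBasis, show Q * c * z = c * z * Q by ring, show Q * c * z⁻¹ = c * z⁻¹ * Q by ring]
  linear_combination (1 - c * z⁻¹) * qPoch (c * z⁻¹ * Q) Q k * h
    + qPoch (c * z) Q k * (1 - c * z * Q ^ k) * h'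

/-- This is the exchange relation for a neighbour moving from `w` to `Q w`. It holds term by term in
the expansion: the contiguous relations turn the basis for `Qc` into the basis for `c`, the
interpolation formula sums the three shifts, and the remaining factor converts the coefficients. -/
theorem siteSum_shift {q : ℂ} (hq : q ≠ 0) (hQ1 : 1 + q ^ 2 ≠ 0)
    (hroot : ∀ k : ℕ, 0 < k → (q ^ 2) ^ k ≠ 1)
    {β β' s s' z w : ℂ} (hβ : β ≠ 0) (hβ' : β' ≠ 0) (hs : s ≠ 0) (hw : w ≠ 0) (hz : Generic q z)
    (h1 : 1 - z ^ 2 ≠ 0) (h2 : 1 - q ^ 2 * z ^ 2 ≠ 0) (h3 : 1 - q ^ 2 * z⁻¹ ^ 2 ≠ 0) (n : ℕ) :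
    siteSum (q ^ 2) β z s s' (fun t t' => (1 - β' * w * t) * (1 - β' * w * t'))
        (fun y => siteFactor (q ^ 2) n β β' s s' y (q ^ 2 * w))
      = ((q ^ 2) ^ n)⁻¹ * ((1 - β' * w * (s * (q ^ 2) ^ n)) * (1 - β' * w * (s' * (q ^ 2) ^ n)))
        * siteFactor (q ^ 2) n β β' s s' z w := by
  have hQ : q ^ 2 ≠ 0 := pow_ne_zero 2 hq
  have ha : β * s ≠ 0 := mul_ne_zero hβ hs
  have hc : β' / β * w ≠ 0 := mul_ne_zero (div_ne_zero hβ' hβ) hw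
  have hc' : β' / β * (q ^ 2 * w) ≠ 0 := mul_ne_zero (div_ne_zero hβ' hβ) (mul_ne_zero hQ hw)
  have hzp : Generic q (q ^ 2 * z) := by simpa using hz.mul_zpow hq 2
  have hzm : Generic q ((q ^ 2)⁻¹ * z) := by
    have := hz.mul_zpow hq (-2)
    rwa [zpow_neg, zpow_ofNat] at this
  simp only [siteSum, siteFactor]
  -- With the parameter containing `w` as the base of the expansion, shifting `w` acts by `c ↦ Qc`,
  -- `d ↦ d/Q`.
  rw [awPoly_swap hq hroot n hz ha hc, awPoly_swap hq hroot n hzp ha hc',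
    awPoly_swap hq hroot n hz ha hc', awPoly_swap hq hroot n hzm ha hc']
  set Q := q ^ 2 with hQdef
  set c := β' / β * w with hcdef
  have e1 : β' / β * (Q * w) = Q * c := by rw [hcdef]; ring
  have e2 : β' / β * (Q * w)⁻¹ = Q⁻¹ * (β' / β * w⁻¹) := by rw [mul_inv]; ring
  have e3 : β' * w = β * c := by rw [hcdef]; field_simp
  have e4 : ∀ x, β' * w * (x / β) = c * x := by intro x; rw [e3]; field_simp
  simp only [e1, e2, awPoly_eq_sum, e4]
  set d := β' / β * w⁻¹
  have key : ∀ k, cShift Q β z s s' * ((1 - c * z) * (1 - c * (Q * z)))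
        * awBasis Q (Q * c) (Q * z) k
      + cShift Q β z⁻¹ s s' * ((1 - c * z⁻¹) * (1 - c * (Q * z⁻¹)))
        * awBasis Q (Q * c) (Q⁻¹ * z) k
      + cStay Q β z s s' * ((1 - c * z) * (1 - c * z⁻¹)) * awBasis Q (Q * c) z k
      = awBasis Q c z k * ((1 - c * Q ^ k * (β * s)) * (1 - c * Q ^ k * (β * s'))) := by
    intro k
    have b1 := awBasis_contiguous hQ (c := c) hz.1 k
    have b2 := awBasis_contiguous hQ (c := c) (inv_ne_zero hz.1) k
    rw [awBasis_inv, ← awBasis_inv Q (Q * c), mul_inv, inv_inv] at b2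
    have b3 := awBasis_contiguous_stay Q c z k
    -- The index `k` enters this weight only by scaling `c`, so the same interpolation formula
    -- serves every term of the series.
    have hlin : IsPairLinear fun t t' => (1 - β * (c * Q ^ k) * t) * (1 - β * (c * Q ^ k) * t') :=
      ⟨1, β * (c * Q ^ k), (β * (c * Q ^ k)) ^ 2, fun t t' => by ring⟩
    have hd := hlin.decompose hQ hQ1 hβ hz.1 h1 h2 h3 s s'
    have e5 : ∀ x, β * (c * Q ^ k) * (x / β) = c * Q ^ k * x := by intro x; field_simp
    simp only [e5] at hd
    linear_combination cShift Q β z s s' * b1 + cShift Q β z⁻¹ s s' * b2 + cStay Q β z s s' * b3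
      + awBasis Q c z k * hd
  calc _ = ((Q * c) ^ n)⁻¹ * ∑ k ∈ Finset.range (n + 1),
        awCoeff Q n k (Q * c) (β * s') (β * s) (Q⁻¹ * d)
        * (cShift Q β z s s' * ((1 - c * z) * (1 - c * (Q * z)))
        * awBasis Q (Q * c) (Q * z) k
      + cShift Q β z⁻¹ s s' * ((1 - c * z⁻¹) * (1 - c * (Q * z⁻¹)))
        * awBasis Q (Q * c) (Q⁻¹ * z) k
      + cStay Q β z s s' * ((1 - c * z) * (1 - c * z⁻¹)) * awBasis Q (Q * c) z k) := by
        simp only [mul_add, Finset.sum_add_distrib, Finset.mul_sum]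
        congr 1
        · congr 1 <;> exact Finset.sum_congr rfl fun k _ => by ring
        · exact Finset.sum_congr rfl fun k _ => by ring
    _ = ((Q * c) ^ n)⁻¹ * ∑ k ∈ Finset.range (n + 1),
        (1 - c * Q ^ n * (β * s)) * (1 - c * Q ^ n * (β * s'))
          * (awCoeff Q n k c (β * s') (β * s) d * awBasis Q c z k) := by
        congr 1
        refine Finset.sum_congr rfl fun k hk => ?_
        have := awCoeff_contiguous hQ (Nat.lt_succ_iff.mp (Finset.mem_range.mp hk)) c (β * s')
          (β * s) d
        rw [key]
        linear_combination awBasis Q c z k * this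
    _ = _ := by
        rw [← Finset.mul_sum, e3, mul_pow, mul_inv]
        ring

theorem siteSum_shift_inv {q : ℂ} (hq : q ≠ 0) (hQ1 : 1 + q ^ 2 ≠ 0)
    (hroot : ∀ k : ℕ, 0 < k → (q ^ 2) ^ k ≠ 1)
    {β β' s s' z w : ℂ} (hβ : β ≠ 0) (hβ' : β' ≠ 0) (hs : s ≠ 0) (hw : w ≠ 0) (hz : Generic q z)
    (h1 : 1 - z ^ 2 ≠ 0) (h2 : 1 - q ^ 2 * z ^ 2 ≠ 0) (h3 : 1 - q ^ 2 * z⁻¹ ^ 2 ≠ 0) (n : ℕ) :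
    siteSum (q ^ 2) β z s s' (fun t t' => (1 - β' * w⁻¹ * t) * (1 - β' * w⁻¹ * t'))
        (fun y => siteFactor (q ^ 2) n β β' s s' y ((q ^ 2)⁻¹ * w))
      = ((q ^ 2) ^ n)⁻¹ * ((1 - β' * w⁻¹ * (s * (q ^ 2) ^ n))
          * (1 - β' * w⁻¹ * (s' * (q ^ 2) ^ n)))
        * siteFactor (q ^ 2) n β β' s s' z w := by
  have := siteSum_shift hq hQ1 hroot (s' := s') hβ hβ' hs (inv_ne_zero hw) hz h1 h2 h3 n
  rw [siteFactor_inv] at this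
  have e : (fun y => siteFactor (q ^ 2) n β β' s s' y ((q ^ 2)⁻¹ * w))
      = fun y => siteFactor (q ^ 2) n β β' s s' y (q ^ 2 * w⁻¹) := by
    funext y
    rw [← siteFactor_inv, mul_inv, inv_inv]
  rw [e]
  exact this

theorem Generic.sub_ne_zero {q z : ℂ} (h : Generic q z) :
    1 - z ^ 2 ≠ 0 ∧ 1 - q ^ 2 * z ^ 2 ≠ 0 ∧ 1 - q ^ 2 * z⁻¹ ^ 2 ≠ 0 := by
  refine ⟨fun e => h.2 0 ?_, fun e => h.2 1 ?_, fun e => h.inv.2 1 ?_⟩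
  · rw [zpow_zero]; linear_combination -e
  · rw [zpow_one]; linear_combination -e
  · rw [zpow_one]; linear_combination -e

/-! ### The eigenvalue equation -/

/-- The Gasper-Rahman polynomial, built up from the first variable on. -/
def grPoly (Q w : ℂ) : (N : ℕ) → (ℕ → ℂ) → ℂ → ℂ → (Fin N → ℕ) → (Fin N → ℂ) → ℂ
  | 0, _, _, _, _, _ => 1
  | N + 1, β, s, s', n, z =>
    siteFactor Q (n 0) (β 0) (β 1) s s' (z 0) (headVar w (Fin.tail z))
      * grPoly Q w N (fun i => β (i + 1)) (s * Q ^ n 0) (s' * Q ^ n 0) (Fin.tail n) (Fin.tail z)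

/-- The factor at the first site depends on the second variable, so the next site's move decides
which exchange relation applies: forward, backward or no shift. Without a next site, the end weight
takes its place. -/
theorem transfer_siteFactor_mul {q w : ℂ} (hq : q ≠ 0) (hQ1 : 1 + q ^ 2 ≠ 0)
    (hroot : ∀ k : ℕ, 0 < k → (q ^ 2) ^ k ≠ 1) (hw : w ≠ 0) {N : ℕ} {β : ℕ → ℂ}
    (hβ : ∀ i ≤ N + 1, β i ≠ 0) {s s' : ℂ} (hs : s ≠ 0) (n : ℕ) {z : Fin (N + 1) → ℂ}
    (hz : ∀ i, Generic q (z i)) (g : (Fin N → ℂ) → ℂ) :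
    transfer (q ^ 2) w (N + 1) β s s' (fun y =>
        siteFactor (q ^ 2) n (β 0) (β 1) s s' (y 0) (headVar w (Fin.tail y)) * g (Fin.tail y)) z
      = ((q ^ 2) ^ n)⁻¹ * siteFactor (q ^ 2) n (β 0) (β 1) s s' (z 0) (headVar w (Fin.tail z))
        * transfer (q ^ 2) w N (fun i => β (i + 1)) (s * (q ^ 2) ^ n) (s' * (q ^ 2) ^ n) g
          (Fin.tail z) := by
  have hQ : q ^ 2 ≠ 0 := pow_ne_zero 2 hq
  have hβ0 := hβ 0 (Nat.zero_le _)
  have hβ1 := hβ 1 (by omega)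
  obtain ⟨h1, h2, h3⟩ := (hz 0).sub_ne_zero
  cases N with
  | zero =>
    have := siteSum_hEnd (β' := β 1) (s' := s') hQ hQ1 hroot hβ0 hs (hz 0).1 hw h1 h2 h3 n
    simp only [siteSum] at this
    simp only [transfer, headVar, Fin.cons_zero, Fin.tail_cons, zero_add]
    linear_combination g (Fin.tail z) * this
  | succ N =>
    have hz1 := hz 1
    have e0 := siteSum_hEnd (β' := β 1) (s' := s') hQ hQ1 hroot hβ0 hs (hz 0).1 hz1.1 h1 h2 h3 n
    have e1 := siteSum_shift (s' := s') hq hQ1 hroot hβ0 hβ1 hs hz1.1 (hz 0) h1 h2 h3 n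
    have e2 := siteSum_shift_inv (s' := s') hq hQ1 hroot hβ0 hβ1 hs hz1.1 (hz 0) h1 h2 h3 n
    simp only [siteSum] at e0 e1 e2
    have ht : (Fin.tail z : Fin (N + 1) → ℂ) 0 = z 1 := rfl
    simp only [transfer, headVar, Fin.cons_zero, Fin.tail_cons, zero_add, ht, transfer_const_mul]
    generalize transfer (q ^ 2) w N (fun i => β (i + 1 + 1)) (z 1 / β 1) (q ^ 2 * z 1 / β 1)
      (fun y => g (Fin.cons (q ^ 2 * z 1) y)) (Fin.tail (Fin.tail z)) = U1
    generalize transfer (q ^ 2) w N (fun i => β (i + 1 + 1)) ((z 1)⁻¹ / β 1)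
      (q ^ 2 * (z 1)⁻¹ / β 1)
      (fun y => g (Fin.cons ((q ^ 2)⁻¹ * z 1) y)) (Fin.tail (Fin.tail z)) = U2
    generalize transfer (q ^ 2) w N (fun i => β (i + 1 + 1)) (z 1 / β 1) ((z 1)⁻¹ / β 1)
      (fun y => g (Fin.cons (z 1) y)) (Fin.tail (Fin.tail z)) = U3
    -- Up to factors free of the boundary pair, the coefficients of the second site are exactly the
    -- three weights in `e1`, `e2` and `e0`.
    have c1 : ∀ t t', cShift (q ^ 2) (β 1) (z 1) t t'
      = (1 - β 1 * z 1 * t) * (1 - β 1 * z 1 * t')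
        / ((1 - z 1 ^ 2) * (1 - q ^ 2 * z 1 ^ 2)) := fun _ _ => rfl
    have c2 : ∀ t t', cShift (q ^ 2) (β 1) (z 1)⁻¹ t t'
      = (1 - β 1 * (z 1)⁻¹ * t) * (1 - β 1 * (z 1)⁻¹ * t')
        / ((1 - (z 1)⁻¹ ^ 2) * (1 - q ^ 2 * (z 1)⁻¹ ^ 2)) := fun _ _ => rfl
    have c3 : ∀ t t', cStay (q ^ 2) (β 1) (z 1) t t' = hEnd (q ^ 2) (β 1) (z 1) t t'
      * (q ^ 2 * (1 + q ^ 2) / ((1 - q ^ 2 * z 1 ^ 2) * (1 - q ^ 2 * (z 1)⁻¹ ^ 2))) :=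
      fun _ _ => rfl
    simp only [c1, c2, c3]
    clear c1 c2 c3
    linear_combination U1 / ((1 - z 1 ^ 2) * (1 - q ^ 2 * z 1 ^ 2)) * e1
      + U2 / ((1 - (z 1)⁻¹ ^ 2) * (1 - q ^ 2 * (z 1)⁻¹ ^ 2)) * e2
      + U3 * (q ^ 2 * (1 + q ^ 2) / ((1 - q ^ 2 * z 1 ^ 2) * (1 - q ^ 2 * (z 1)⁻¹ ^ 2))) * e0

/-- Each site contributes a factor `Q^{-n_i}` and scales the boundary pair by `Q^{n_i}`, so after
all sites only the total degree enters the eigenvalue. -/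
theorem transfer_grPoly {q w : ℂ} (hq : q ≠ 0) (hQ1 : 1 + q ^ 2 ≠ 0)
    (hroot : ∀ k : ℕ, 0 < k → (q ^ 2) ^ k ≠ 1) (hw : w ≠ 0) {N : ℕ} {β : ℕ → ℂ}
    (hβ : ∀ i ≤ N, β i ≠ 0) {s s' : ℂ} (hs : s ≠ 0) (n : Fin N → ℕ) {z : Fin N → ℂ}
    (hz : ∀ i, Generic q (z i)) :
    transfer (q ^ 2) w N β s s' (grPoly (q ^ 2) w N β s s' n) z
      = ((q ^ 2) ^ ∑ i, n i)⁻¹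
        * hEnd (q ^ 2) (β N) w (s * (q ^ 2) ^ ∑ i, n i) (s' * (q ^ 2) ^ ∑ i, n i)
        * grPoly (q ^ 2) w N β s s' n z := by
  induction N generalizing β s s' with
  | zero => simp [transfer, grPoly]
  | succ N ih =>
    have hQ : q ^ 2 ≠ 0 := pow_ne_zero 2 hq
    have := transfer_siteFactor_mul (s' := s') hq hQ1 hroot hw hβ hs (n 0) hz
      (grPoly (q ^ 2) w N (fun i => β (i + 1)) (s * (q ^ 2) ^ n 0) (s' * (q ^ 2) ^ n 0)
        (Fin.tail n))
    rw [ih (fun i hi => hβ (i + 1) (by omega)) (mul_ne_zero hs (pow_ne_zero _ hQ)) (Fin.tail n)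
      (z := Fin.tail z) (fun i => hz i.succ)] at this
    have hsum : ∑ i, n i = n 0 + ∑ i, Fin.tail n i := Fin.sum_univ_succ n
    rw [hsum, pow_add]
    refine this.trans ?_
    rw [grPoly, mul_inv, mul_assoc s, mul_assoc s']
    ring

/-! ### The transfer operator on the discrete support -/

/-- The support point with label `μ`, where `μ i` is the exponent of `z_i / z_{i+1}`. -/
def gridPt (Q w : ℂ) : (N : ℕ) → (ℕ → ℂ) → (Fin N → ℕ) → Fin N → ℂ
  | 0, _, _ => Fin.elim0
  | N + 1, β, μ =>
    Fin.cons (β 1 / β 0 * headVar w (gridPt Q w N (fun i => β (i + 1)) (Fin.tail μ)) * Q ^ μ 0)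
      (gridPt Q w N (fun i => β (i + 1)) (Fin.tail μ))

theorem headVar_gridPt (Q w : ℂ) {N : ℕ} {β : ℕ → ℂ} (hβ : ∀ i ≤ N, β i ≠ 0) (μ : Fin N → ℕ) :
    headVar w (gridPt Q w N β μ) = β N / β 0 * w * Q ^ ∑ i, μ i := by
  induction N generalizing β with
  | zero => simp [headVar, div_self (hβ 0 le_rfl)]
  | succ N ih =>
    have h0 := hβ 0 (Nat.zero_le _)
    have h1 := hβ 1 (by omega)
    have hsum : ∑ i, μ i = μ 0 + ∑ i, Fin.tail μ i := Fin.sum_univ_succ μ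
    rw [gridPt, headVar, Fin.cons_zero, ih (fun i hi => hβ (i + 1) (by omega)), hsum, pow_add]
    field_simp

/-- The span of the evaluations at those support points whose total exponent differs from that of
`μ` by `e`. -/
def gridSpan (Q w : ℂ) {N : ℕ} (β : ℕ → ℂ) (J μ : Fin N → ℕ) (e : ℤ) :
    Submodule ℂ (((Fin N → ℂ) → ℂ) → ℂ) :=
  Submodule.span ℂ {L | ∃ μ' : Fin N → ℕ, (∀ i, μ' i ≤ J i) ∧
    ((∑ i, μ' i : ℕ) : ℤ) = (∑ i, μ i : ℕ) + e ∧ L = fun f => f (gridPt Q w N β μ')}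

/-- Prepending a variable to functionals on the shorter chain. Labels record ratios of neighbouring
variables, so a total change `e` in the tail must be compensated in the first component; the
hypothesis on `r` discards the moves out of the box. -/
theorem gridSpan_push {Q w : ℂ} (hQ : Q ≠ 0) {N : ℕ} {β : ℕ → ℂ} (hβ : ∀ i ≤ N + 1, β i ≠ 0)
    {J μ : Fin (N + 1) → ℕ} {e ε : ℤ} {L : ((Fin N → ℂ) → ℂ) → ℂ}
    (hL : L ∈ gridSpan Q w (fun i => β (i + 1)) (Fin.tail J) (Fin.tail μ) e) {x r : ℂ}
    (hx : x = Q ^ ε * gridPt Q w (N + 1) β μ 0)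
    (hr : (μ 0 : ℤ) + ε - e < 0 ∨ (J 0 : ℤ) < μ 0 + ε - e → r = 0) :
    (fun f : (Fin (N + 1) → ℂ) → ℂ => r * L fun y => f (Fin.cons x y))
      ∈ gridSpan Q w β J μ ε := by
  by_cases h : (μ 0 : ℤ) + ε - e < 0 ∨ (J 0 : ℤ) < μ 0 + ε - e
  · rw [hr h]
    simp only [zero_mul]
    exact Submodule.zero_mem _
  -- The new first component of the label.
  obtain ⟨k, hk⟩ := Int.eq_ofNat_of_zero_le (show 0 ≤ (μ 0 : ℤ) + ε - e by omega)
  have hkJ : k ≤ J 0 := by omega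
  refine Submodule.smul_mem _ r (x := fun f : (Fin (N + 1) → ℂ) → ℂ => L fun y => f (Fin.cons x y)) ?_
  rw [gridSpan] at hL
  induction hL using Submodule.span_induction with
  | zero => exact Submodule.zero_mem _
  | add _ _ _ _ h1 h2 => exact Submodule.add_mem _ h1 h2
  | smul c _ _ h1 => exact Submodule.smul_mem _ c h1
  | mem L hL =>
    obtain ⟨μ', h1, h2, rfl⟩ := hL
    refine Submodule.subset_span ⟨Fin.cons k μ', ?_, ?_, ?_⟩
    · intro i
      refine Fin.cases ?_ (fun j => ?_) i
      · exact hkJ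
      · exact h1 j
    · have hsum : ∑ i, μ i = μ 0 + ∑ i, Fin.tail μ i := Fin.sum_univ_succ μ
      rw [Fin.sum_cons, hsum]
      push_cast at h2 ⊢
      omega
    · funext f
      have hβ' : ∀ i ≤ N, β (i + 1) ≠ 0 := fun i hi => hβ (i + 1) (by omega)
      rw [gridPt, Fin.tail_cons, Fin.cons_zero, hx, gridPt, Fin.cons_zero,
        headVar_gridPt Q w hβ', headVar_gridPt Q w hβ']
      refine congrArg (fun t => f (Fin.cons t (gridPt Q w N (fun i => β (i + 1)) μ'))) ?_
      have e3 : Q ^ (∑ i, μ' i) * Q ^ k = Q ^ ε * (Q ^ (∑ i, Fin.tail μ i) * Q ^ μ 0) := by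
        simp only [← zpow_natCast, ← zpow_add₀ hQ]
        rw [h2, show (k : ℤ) = μ 0 + ε - e from hk.symm]
        congr 1
        ring
      linear_combination -(β 1 / β 0 * (β (N + 1) / β (0 + 1) * w)) * e3

theorem gridSpan_add_three {Q w : ℂ} {N : ℕ} {β : ℕ → ℂ} {J μ : Fin N → ℕ} {ε : ℤ}
    {L₁ L₂ L₃ : ((Fin N → ℂ) → ℂ) → ℂ} (h₁ : L₁ ∈ gridSpan Q w β J μ ε)
    (h₂ : L₂ ∈ gridSpan Q w β J μ ε) (h₃ : L₃ ∈ gridSpan Q w β J μ ε) (r : ℂ) :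
    (fun f => r * (L₁ f + L₂ f + L₃ f)) ∈ gridSpan Q w β J μ ε :=
  Submodule.smul_mem _ r (Submodule.add_mem _ (Submodule.add_mem _ h₁ h₂) h₃)

/-- The terms are grouped by the move of the first variable, which changes the total label by `1`,
`-1` or `0`. The three functionals must not depend on `s, s'`, because the induction uses them at
the different boundary pairs created by one more site. -/
theorem transfer_gridPt {Q w : ℂ} (hQ : Q ≠ 0) (hQ1 : 1 + Q ≠ 0) (hw : w ≠ 0) {N : ℕ} {β : ℕ → ℂ}
    (hβ : ∀ i ≤ N, β i ≠ 0) {J : Fin N → ℕ}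
    (hJ : ∀ i : Fin N, (β (i + 1) / β i) ^ 2 * Q ^ J i = 1) {μ : Fin N → ℕ} (hμ : ∀ i, μ i ≤ J i) :
    ∃ Lp ∈ gridSpan Q w β J μ 1, ∃ Lm ∈ gridSpan Q w β J μ (-1), ∃ L ∈ gridSpan Q w β J μ 0,
      ∀ s s' f, transfer Q w N β s s' f (gridPt Q w N β μ)
        = (1 - β 0 * headVar w (gridPt Q w N β μ) * s)
            * (1 - β 0 * headVar w (gridPt Q w N β μ) * s') * Lp f
          + (1 - β 0 * (headVar w (gridPt Q w N β μ))⁻¹ * s)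
            * (1 - β 0 * (headVar w (gridPt Q w N β μ))⁻¹ * s') * Lm f
          + hEnd Q (β 0) (headVar w (gridPt Q w N β μ)) s s' * L f := by
  induction N generalizing β with
  | zero =>
    refine ⟨0, Submodule.zero_mem _, 0, Submodule.zero_mem _, fun f => f (gridPt Q w 0 β μ),
      Submodule.subset_span ⟨μ, hμ, by simp, rfl⟩, fun s s' f => ?_⟩
    simp [transfer, headVar]
  | succ N ih =>
    have hβ' : ∀ i ≤ N, β (i + 1) ≠ 0 := fun i hi => hβ (i + 1) (by omega)
    have h0 := hβ 0 (Nat.zero_le _)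
    have h1 := hβ 1 (by omega)
    obtain ⟨Lp, hLp, Lm, hLm, L, hL, h⟩ := ih hβ' (J := Fin.tail J) (fun i => hJ i.succ)
      (μ := Fin.tail μ) (fun i => hμ i.succ)
    have hx0 : headVar w (gridPt Q w N (fun i => β (i + 1)) (Fin.tail μ)) ≠ 0 := by
      rw [headVar_gridPt Q w hβ']
      exact mul_ne_zero (mul_ne_zero (div_ne_zero (hβ' N le_rfl) (hβ' 0 (Nat.zero_le _))) hw)
        (pow_ne_zero _ hQ)
    set x := headVar w (gridPt Q w N (fun i => β (i + 1)) (Fin.tail μ)) with hx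
    set z0 := β 1 / β 0 * x * Q ^ μ 0 with hz0
    have hgrid : gridPt Q w (N + 1) β μ
        = Fin.cons z0 (gridPt Q w N (fun i => β (i + 1)) (Fin.tail μ)) := by
      rw [gridPt]
    have hgz : gridPt Q w (N + 1) β μ 0 = z0 := by rw [hgrid, Fin.cons_zero]
    have hz0' : z0 ≠ 0 := mul_ne_zero (mul_ne_zero (div_ne_zero h1 h0) hx0) (pow_ne_zero _ hQ)
    have hp1 : Q * z0 = Q ^ (1 : ℤ) * gridPt Q w (N + 1) β μ 0 := by rw [hgz, zpow_one]
    have hp2 : Q⁻¹ * z0 = Q ^ (-1 : ℤ) * gridPt Q w (N + 1) β μ 0 := by rw [hgz, zpow_neg_one]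
    have hp3 : z0 = Q ^ (0 : ℤ) * gridPt Q w (N + 1) β μ 0 := by rw [hgz, zpow_zero, one_mul]
    have hQm : Q ^ μ 0 ≠ 0 := pow_ne_zero _ hQ
    -- These two values control the walls: the lower one because the component is zero there, the
    -- upper one because `(β 1 / β 0)² Q^{J 0} = 1`. The factors `l0`, `l1`, `u0`, `u1` remove moves
    -- by one or two steps across a wall.
    have hlow : β 1 * x * (z0⁻¹ / β 0) = (Q ^ μ 0)⁻¹ := by
      rw [hz0]; field_simp
    have hhigh : β 1 * x⁻¹ * (z0 / β 0) = (Q ^ (J 0 - μ 0))⁻¹ := by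
      have e1 := hJ 0
      rw [← Nat.sub_add_cancel (hμ 0), pow_add] at e1
      simp only [Fin.val_zero, zero_add] at e1
      apply eq_inv_of_mul_eq_one_left
      rw [← e1, hz0]
      field_simp
    have hend : ∀ t, hEnd Q (β 1) x t (Q * t)
        = (1 - β 1 * x * t) * (1 - β 1 * x⁻¹ * t) := by
      intro t; rw [hEnd]; field_simp; ring
    have hmu := hμ 0
    have l0 : μ 0 = 0 → 1 - β 1 * x * (z0⁻¹ / β 0) = 0 := by
      intro e; rw [hlow, e]; simp
    have l1 : μ 0 = 1 → 1 - β 1 * x * (Q * z0⁻¹ / β 0) = 0 := by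
      intro e
      rw [show β 1 * x * (Q * z0⁻¹ / β 0) = Q * (β 1 * x * (z0⁻¹ / β 0)) by ring, hlow, e, pow_one,
        mul_inv_cancel₀ hQ, sub_self]
    have u0 : J 0 - μ 0 = 0 → 1 - β 1 * x⁻¹ * (z0 / β 0) = 0 := by
      intro e; rw [hhigh, e]; simp
    have u1 : J 0 - μ 0 = 1 → 1 - β 1 * x⁻¹ * (Q * z0 / β 0) = 0 := by
      intro e
      rw [show β 1 * x⁻¹ * (Q * z0 / β 0) = Q * (β 1 * x⁻¹ * (z0 / β 0)) by ring, hhigh, e, pow_one,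
        mul_inv_cancel₀ hQ, sub_self]
    refine ⟨_, gridSpan_add_three
        (gridSpan_push hQ hβ hLp hp1
          (r := (1 - β 1 * x * (z0 / β 0)) * (1 - β 1 * x * (Q * z0 / β 0))) ?_)
        (gridSpan_push hQ hβ hLm hp1
          (r := (1 - β 1 * x⁻¹ * (z0 / β 0)) * (1 - β 1 * x⁻¹ * (Q * z0 / β 0))) ?_)
        (gridSpan_push hQ hβ hL hp1 (r := hEnd Q (β 1) x (z0 / β 0) (Q * z0 / β 0)) ?_)
        ((1 - z0 ^ 2) * (1 - Q * z0 ^ 2))⁻¹,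
      _, gridSpan_add_three
        (gridSpan_push hQ hβ hLp hp2
          (r := (1 - β 1 * x * (z0⁻¹ / β 0)) * (1 - β 1 * x * (Q * z0⁻¹ / β 0))) ?_)
        (gridSpan_push hQ hβ hLm hp2
          (r := (1 - β 1 * x⁻¹ * (z0⁻¹ / β 0)) * (1 - β 1 * x⁻¹ * (Q * z0⁻¹ / β 0))) ?_)
        (gridSpan_push hQ hβ hL hp2 (r := hEnd Q (β 1) x (z0⁻¹ / β 0) (Q * z0⁻¹ / β 0)) ?_)
        ((1 - z0⁻¹ ^ 2) * (1 - Q * z0⁻¹ ^ 2))⁻¹,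
      _, gridSpan_add_three
        (gridSpan_push hQ hβ hLp hp3
          (r := (1 - β 1 * x * (z0 / β 0)) * (1 - β 1 * x * (z0⁻¹ / β 0))) ?_)
        (gridSpan_push hQ hβ hLm hp3
          (r := (1 - β 1 * x⁻¹ * (z0 / β 0)) * (1 - β 1 * x⁻¹ * (z0⁻¹ / β 0))) ?_)
        (gridSpan_push hQ hβ hL hp3 (r := hEnd Q (β 1) x (z0 / β 0) (z0⁻¹ / β 0)) ?_)
        (Q * (1 + Q) / ((1 - Q * z0 ^ 2) * (1 - Q * z0⁻¹ ^ 2))), ?_⟩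
    -- When the first two variables move together, their ratio and hence the label component is
    -- unchanged, and no coefficient has to vanish. The same applies to the other two goals closed
    -- this way.
    · intro; omega
    · intro
      rcases (by omega : J 0 - μ 0 = 0 ∨ J 0 - μ 0 = 1) with e | e
      · rw [u0 e, zero_mul]
      · rw [u1 e, mul_zero]
    · intro
      rw [mul_div_assoc Q, hend, u0 (by omega), mul_zero]
    · intro
      rcases (by omega : μ 0 = 0 ∨ μ 0 = 1) with e | e
      · rw [l0 e, zero_mul]
      · rw [l1 e, mul_zero]
    · intro; omega
    · intro
      rw [mul_div_assoc Q, hend, l0 (by omega), zero_mul]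
    · intro
      rw [l0 (by omega), mul_zero]
    · intro
      rw [u0 (by omega), zero_mul]
    · intro; omega
    · intro s s' f
      rw [hgrid]
      simp only [transfer, headVar, Fin.cons_zero, Fin.tail_cons]
      rw [h, h, h]
      simp only [cShift, cStay, zero_add]
      ring

/-! ### Linear independence on the discrete support -/

theorem Generic.mul_pow {q z : ℂ} (hq : q ≠ 0) (h : Generic q z) (k : ℕ) :
    Generic q (z * (q ^ 2) ^ k) := by
  have := h.mul_zpow hq ((2 * k : ℕ) : ℤ)
  rwa [zpow_natCast, pow_mul, mul_comm] at this

theorem qPoch_neg_self_ne_zero {Q : ℂ} (hQ : Q ≠ 0) (hroot : ∀ k : ℕ, 0 < k → Q ^ k ≠ 1) (n : ℕ) :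
    qPoch (Q ^ (-(n : ℤ))) Q n ≠ 0 :=
  qPoch_ne_zero fun k hk h => by
    rw [← zpow_natCast, ← zpow_add₀ hQ] at h
    exact zpow_ne_one_of_pow hroot (by omega : -(n : ℤ) + k ≠ 0) (by linear_combination -h)

/-- The matrix of values is a product of two triangular matrices: coefficients in the basis with
base `c` vanish above the degree, and that basis at the node `c Q^m` vanishes for `k > m`.
Genericity makes both diagonals nonzero. -/
theorem awPoly_independent {q : ℂ} (hq : q ≠ 0) (hroot : ∀ k : ℕ, 0 < k → (q ^ 2) ^ k ≠ 1)
    {a b c d : ℂ} (ha : a ≠ 0) (hc : Generic q c)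
    (habcd : ∀ e : ℤ, a * b * c * d * (q ^ 2) ^ e ≠ 1) (M : ℕ) (g : Fin (M + 1) → ℂ)
    (h : ∀ m : Fin (M + 1),
      ∑ n : Fin (M + 1), g n * awPoly (q ^ 2) n (c * (q ^ 2) ^ (m : ℕ)) a b c d = 0) : g = 0 := by
  have hQ : q ^ 2 ≠ 0 := pow_ne_zero 2 hq
  set Q := q ^ 2 with hQdef
  let A : Matrix (Fin (M + 1)) (Fin (M + 1)) ℂ :=
    Matrix.of fun n k => (c ^ (n : ℕ))⁻¹ * awCoeff Q n k c b a d
  let B : Matrix (Fin (M + 1)) (Fin (M + 1)) ℂ :=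
    Matrix.of fun k m => awBasis Q c (c * Q ^ (m : ℕ)) k
  have hbasis : ∀ k m : ℕ, awBasis Q c (c * Q ^ m) k
      = qPoch (c ^ 2 * Q ^ m) Q k * qPoch (Q ^ (-(m : ℤ))) Q k := by
    intro k m
    have hc0 := hc.1
    rw [awBasis, zpow_neg, zpow_natCast]
    congr 2
    · ring
    · field_simp
  have hAB : ∀ n m : Fin (M + 1), (A * B) n m
      = awPoly Q n (c * Q ^ (m : ℕ)) a b c d := by
    intro n m
    rw [awPoly_swap hq hroot n (hc.mul_pow hq m) ha hc.1, awPoly_eq_sum, Matrix.mul_apply,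
      Finset.mul_sum]
    simp only [A, B, Matrix.of_apply, ← mul_assoc]
    rw [Fin.sum_univ_eq_sum_range (fun k => (c ^ (n : ℕ))⁻¹ * awCoeff Q n k c b a d
      * awBasis Q c (c * Q ^ (m : ℕ)) k) (M + 1)]
    refine (Finset.sum_subset (Finset.range_mono (by omega)) fun k _ hk => ?_).symm
    rw [awCoeff_eq_zero hQ (by simpa using hk)]
    ring
  have hA : A.det ≠ 0 := by
    rw [Matrix.det_of_isLowerTriangular]
    · refine Finset.prod_ne_zero_iff.mpr fun n _ => ?_
      simp only [A, Matrix.of_apply, awCoeff, awTail, Nat.sub_self, qPoch_zero, mul_one]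
      refine mul_ne_zero (inv_ne_zero (pow_ne_zero _ hc.1)) (mul_ne_zero (div_ne_zero (mul_ne_zero
        (qPoch_neg_self_ne_zero hQ hroot n) (qPoch_ne_zero fun j _ e => ?_))
        (qPoch_self_ne_zero hroot n)) (pow_ne_zero _ hQ))
      refine habcd ((n : ℤ) - 1 + j) ?_
      rw [zpow_add₀ hQ, zpow_natCast]
      linear_combination -e
    · intro n k hnk
      simp only [A, Matrix.of_apply]
      rw [awCoeff_eq_zero hQ (by exact_mod_cast hnk), mul_zero]
  have hB : B.det ≠ 0 := by
    rw [Matrix.det_of_isUpperTriangular]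
    · refine Finset.prod_ne_zero_iff.mpr fun k _ => ?_
      simp only [B, Matrix.of_apply]
      rw [hbasis]
      refine mul_ne_zero (qPoch_ne_zero fun j _ e => ?_) (qPoch_neg_self_ne_zero hQ hroot k)
      refine hc.2 ((k + j : ℕ) : ℤ) ?_
      rw [zpow_natCast, pow_add]
      linear_combination -e
    · intro k m hmk
      simp only [B, Matrix.of_apply]
      rw [hbasis, qPoch_neg_eq_zero hQ (by exact_mod_cast hmk), mul_zero]
  have hdet : (A * B).det ≠ 0 := by rw [Matrix.det_mul]; exact mul_ne_zero hA hB
  refine Matrix.eq_zero_of_vecMul_eq_zero hdet ?_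
  funext m
  rw [Matrix.vecMul, dotProduct]
  simp only [hAB]
  exact h m

/-- For a fixed tail of the support label, the first variable runs over a one-variable grid and the
tail factors are constants. The one-variable statement isolates each first degree, leaving the same
problem on the shorter chain with `s, s'` scaled by `Q^{n 0}`. -/
theorem grPoly_independent {q w : ℂ} (hq : q ≠ 0) (hroot : ∀ k : ℕ, 0 < k → (q ^ 2) ^ k ≠ 1)
    {N : ℕ} {β : ℕ → ℂ} (hβ : ∀ i ≤ N, β i ≠ 0) (hgen : ∀ i ≤ N, Generic q (β N * w / β i))
    {s s' : ℂ} (hs : s ≠ 0) (hgen' : ∀ i ≤ N, ∀ e : ℤ, β i ^ 2 * (s * s') * (q ^ 2) ^ e ≠ 1)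
    (J : Fin N → ℕ) (f : Box J → ℂ)
    (h : ∀ μ : Box J, ∑ n : Box J, f n * grPoly (q ^ 2) w N β s s' (fun i => n i)
      (gridPt (q ^ 2) w N β fun i => μ i) = 0) : f = 0 := by
  have hQ : q ^ 2 ≠ 0 := pow_ne_zero 2 hq
  induction N generalizing β s s' with
  | zero =>
    funext n
    have := h n
    simp only [grPoly, mul_one, Finset.univ_unique, Finset.sum_singleton] at this
    exact (congrArg f (Subsingleton.elim n _)).trans this
  | succ N ih =>
    have h0 := hβ 0 (Nat.zero_le _)
    have h1 := hβ 1 (by omega)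
    have hβ' : ∀ i ≤ N, β (i + 1) ≠ 0 := fun i hi => hβ (i + 1) (by omega)
    have key : ∀ (n0 : Fin (J 0 + 1)) (μ' : Box (Fin.tail J)),
        ∑ n' : Box (Fin.tail J), f (Fin.cons n0 n')
          * grPoly (q ^ 2) w N (fun i => β (i + 1)) (s * (q ^ 2) ^ (n0 : ℕ))
            (s' * (q ^ 2) ^ (n0 : ℕ)) (fun i => n' i)
            (gridPt (q ^ 2) w N (fun i => β (i + 1)) fun i => μ' i) = 0 := by
      intro n0 μ'
      set y := gridPt (q ^ 2) w N (fun i => β (i + 1)) fun i => (μ' i : ℕ) with hy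
      have hc : Generic q (β 1 / β 0 * headVar w y) := by
        rw [hy, headVar_gridPt _ w hβ']
        have := (hgen 0 (Nat.zero_le _)).mul_pow hq (∑ i, (μ' i : ℕ))
        convert this using 1
        simp only [zero_add]
        field_simp
      have hx : headVar w y ≠ 0 := right_ne_zero_of_mul hc.1
      refine congrFun (awPoly_independent (a := β 0 * s) (b := β 0 * s')
        (c := β 1 / β 0 * headVar w y) (d := β 1 / β 0 * (headVar w y)⁻¹) hq hroot
        (mul_ne_zero h0 hs) hc ?_ (J 0) (fun n0 => ∑ n' : Box (Fin.tail J), f (Fin.cons n0 n')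
          * grPoly (q ^ 2) w N (fun i => β (i + 1)) (s * (q ^ 2) ^ (n0 : ℕ))
            (s' * (q ^ 2) ^ (n0 : ℕ)) (fun i => n' i) y) ?_) n0
      · intro e
        convert hgen' 1 (by omega) e using 2
        field_simp
      · intro m
        rw [← h (Fin.cons m μ'), ← (Fin.consEquiv fun i => Fin (J i + 1)).sum_comp,
          Fintype.sum_prod_type]
        refine Finset.sum_congr rfl fun n0 _ => ?_
        rw [Finset.sum_mul]
        refine Finset.sum_congr rfl fun n' _ => ?_
        have e1 : gridPt (q ^ 2) w (N + 1) β (fun i => ((Fin.cons m μ' : Box J) i : ℕ))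
            = Fin.cons (β 1 / β 0 * headVar w y * (q ^ 2) ^ (m : ℕ)) y := rfl
        rw [e1, grPoly, siteFactor, Fin.tail_cons, Fin.cons_zero, mul_assoc]
        congr 1
        rw [mul_comm]
        rfl
    funext n
    rw [← Fin.cons_self_tail n]
    refine congrFun (ih (β := fun i => β (i + 1)) (s := s * (q ^ 2) ^ (n 0 : ℕ))
      (s' := s' * (q ^ 2) ^ (n 0 : ℕ)) hβ' ?_ (mul_ne_zero hs (pow_ne_zero _ hQ)) ?_ (Fin.tail J)
      (fun n' => f (Fin.cons (n 0) n')) (key (n 0))) (Fin.tail n)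
    · intro i hi
      exact hgen (i + 1) (by omega)
    · intro i hi e he
      refine hgen' (i + 1) (by omega) ((n 0 : ℕ) + (n 0 : ℕ) + e) ?_
      rw [zpow_add₀ hQ, zpow_add₀ hQ, zpow_natCast, ← he]
      ring

/-! ### From differences to shifts -/

/-- The coefficients of the difference form of the operator, built up from the first variable on.
The variable `z i` is understood to have been inverted already if `ν i = -1`. -/
def chainWeight (Q w : ℂ) :
    (N : ℕ) → (ℕ → ℂ) → ℂ → ℂ → (Fin N → SignType) → (Fin N → ℂ) → ℂ
  | 0, β, s, s', _, _ => hEnd Q (β 0) w s s'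
  | N + 1, β, s, s', ν, z =>
    if ν 0 = 0 then chainWeight Q w N (fun i => β (i + 1)) s s' (Fin.tail ν) (Fin.tail z)
    else cShift Q (β 0) (z 0) s s'
      * chainWeight Q w N (fun i => β (i + 1)) (z 0 / β 0) (Q * z 0 / β 0) (Fin.tail ν)
        (Fin.tail z)

/-- Invert those variables for which `ν` is negative. -/
def signedVar {N : ℕ} (ν : Fin N → SignType) (z : Fin N → ℂ) : Fin N → ℂ :=
  fun i => if ν i = -1 then (z i)⁻¹ else z i

/-- The difference in the direction given by a sign. -/
def siteDiff {N : ℕ} (q : ℂ) (σ : SignType) (i : Fin N) : Module.End ℂ ((Fin N → ℂ) → ℂ) :=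
  if σ = 1 then forwardDiff q i else if σ = -1 then backwardDiff q i else 1

theorem siteDiff_one {N : ℕ} (q : ℂ) (i : Fin N) (f : (Fin N → ℂ) → ℂ) (z : Fin N → ℂ) :
    siteDiff q 1 i f z = f (Function.update z i (q ^ 2 * z i)) - f z := by
  simp [siteDiff, forwardDiff, scaleVar]

theorem siteDiff_neg_one {N : ℕ} (q : ℂ) (i : Fin N) (f : (Fin N → ℂ) → ℂ) (z : Fin N → ℂ) :
    siteDiff q (-1) i f z = f z - f (Function.update z i ((q ^ 2)⁻¹ * z i)) := by
  have h : ¬ ((-1 : SignType) = 1) := by decide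
  simp [siteDiff, backwardDiff, scaleVar, h]

theorem siteDiff_zero {N : ℕ} (q : ℂ) (i : Fin N) (f : (Fin N → ℂ) → ℂ) (z : Fin N → ℂ) :
    siteDiff q 0 i f z = f z := by
  have h : ¬ ((0 : SignType) = 1) := by decide
  have h' : ¬ ((0 : SignType) = -1) := by decide
  simp [siteDiff, h, h']

/-- Differences in the later variables treat the first one as frozen, which allows the operator to
be peeled off site by site. -/
theorem prod_siteDiff_succ {N : ℕ} (q : ℂ) (σ : Fin N → SignType) (l : List (Fin N))
    (f : (Fin (N + 1) → ℂ) → ℂ) (z : Fin (N + 1) → ℂ) :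
    (l.map fun i => siteDiff q (σ i) i.succ).prod f z
      = (l.map fun i => siteDiff q (σ i) i).prod (fun y => f (Fin.cons (z 0) y)) (Fin.tail z) := by
  induction l generalizing z with
  | nil => simp
  | cons i l ih =>
    have e : ∀ c : ℂ, (l.map fun i => siteDiff q (σ i) i.succ).prod f
          (Function.update z i.succ (c * z i.succ))
        = (l.map fun i => siteDiff q (σ i) i).prod (fun y => f (Fin.cons (z 0) y))
          (Function.update (Fin.tail z) i (c * Fin.tail z i)) := by
      intro c
      rw [ih, Fin.tail_update_succ, Function.update_of_ne (Fin.succ_ne_zero i).symm]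
      rfl
    rw [List.map_cons, List.map_cons, List.prod_cons, List.prod_cons, Module.End.mul_apply,
      Module.End.mul_apply]
    generalize σ i = τ
    cases τ with
    | zero => rw [SignType.zero_eq_zero, siteDiff_zero, siteDiff_zero, ih]
    | pos => rw [SignType.pos_eq_one, siteDiff_one, siteDiff_one, e, ih]
    | neg => rw [SignType.neg_eq_neg_one, siteDiff_neg_one, siteDiff_neg_one, e, ih]

theorem mixedDiff_succ {N : ℕ} (q : ℂ) (ν : Fin (N + 1) → SignType) (f : (Fin (N + 1) → ℂ) → ℂ)
    (z : Fin (N + 1) → ℂ) :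
    mixedDiff q ν f z
      = siteDiff q (ν 0) 0 (fun y => mixedDiff q (Fin.tail ν) (fun x => f (Fin.cons (y 0) x))
        (Fin.tail y)) z := by
  have h : mixedDiff q ν f = siteDiff q (ν 0) 0
      (((List.finRange N).map fun i => siteDiff q (Fin.tail ν i) i.succ).prod f) := by
    rw [mixedDiff, List.ofFn_succ, List.prod_cons, List.ofFn_eq_map]
    rfl
  have h' : (((List.finRange N).map fun i => siteDiff q (Fin.tail ν i) i.succ).prod f)
      = fun y => mixedDiff q (Fin.tail ν) (fun x => f (Fin.cons (y 0) x)) (Fin.tail y) := by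
    funext y
    rw [prod_siteDiff_succ, mixedDiff, List.ofFn_eq_map]
    rfl
  rw [h, h']

theorem sum_signType (g : SignType → ℂ) : ∑ σ, g σ = g 0 + g 1 + g (-1) := by
  have h : (Finset.univ : Finset SignType) = {0, 1, -1} := by decide
  rw [h, Finset.sum_insert (by decide), Finset.sum_insert (by decide), Finset.sum_singleton,
    add_assoc]

/-- The sign `(-1)^{|ν⁻|}`. -/
def negSign {N : ℕ} (ν : Fin N → SignType) : ℂ := ∏ i, if ν i = -1 then -1 else 1

theorem negSign_eq {N : ℕ} (ν : Fin N → SignType) :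
    negSign ν = (-1) ^ (Finset.univ.filter fun i => ν i = -1).card := by
  rw [negSign, Finset.prod_ite, Finset.prod_const, Finset.prod_const_one, mul_one]

/-- The differences at the first site leave unshifted terms with coefficients `-cShift`. Expanding
the summand with `ν 0 = 0` by interpolation produces the same terms with the opposite sign, and what
survives is `cStay`. -/
theorem sum_chainWeight {q w : ℂ} (hq : q ≠ 0) (hQ1 : 1 + q ^ 2 ≠ 0) {N : ℕ} {β : ℕ → ℂ}
    (hβ : ∀ i ≤ N, β i ≠ 0) (s s' : ℂ) (f : (Fin N → ℂ) → ℂ) {z : Fin N → ℂ}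
    (hz : ∀ i, Generic q (z i)) :
    ∑ ν : Fin N → SignType, negSign ν * chainWeight (q ^ 2) w N β s s' ν (signedVar ν z)
        * mixedDiff q ν f z
      = transfer (q ^ 2) w N β s s' f z := by
  have hQ : q ^ 2 ≠ 0 := pow_ne_zero 2 hq
  induction N generalizing β s s' with
  | zero => simp [negSign, chainWeight, mixedDiff, transfer]
  | succ N ih =>
    obtain ⟨h1, h2, h3⟩ := (hz 0).sub_ne_zero
    have hβ' : ∀ i ≤ N, β (i + 1) ≠ 0 := fun i hi => hβ (i + 1) (by omega)
    have h0 := hβ 0 (Nat.zero_le _)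
    have hz' : ∀ i, Generic q (Fin.tail z i) := fun i => hz i.succ
    have hd := (isPairLinear_transfer (q ^ 2) w (fun i => β (i + 1))
      (fun y => f (Fin.cons (z 0) y)) (Fin.tail z)).decompose hQ hQ1 h0 (hz 0).1 h1 h2 h3 s s'
    have n1 : (1 : SignType) ≠ 0 := by decide
    have n2 : (-1 : SignType) ≠ 0 := by decide
    have n3 : (1 : SignType) ≠ -1 := by decide
    have n4 : (0 : SignType) ≠ -1 := by decide
    have hsg : ∀ (σ : SignType) (ν : Fin N → SignType),
        negSign (Fin.cons σ ν : Fin (N + 1) → SignType)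
          = (if σ = -1 then -1 else 1) * negSign ν := by
      intro σ ν
      rw [negSign, Fin.prod_univ_succ]
      rfl
    have htl : ∀ (σ : SignType) (ν : Fin N → SignType),
        Fin.tail (signedVar (Fin.cons σ ν : Fin (N + 1) → SignType) z)
          = signedVar ν (Fin.tail z) := fun σ ν => rfl
    have hhd : ∀ (σ : SignType) (ν : Fin N → SignType),
        signedVar (Fin.cons σ ν : Fin (N + 1) → SignType) z 0
          = if σ = -1 then (z 0)⁻¹ else z 0 := fun σ ν => rfl
    have hce : ∀ (σ : SignType) (ν : Fin N → SignType),
        (Fin.consEquiv fun _ => SignType) (σ, ν) = (Fin.cons σ ν : Fin (N + 1) → SignType) :=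
      fun _ _ => rfl
    rw [← (Fin.consEquiv fun _ => SignType).sum_comp, Fintype.sum_prod_type, sum_signType]
    simp only [hce, chainWeight, mixedDiff_succ, Fin.cons_zero, Fin.tail_cons, hsg,
      htl, hhd, siteDiff_one, siteDiff_neg_one, siteDiff_zero, if_true, if_neg n1, if_neg n2,
      if_neg n3, if_neg n4, Function.update_self, Fin.tail_update_zero, one_mul]
    rw [ih hβ' s s' (fun x => f (Fin.cons (z 0) x)) hz']
    have e1 : ∀ (t t' r a b : ℂ) (η : ℂ),
        ∑ ν : Fin N → SignType, η * negSign ν * (r * chainWeight (q ^ 2) w N (fun i => β (i + 1))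
            t t' ν (signedVar ν (Fin.tail z)))
          * (mixedDiff q ν (fun x => f (Fin.cons a x)) (Fin.tail z)
            - mixedDiff q ν (fun x => f (Fin.cons b x)) (Fin.tail z))
        = η * r * (transfer (q ^ 2) w N (fun i => β (i + 1)) t t' (fun x => f (Fin.cons a x))
            (Fin.tail z)
          - transfer (q ^ 2) w N (fun i => β (i + 1)) t t' (fun x => f (Fin.cons b x))
            (Fin.tail z)) := by
      intro t t' r a b η
      rw [← ih hβ' t t' _ hz', ← ih hβ' t t' _ hz', ← Finset.sum_sub_distrib, Finset.mul_sum]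
      exact Finset.sum_congr rfl fun ν _ => by ring
    have e2 := fun t t' r a b => e1 t t' r a b 1
    simp only [one_mul] at e2
    rw [e1, e2, transfer]
    linear_combination -hd

/-! ### The coefficients of the difference form -/

section Products

variable {M : Type*} [CommMonoid M] {N : ℕ}

/-- The product over the first element of the support. -/
def firstProd (ν : Fin N → SignType) (g : Fin N → M) : M :=
  ∏ i, if ν i ≠ 0 ∧ ∀ k, ν k ≠ 0 → i ≤ k then g i else 1

/-- The product over the last element of the support. -/
def lastProd (ν : Fin N → SignType) (g : Fin N → M) : M :=
  ∏ i, if ν i ≠ 0 ∧ ∀ k, ν k ≠ 0 → k ≤ i then g i else 1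

/-- The product over consecutive pairs of elements of the support. -/
def pairProd (ν : Fin N → SignType) (g : Fin N → Fin N → M) : M :=
  ∏ i, ∏ j, if ν i ≠ 0 ∧ ν j ≠ 0 ∧ i < j ∧ ∀ k, ν k ≠ 0 → k ≤ i ∨ j ≤ k then g i j else 1

theorem firstProd_succ_of_ne {ν : Fin (N + 1) → SignType} (h : ν 0 ≠ 0) (g : Fin (N + 1) → M) :
    firstProd ν g = g 0 := by
  rw [firstProd, Fin.prod_univ_succ]
  simp [h, Fin.forall_fin_succ]

theorem firstProd_succ_of_eq {ν : Fin (N + 1) → SignType} (h : ν 0 = 0) (g : Fin (N + 1) → M) :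
    firstProd ν g = firstProd (Fin.tail ν) fun i => g i.succ := by
  rw [firstProd, Fin.prod_univ_succ]
  simp [h, Fin.forall_fin_succ, firstProd, Fin.tail]
  congr!

theorem lastProd_succ_of_ne {ν : Fin (N + 1) → SignType} (h : ν 0 ≠ 0) (g : Fin (N + 1) → M) :
    lastProd ν g
      = (if Fin.tail ν = 0 then g 0 else 1) * lastProd (Fin.tail ν) fun i => g i.succ := by
  rw [lastProd, Fin.prod_univ_succ]
  simp [h, Fin.forall_fin_succ, lastProd, Fin.tail, funext_iff]
  congr!

theorem lastProd_succ_of_eq {ν : Fin (N + 1) → SignType} (h : ν 0 = 0) (g : Fin (N + 1) → M) :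
    lastProd ν g = lastProd (Fin.tail ν) fun i => g i.succ := by
  rw [lastProd, Fin.prod_univ_succ]
  simp [h, Fin.forall_fin_succ, lastProd, Fin.tail]
  congr!

theorem pairProd_succ_of_ne {ν : Fin (N + 1) → SignType} (h : ν 0 ≠ 0)
    (g : Fin (N + 1) → Fin (N + 1) → M) :
    pairProd ν g = firstProd (Fin.tail ν) (fun j => g 0 j.succ)
      * pairProd (Fin.tail ν) fun i j => g i.succ j.succ := by
  rw [pairProd, Fin.prod_univ_succ]
  simp only [Fin.prod_univ_succ]
  simp [h, Fin.forall_fin_succ, firstProd, pairProd, Fin.tail]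
  congr!

theorem pairProd_succ_of_eq {ν : Fin (N + 1) → SignType} (h : ν 0 = 0)
    (g : Fin (N + 1) → Fin (N + 1) → M) :
    pairProd ν g = pairProd (Fin.tail ν) fun i j => g i.succ j.succ := by
  rw [pairProd, Fin.prod_univ_succ]
  simp only [Fin.prod_univ_succ]
  simp [h, Fin.forall_fin_succ, pairProd, Fin.tail]
  congr!

theorem prod_support_succ {ν : Fin (N + 1) → SignType} (g : Fin (N + 1) → M) :
    (∏ i, if ν i ≠ 0 then g i else 1)
      = (if ν 0 ≠ 0 then g 0 else 1) * ∏ i, if Fin.tail ν i ≠ 0 then g i.succ else 1 :=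
  Fin.prod_univ_succ _

end Products

theorem firstProd_zero {N : ℕ} (g : Fin N → ℂ) : firstProd 0 g = 1 := by simp [firstProd]

theorem lastProd_zero {N : ℕ} (g : Fin N → ℂ) : lastProd 0 g = 1 := by simp [lastProd]

theorem pairProd_zero {N : ℕ} (g : Fin N → Fin N → ℂ) : pairProd 0 g = 1 := by simp [pairProd]

theorem chainWeight_zero (Q w : ℂ) {N : ℕ} (β : ℕ → ℂ) (s s' : ℂ) (z : Fin N → ℂ) :
    chainWeight Q w N β s s' 0 z = hEnd Q (β N) w s s' := by
  induction N generalizing β with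
  | zero => rfl
  | succ N ih =>
    rw [chainWeight, if_pos (by rfl)]
    exact ih _ _

/-- The end weight factors at a pair `(y, Q y)`, and such a pair is passed on by every site in the
support of `ν`. For `ν = 0` there is no such pair, hence the exclusion. -/
theorem chainWeight_eq {Q w : ℂ} (hQ : Q ≠ 0) (hQ1 : 1 + Q ≠ 0) (hw : w ≠ 0) {N : ℕ} {β : ℕ → ℂ}
    (hβ : ∀ i ≤ N, β i ≠ 0) (s s' : ℂ) {ν : Fin N → SignType} (hν : ν ≠ 0) (z : Fin N → ℂ) :
    chainWeight Q w N β s s' ν z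
      = firstProd ν (fun i => (1 - β i * z i * s) * (1 - β i * z i * s'))
        * pairProd ν (fun i j => (1 - β j * z j * z i / β i) * (1 - Q * β j * z j * z i / β i))
        / (∏ i, if ν i ≠ 0 then (1 - z i ^ 2) * (1 - Q * z i ^ 2) else 1)
        * lastProd ν (fun i => (1 - β N * w * z i / β i) * (1 - β N * z i / (β i * w))) := by
  induction N generalizing β s s' with
  | zero => exact absurd (Subsingleton.elim _ _) hν
  | succ N ih =>
    have h0 := hβ 0 (Nat.zero_le _)
    have hβ' : ∀ i ≤ N, β (i + 1) ≠ 0 := fun i hi => hβ (i + 1) (by omega)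
    by_cases hν0 : ν 0 = 0
    · have ht : Fin.tail ν ≠ 0 := by
        intro h
        apply hν
        funext i
        refine Fin.cases hν0 (fun j => congrFun h j) i
      rw [chainWeight, if_pos hν0, firstProd_succ_of_eq hν0, pairProd_succ_of_eq hν0,
        lastProd_succ_of_eq hν0, prod_support_succ, if_neg (not_not.mpr hν0), one_mul,
        ih hβ' s s' ht]
      rfl
    · rw [chainWeight, if_neg hν0, firstProd_succ_of_ne hν0, pairProd_succ_of_ne hν0,
        lastProd_succ_of_ne hν0, prod_support_succ, if_pos hν0, cShift]
      by_cases ht : Fin.tail ν = 0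
      · rw [ht, chainWeight_zero, firstProd_zero, lastProd_zero, pairProd_zero, if_pos rfl]
        have e : hEnd Q (β (N + 1)) w (z 0 / β 0) (Q * z 0 / β 0)
            = (1 - β (N + 1) * w * z 0 / β 0) * (1 - β (N + 1) * z 0 / (β 0 * w)) := by
          rw [hEnd]; field_simp; ring
        rw [e]
        simp
      · rw [if_neg ht, ih hβ' _ _ ht]
        have e : (fun j : Fin N => (1 - β (j.succ : Fin (N + 1)) * z j.succ * z 0
              / β (0 : Fin (N + 1)))
              * (1 - Q * β (j.succ : Fin (N + 1)) * z j.succ * z 0 / β (0 : Fin (N + 1))))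
            = fun j : Fin N => (1 - β (j + 1) * Fin.tail z j * (z 0 / β 0))
              * (1 - β (j + 1) * Fin.tail z j * (Q * z 0 / β 0)) := by
          funext j
          simp only [Fin.val_succ, Fin.val_zero, Fin.tail]
          ring
        rw [e]
        simp only [Fin.val_succ, Fin.val_zero, Fin.tail, one_mul]
        rw [div_mul_eq_mul_div, div_mul_eq_mul_div, div_mul_eq_mul_div, mul_div_assoc',
          div_div, mul_comm (∏ i, _)]
        congr 1
        ring

/-! ### Translation to the operator, the polynomials and the support points of the statement -/

theorem phi_eq_chainWeight {N : ℕ} {q : ℂ} (hq : q ≠ 0) (hQ1 : 1 + q ^ 2 ≠ 0) {α : ℕ → ℂ}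
    (hα : ∀ k ≤ N + 2, α k ≠ 0) {ν : Fin N → SignType} (hν : ν ≠ 0) (z : Fin N → ℂ) :
    phi q α ν z = chainWeight (q ^ 2) (α (N + 2)) N (fun i => α (i + 1)) 1 (1 / α 0 ^ 2) ν
      (signedVar ν z) := by
  rw [chainWeight_eq (pow_ne_zero 2 hq) hQ1 (hα _ le_rfl) (fun i hi => hα (i + 1) (by omega)) _ _
    hν, phi, show (fun i => if ν i = -1 then (z i)⁻¹ else z i) = signedVar ν z from rfl, phiSupp]
  congr 1
  · congr 1
    · congr 1
      · rw [Finset.filter_filter, Finset.prod_filter, firstProd]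
        refine Finset.prod_congr rfl fun i _ => if_congr ?_ ?_ rfl
        · simp
        · rw [mul_one]; ring
      · rw [Finset.prod_filter, Finset.prod_product, Finset.prod_filter, pairProd]
        refine Finset.prod_congr rfl fun i _ => ?_
        by_cases hi : ν i = 0
        · simp [hi]
        · rw [if_pos hi, Finset.prod_filter]
          refine Finset.prod_congr rfl fun j _ => ?_
          by_cases hj : ν j = 0
          · simp [hj]
          · rw [if_pos hj]
            refine if_congr ?_ rfl rfl
            simp [hi, hj]
    · rw [Finset.prod_filter]
  · rw [Finset.filter_filter, Finset.prod_filter, lastProd]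
    refine Finset.prod_congr rfl fun i _ => if_congr ?_ rfl rfl
    simp

/-- The summand for `ν = 0` in the transfer operator carries the full end weight, whereas the
operator has only its part without `s + s'`; the added constant is the difference. -/
theorem qDiffOp_eq_transfer {N : ℕ} {q : ℂ} (hq : q ≠ 0) (hQ1 : 1 + q ^ 2 ≠ 0) {α : ℕ → ℂ}
    (hα : ∀ k ≤ N + 2, α k ≠ 0) (f : (Fin N → ℂ) → ℂ) {z : Fin N → ℂ}
    (hz : ∀ i, Generic q (z i)) :
    qDiffOp q α f z = α 0 * q / α (N + 1)
      * (transfer (q ^ 2) (α (N + 2)) N (fun i => α (i + 1)) 1 (1 / α 0 ^ 2) f z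
        + (1 + 1 / α 0 ^ 2) * (α (N + 1) * (α (N + 2) + (α (N + 2))⁻¹) / (1 + q ^ 2)) * f z) := by
  have hβ : ∀ i ≤ N, α (i + 1) ≠ 0 := fun i hi => hα (i + 1) (by omega)
  rw [← sum_chainWeight hq hQ1 (β := fun i => α (i + 1)) hβ _ _ f hz, qDiffOp]
  congr 1
  rw [← Finset.sum_filter_add_sum_filter_not Finset.univ (fun ν : Fin N → SignType => ν ≠ 0),
    add_assoc]
  congr 1
  · refine Finset.sum_congr rfl fun ν hν => ?_
    rw [negSign_eq, phi_eq_chainWeight hq hQ1 hα (Finset.mem_filter.mp hν).2]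
  · have h0 : (Finset.univ.filter fun ν : Fin N → SignType => ¬ ν ≠ 0) = {0} := by
      ext ν; simp
    have h1 : mixedDiff q (0 : Fin N → SignType) f z = f z := by
      have : (List.ofFn fun _ : Fin N => (1 : Module.End ℂ ((Fin N → ℂ) → ℂ))).prod = 1 := by
        rw [List.ofFn_const, List.prod_replicate, one_pow]
      have h : ¬ ((0 : SignType) = 1) := by decide
      have h' : ¬ ((0 : SignType) = -1) := by decide
      simp only [mixedDiff, Pi.zero_apply, if_neg h, if_neg h', this, Module.End.one_apply]
    have h2 : negSign (0 : Fin N → SignType) = 1 := by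
      have h' : ¬ ((0 : SignType) = -1) := by decide
      simp [negSign, h']
    rw [h0, Finset.sum_singleton, h1, h2, chainWeight_zero, hEnd]
    have := hα 0 (Nat.zero_le _)
    field_simp
    ring

theorem partialSum_zero {N : ℕ} (n : Fin N → ℕ) : partialSum n 0 = 0 := by simp [partialSum]

theorem partialSum_succ {N : ℕ} (n : Fin (N + 1) → ℕ) (i : ℕ) :
    partialSum n (i + 1) = n 0 + partialSum (Fin.tail n) i := by
  rw [partialSum, Fin.sum_univ_succ]
  simp [partialSum, Fin.tail]

theorem partialSum_self {N : ℕ} (n : Fin N → ℕ) : partialSum n N = ∑ i, n i := by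
  simp [partialSum]

/-- The variable following `z i`, where the last one is followed by `w`. -/
def followVar (w : ℂ) {N : ℕ} (z : Fin N → ℂ) (i : Fin N) : ℂ :=
  if h : (i : ℕ) + 1 < N then z ⟨(i : ℕ) + 1, h⟩ else w

theorem grPoly_eq_prod (Q w : ℂ) {N : ℕ} (β : ℕ → ℂ) (s s' : ℂ) (n : Fin N → ℕ) (z : Fin N → ℂ) :
    grPoly Q w N β s s' n z = ∏ i : Fin N, siteFactor Q (n i) (β i) (β (i + 1))
      (s * Q ^ partialSum n i) (s' * Q ^ partialSum n i) (z i) (followVar w z i) := by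
  induction N generalizing β s s' with
  | zero => simp [grPoly]
  | succ N ih =>
    rw [grPoly, ih, Fin.prod_univ_succ]
    congr 1
    · have : headVar w (Fin.tail z) = followVar w z 0 := by
        cases N with
        | zero => simp [headVar, followVar]
        | succ N => simp [headVar, followVar, Fin.tail]
      simp [partialSum_zero, this]
    · refine Finset.prod_congr rfl fun i _ => ?_
      have : followVar w (Fin.tail z) i = followVar w z i.succ := by
        simp only [followVar, Fin.val_succ, Nat.add_lt_add_iff_right]
        rfl
      rw [this, Fin.val_succ, partialSum_succ, pow_add, ← mul_assoc, ← mul_assoc]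
      rfl

theorem gasperRahman_eq_grPoly (q : ℂ) {N : ℕ} (α : ℕ → ℂ) (n : Fin N → ℕ) (z : Fin N → ℂ) :
    gasperRahman q α n z
      = grPoly (q ^ 2) (α (N + 2)) N (fun i => α (i + 1)) 1 (1 / α 0 ^ 2) n z := by
  rw [grPoly_eq_prod, gasperRahman]
  refine Finset.prod_congr rfl fun i _ => ?_
  rw [siteFactor, pow_mul, one_mul]
  congr 1
  ring

theorem gridPt_apply (Q w : ℂ) {N : ℕ} {β : ℕ → ℂ} (hβ : ∀ i ≤ N, β i ≠ 0) (μ : Fin N → ℕ)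
    (i : Fin N) :
    gridPt Q w N β μ i = β N / β i * w * Q ^ ∑ l : Fin N, if i ≤ l then μ l else 0 := by
  induction N generalizing β with
  | zero => exact i.elim0
  | succ N ih =>
    refine Fin.cases ?_ (fun j => ?_) i
    · have := headVar_gridPt Q w hβ μ
      simpa [headVar] using this
    · rw [gridPt, Fin.cons_succ, ih (fun i hi => hβ (i + 1) (by omega)), Fin.sum_univ_succ]
      simp [Fin.tail]

theorem partialSum_rev {N : ℕ} (m : Fin N → ℕ) (i : Fin N) :
    partialSum m (N - i) = ∑ l : Fin N, if i ≤ l then m l.rev else 0 := by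
  rw [partialSum, ← Equiv.sum_comp Fin.revPerm]
  refine Finset.sum_congr rfl fun l _ => ?_
  rw [Fin.revPerm_apply]
  refine if_congr ?_ rfl rfl
  rw [Fin.val_rev, Fin.le_def]
  omega

theorem supportPt_eq_gridPt {N : ℕ} (q : ℂ) {α : ℕ → ℂ} (hα : ∀ k ≤ N + 2, α k ≠ 0)
    (m : Fin N → ℕ) :
    supportPt q α m = gridPt (q ^ 2) (α (N + 2)) N (fun i => α (i + 1)) fun l => m l.rev := by
  funext i
  rw [gridPt_apply _ _ (fun i hi => hα (i + 1) (by omega)), supportPt, partialSum_rev, pow_mul]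
  ring

/-! ### Admissible parameters -/

/-- The hypotheses on the parameters. -/
structure Admissible {N : ℕ} (q : ℂ) (α : ℕ → ℂ) (J : Fin N → ℕ) : Prop where
  ne_zero : q ≠ 0
  pow_ne_one : ∀ k : ℕ, 0 < k → q ^ k ≠ 1
  param_ne_zero : ∀ k ≤ N + 2, α k ≠ 0
  ratio : ∀ k : Fin N, α (k + 2) / α (k + 1) = q ^ (-(J k : ℤ))
  norm₁ : qPoch (α (N + 1) * α (N + 2)) (q ^ 2) (diam J) ≠ 0
  norm₂ : qPoch (α (N + 1) * α (N + 2) / α 0 ^ 2) (q ^ 2) (diam J) ≠ 0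
  gen₁ : ∀ e : ℤ, α (N + 2) ^ 2 ≠ (q ^ 2) ^ e
  gen₂ : ∀ e : ℤ, α (N + 1) ^ 2 / α 0 ^ 2 ≠ (q ^ 2) ^ e

namespace Admissible

variable {N : ℕ} {q : ℂ} {α : ℕ → ℂ} {J : Fin N → ℕ}

theorem sq_ne_zero (h : Admissible q α J) : q ^ 2 ≠ 0 := pow_ne_zero 2 h.ne_zero

theorem sq_pow_ne_one (h : Admissible q α J) : ∀ k : ℕ, 0 < k → (q ^ 2) ^ k ≠ 1 := fun k hk => by
  rw [← pow_mul]; exact h.pow_ne_one _ (by omega)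

theorem one_add_sq_ne_zero (h : Admissible q α J) : 1 + q ^ 2 ≠ 0 := fun e =>
  -- `q² = -1` would give `q⁴ = 1`.
  h.pow_ne_one 4 (by norm_num) (by linear_combination (q ^ 2 - 1) * e)

theorem ratio_sq (h : Admissible q α J) (i : Fin N) :
    (α (i + 2) / α (i + 1)) ^ 2 * (q ^ 2) ^ J i = 1 := by
  rw [h.ratio, zpow_neg, zpow_natCast, ← pow_mul, mul_comm 2, pow_mul, ← mul_pow,
    inv_mul_cancel₀ (pow_ne_zero _ h.ne_zero), one_pow]

/-- The squared ratio is `Q^{-J i}`, so the first vanishing factor has index `J i`; this is why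
degrees up to `J i` can be normalized. -/
theorem qPoch_ratio_ne_zero (h : Admissible q α J) {i : Fin N} {n : ℕ} (hn : n ≤ J i) :
    qPoch (α (i + 2) ^ 2 / α (i + 1) ^ 2) (q ^ 2) n ≠ 0 := by
  refine qPoch_ne_zero fun k hk e => ?_
  have hi := h.ratio_sq i
  rw [← div_pow] at e
  have e1 : (q ^ 2) ^ k = (q ^ 2) ^ J i := by
    linear_combination -(q ^ 2) ^ k * hi - (q ^ 2) ^ J i * e
  refine h.sq_pow_ne_one (J i - k) (by omega) ?_
  have : (q ^ 2) ^ J i = (q ^ 2) ^ (J i - k) * (q ^ 2) ^ k := by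
    rw [← pow_add, Nat.sub_add_cancel (by omega)]
  rw [this] at e1
  exact (mul_eq_right₀ (pow_ne_zero _ h.sq_ne_zero)).mp e1.symm

/-- Up to a power of `Q`, every `α (i + 1) ^ 2` equals `α (N + 1) ^ 2`. The genericity conditions
imposed at the end of the chain thus hold at every site. -/
theorem exists_ratio_sq (h : Admissible q α J) {i : ℕ} (hi : i ≤ N) :
    ∃ k : ℕ, (α (N + 1) / α (i + 1)) ^ 2 * (q ^ 2) ^ k = 1 := by
  induction hi using Nat.decreasingInduction with
  | self => exact ⟨0, by rw [div_self (h.param_ne_zero _ (by omega))]; simp⟩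
  | of_succ i hi ih =>
    obtain ⟨k, hk⟩ := ih
    refine ⟨k + J ⟨i, hi⟩, ?_⟩
    have h1 := h.ratio_sq ⟨i, hi⟩
    have e1 := h.param_ne_zero (i + 1) (by omega)
    have e2 := h.param_ne_zero (i + 2) (by omega)
    rw [← one_mul (1 : ℂ)]
    nth_rewrite 1 [← hk]
    rw [← h1, pow_add]
    simp only
    field_simp

theorem generic (h : Admissible q α J) {i : ℕ} (hi : i ≤ N) :
    Generic q (α (N + 1) * α (N + 2) / α (i + 1)) := by
  have e0 := h.param_ne_zero (i + 1) (by omega)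
  refine ⟨div_ne_zero (mul_ne_zero (h.param_ne_zero _ (by omega)) (h.param_ne_zero _ le_rfl)) e0,
    fun e he => ?_⟩
  obtain ⟨k, hk⟩ := h.exists_ratio_sq hi
  apply h.gen₁ (k - e)
  have hQ := h.sq_ne_zero
  rw [zpow_sub₀ hQ, zpow_natCast, eq_div_iff (zpow_ne_zero _ hQ)]
  calc α (N + 2) ^ 2 * (q ^ 2) ^ e
      = α (N + 2) ^ 2 * (q ^ 2) ^ e * ((α (N + 1) / α (i + 1)) ^ 2 * (q ^ 2) ^ k) := by
        rw [hk, mul_one]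
    _ = ((α (N + 1) * α (N + 2) / α (i + 1)) ^ 2 * (q ^ 2) ^ e) * (q ^ 2) ^ k := by ring
    _ = _ := by rw [he, one_mul]

theorem generic' (h : Admissible q α J) {i : ℕ} (hi : i ≤ N) (e : ℤ) :
    α (i + 1) ^ 2 * (1 * (1 / α 0 ^ 2)) * (q ^ 2) ^ e ≠ 1 := by
  intro he
  obtain ⟨k, hk⟩ := h.exists_ratio_sq hi
  have e0 := h.param_ne_zero (i + 1) (by omega)
  have e1 := h.param_ne_zero 0 (by omega)
  apply h.gen₂ (-e - k)
  have hQ := h.sq_ne_zero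
  rw [zpow_sub₀ hQ, zpow_neg, zpow_natCast, eq_div_iff (pow_ne_zero _ hQ)]
  apply eq_inv_of_mul_eq_one_left
  calc _ = (α (i + 1) ^ 2 * (1 * (1 / α 0 ^ 2)) * (q ^ 2) ^ e)
        * ((α (N + 1) / α (i + 1)) ^ 2 * (q ^ 2) ^ k) := by field_simp
    _ = 1 := by rw [he, hk, one_mul]

theorem generic_supportPt (h : Admissible q α J) (m : Fin N → ℕ) (i : Fin N) :
    Generic q (supportPt q α m i) := by
  rw [supportPt, pow_mul]
  exact (h.generic i.2.le).mul_pow h.ne_zero _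

end Admissible

/-- The eigenvalue of the difference operator on polynomials of degree `k`. -/
def eigenvalue (q : ℂ) (α : ℕ → ℂ) (N k : ℕ) : ℂ :=
  α 0 * q / α (N + 1) * ((q ^ 2) ^ k)⁻¹ + α (N + 1) / (α 0 * q) * (q ^ 2) ^ k

/-- The normalization factor of a Gasper-Rahman polynomial. -/
def normFactor {N : ℕ} (q : ℂ) (α : ℕ → ℂ) (n : Fin N → ℕ) : ℂ :=
  (α (N + 1) * α (N + 2)) ^ (∑ i, n i)
    / (qPoch (α (N + 1) * α (N + 2)) (q ^ 2) (∑ i, n i)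
      * qPoch (α (N + 1) * α (N + 2) / α 0 ^ 2) (q ^ 2) (∑ i, n i))
    * (∏ i : Fin N, α (i + 1) ^ n i * qPoch (α (i + 2) ^ 2 / α (i + 1) ^ 2) (q ^ 2) (n i))⁻¹

theorem normGasperRahman_eq {N : ℕ} (q : ℂ) (α : ℕ → ℂ) (n : Fin N → ℕ) (z : Fin N → ℂ) :
    normGasperRahman q α n z = normFactor q α n
      * grPoly (q ^ 2) (α (N + 2)) N (fun i => α (i + 1)) 1 (1 / α 0 ^ 2) n z := by
  rw [← gasperRahman_eq_grPoly]; rfl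

namespace Admissible

variable {N : ℕ} {q : ℂ} {α : ℕ → ℂ} {J : Fin N → ℕ}

/-- In the transfer eigenvalue the term with `s + s'` does not depend on the degree, as the scaling
cancels `Q^{-|n|}`; the added constant removes it. -/
theorem transfer_eq (h : Admissible q α J) (n m : Fin N → ℕ) :
    α 0 * q / α (N + 1) * (transfer (q ^ 2) (α (N + 2)) N (fun i => α (i + 1)) 1 (1 / α 0 ^ 2)
        (normGasperRahman q α n) (supportPt q α m)
      + (1 + 1 / α 0 ^ 2) * (α (N + 1) * (α (N + 2) + (α (N + 2))⁻¹) / (1 + q ^ 2))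
        * discPoly q α n m) = eigenvalue q α N (∑ i, n i) * discPoly q α n m := by
  have hβ : ∀ i ≤ N, α (i + 1) ≠ 0 := fun i hi => h.param_ne_zero (i + 1) (by omega)
  have ht := transfer_grPoly (β := fun i => α (i + 1)) (s' := 1 / α 0 ^ 2) h.ne_zero
    h.one_add_sq_ne_zero h.sq_pow_ne_one (h.param_ne_zero _ le_rfl) hβ one_ne_zero n
    (h.generic_supportPt m)
  have hf : normGasperRahman q α n = fun z => normFactor q α n
      * grPoly (q ^ 2) (α (N + 2)) N (fun i => α (i + 1)) 1 (1 / α 0 ^ 2) n z :=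
    funext fun z => normGasperRahman_eq q α n z
  rw [discPoly, hf, transfer_const_mul, ht, eigenvalue, hEnd]
  clear ht
  beta_reduce
  have h0 := h.param_ne_zero 0 (by omega)
  have h1 := h.param_ne_zero (N + 1) (by omega)
  have h2 := h.one_add_sq_ne_zero
  have h3 := h.ne_zero
  have h4 : (q ^ 2) ^ (∑ i, n i) ≠ 0 := pow_ne_zero _ h.sq_ne_zero
  generalize (q ^ 2) ^ (∑ i, n i) = x at *
  generalize grPoly (q ^ 2) (α (N + 2)) N (fun i => α (i + 1)) 1 (1 / α 0 ^ 2) n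
    (supportPt q α m) = G
  generalize α (N + 2) + (α (N + 2))⁻¹ = W
  field_simp
  ring

theorem halfQDiff_eq (h : Admissible q α J) (n m : Fin N → ℕ) :
    halfQDiff q α n m = 1 / 2 * eigenvalue q α N (∑ i, n i) * discPoly q α n m := by
  rw [halfQDiff, qDiffOp_eq_transfer h.ne_zero h.one_add_sq_ne_zero h.param_ne_zero _
    (h.generic_supportPt m), mul_assoc (1 / 2 : ℂ), ← h.transfer_eq]
  rfl

end Admissible

/-! ### Recurrences in the support label and independence -/

theorem exists_coeff_of_mem_gridSpan {Q w : ℂ} {N : ℕ} {β : ℕ → ℂ} {J μ : Fin N → ℕ} {e : ℤ}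
    {L : ((Fin N → ℂ) → ℂ) → ℂ} (hL : L ∈ gridSpan Q w β J μ e) :
    ∃ c : Box J → ℂ, (∀ ν, c ν ≠ 0 → ((∑ i, (ν i : ℕ) : ℕ) : ℤ) = (∑ i, μ i : ℕ) + e) ∧
      ∀ f, L f = ∑ ν : Box J, c ν * f (gridPt Q w N β fun i => ν i) := by
  rw [gridSpan] at hL
  induction hL using Submodule.span_induction with
  | mem L hL =>
    obtain ⟨μ', h1, h2, rfl⟩ := hL
    let ν₀ : Box J := fun i => ⟨μ' i, Nat.lt_succ_of_le (h1 i)⟩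
    refine ⟨Pi.single ν₀ 1, fun ν hν => ?_, fun f => ?_⟩
    · by_cases e : ν = ν₀
      · rw [e]; exact h2
      · exact absurd (Pi.single_eq_of_ne e _) hν
    · rw [Finset.sum_eq_single ν₀ (fun ν _ e => by rw [Pi.single_eq_of_ne e, zero_mul])
        (fun e => absurd (Finset.mem_univ _) e), Pi.single_eq_same, one_mul]
  | zero => exact ⟨0, fun ν hν => absurd rfl hν, fun f => by simp⟩
  | add L₁ L₂ _ _ h1 h2 =>
    obtain ⟨c₁, a₁, b₁⟩ := h1
    obtain ⟨c₂, a₂, b₂⟩ := h2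
    refine ⟨c₁ + c₂, fun ν hν => ?_, fun f => ?_⟩
    · by_cases e : c₁ ν = 0
      · refine a₂ ν fun e' => hν ?_
        rw [Pi.add_apply, e, e', add_zero]
      · exact a₁ ν e
    · rw [Pi.add_apply, b₁, b₂, ← Finset.sum_add_distrib]
      exact Finset.sum_congr rfl fun ν _ => by rw [Pi.add_apply, add_mul]
  | smul r L _ h1 =>
    obtain ⟨c₁, a₁, b₁⟩ := h1
    refine ⟨r • c₁, fun ν hν => a₁ ν fun e => hν ?_, fun f => ?_⟩
    · rw [Pi.smul_apply, e, smul_zero]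
    · rw [Pi.smul_apply, b₁, smul_eq_mul, Finset.mul_sum]
      exact Finset.sum_congr rfl fun ν _ => by rw [Pi.smul_apply, smul_eq_mul, mul_assoc]

/-- Reversal of the order of the components identifies the two kinds of labels. -/
def dualBoxEquiv {N : ℕ} (J : Fin N → ℕ) : DualBox J ≃ Box J :=
  Equiv.piCongrLeft (fun k => Fin (J k + 1)) Fin.revPerm

theorem dualBoxEquiv_apply {N : ℕ} (J : Fin N → ℕ) (m : DualBox J) (l : Fin N) :
    (dualBoxEquiv J m l : ℕ) = m l.rev := by
  obtain ⟨a, rfl⟩ := Fin.revPerm.surjective l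
  have e : ∀ x y, x = y → (m x : ℕ) = m y := by rintro x _ rfl; rfl
  rw [e (Fin.revPerm a).rev a (Fin.rev_rev a)]
  exact congrArg Fin.val (Equiv.piCongrLeft_apply_apply (fun k => Fin (J k + 1)) Fin.revPerm m a)

theorem supportPt_dualBox {N : ℕ} {q : ℂ} {α : ℕ → ℂ} (hα : ∀ k ≤ N + 2, α k ≠ 0)
    {J : Fin N → ℕ} (m : DualBox J) :
    gridPt (q ^ 2) (α (N + 2)) N (fun i => α (i + 1)) (fun i => dualBoxEquiv J m i)
      = supportPt q α fun k => m k := by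
  rw [supportPt_eq_gridPt q hα]
  congr 1
  funext l
  exact dualBoxEquiv_apply J m l

theorem sum_dualBoxEquiv {N : ℕ} (J : Fin N → ℕ) (m : DualBox J) :
    ∑ i, (dualBoxEquiv J m i : ℕ) = ∑ i, (m i : ℕ) := by
  simp only [dualBoxEquiv_apply]
  exact Equiv.sum_comp Fin.revPerm fun i => (m i : ℕ)

namespace Admissible

variable {N : ℕ} {q : ℂ} {α : ℕ → ℂ} {J : Fin N → ℕ}

/-- The difference operator acts on functions on the discrete support, and shifts the total degree
of the support label by at most one. -/
theorem exists_dual_recurrence (h : Admissible q α J) (m : DualBox J) :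
    ∃ c : DualBox J → ℂ,
      (∀ m', c m' ≠ 0 → |((∑ i, (m' i : ℕ) : ℕ) : ℤ) - (∑ i, (m i : ℕ) : ℕ)| ≤ 1) ∧
      ∀ n : Fin N → ℕ, eigenvalue q α N (∑ i, n i) * discPoly q α n (fun k => m k)
        = ∑ m', c m' * discPoly q α n fun k => m' k := by
  have hβ : ∀ i ≤ N, α (i + 1) ≠ 0 := fun i hi => h.param_ne_zero (i + 1) (by omega)
  obtain ⟨Lp, hLp, Lm, hLm, L, hL, ht⟩ := transfer_gridPt (β := fun i => α (i + 1)) (J := J)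
    (μ := fun i => dualBoxEquiv J m i) h.sq_ne_zero h.one_add_sq_ne_zero
    (h.param_ne_zero _ le_rfl) hβ h.ratio_sq (fun i => Nat.lt_succ_iff.mp (dualBoxEquiv J m i).2)
  obtain ⟨cp, ap, bp⟩ := exists_coeff_of_mem_gridSpan hLp
  obtain ⟨cm, am, bm⟩ := exists_coeff_of_mem_gridSpan hLm
  obtain ⟨c₀, a₀, b₀⟩ := exists_coeff_of_mem_gridSpan hL
  simp only [sum_dualBoxEquiv] at ap am a₀
  have ht' := fun f => ht 1 (1 / α 0 ^ 2) f
  simp only [bp, bm, b₀, ← (dualBoxEquiv J).sum_comp (fun ν => _ * _),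
    supportPt_dualBox h.param_ne_zero] at ht'
  -- The boundary pair is now fixed, so the weights are mere scalars; only the degree constraints on
  -- `cp`, `cm`, `c₀` matter.
  obtain ⟨x, y, v, ht'⟩ : ∃ x y v : ℂ, ∀ f, transfer (q ^ 2) (α (N + 2)) N (fun i => α (i + 1)) 1
      (1 / α 0 ^ 2) f (supportPt q α fun k => m k)
      = x * ∑ m', cp (dualBoxEquiv J m') * f (supportPt q α fun k => m' k)
        + y * ∑ m', cm (dualBoxEquiv J m') * f (supportPt q α fun k => m' k)
        + v * ∑ m', c₀ (dualBoxEquiv J m') * f (supportPt q α fun k => m' k) := ⟨_, _, _, ht'⟩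
  refine ⟨fun m' => α 0 * q / α (N + 1) * (x * cp (dualBoxEquiv J m') + y * cm (dualBoxEquiv J m')
    + v * c₀ (dualBoxEquiv J m') + (1 + 1 / α 0 ^ 2) * (α (N + 1) * (α (N + 2) + (α (N + 2))⁻¹)
      / (1 + q ^ 2)) * if m' = m then 1 else 0), fun m' hm' => ?_, fun n => ?_⟩
  · by_cases e1 : cp (dualBoxEquiv J m') = 0
    · by_cases e2 : cm (dualBoxEquiv J m') = 0
      · by_cases e3 : c₀ (dualBoxEquiv J m') = 0
        · by_cases e4 : m' = m
          · rw [e4]; simp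
          · exact absurd (by simp [e1, e2, e3, e4]) hm'
        · have := a₀ _ e3
          rw [sum_dualBoxEquiv] at this
          rw [this]; simp
      · have := am _ e2
        rw [sum_dualBoxEquiv] at this
        rw [this]; simp
    · have := ap _ e1
      rw [sum_dualBoxEquiv] at this
      rw [this]; simp
  · rw [← h.transfer_eq, ht']
    simp only [mul_add, add_mul, Finset.sum_add_distrib, Finset.mul_sum, mul_ite, ite_mul, mul_zero,
      zero_mul, mul_one, Finset.sum_ite_eq', Finset.mem_univ, if_true, mul_assoc]
    rfl

/-- The discretized polynomials are linearly independent. -/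
theorem independent (h : Admissible q α J) (f : Box J → ℂ)
    (hf : ∀ m : DualBox J, ∑ n : Box J, f n * discPoly q α (fun k => n k) (fun k => m k) = 0) :
    f = 0 := by
  have hβ : ∀ i ≤ N, α (i + 1) ≠ 0 := fun i hi => h.param_ne_zero (i + 1) (by omega)
  have hne : ∀ n : Box J, normFactor q α (fun k => (n k : ℕ)) ≠ 0 := by
    intro n
    have hle : ∑ i, (n i : ℕ) ≤ diam J :=
      Finset.sum_le_sum fun k _ => Nat.lt_succ_iff.mp (n k).isLt
    have n1 := h.norm₁
    have n2 := h.norm₂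
    rw [qPoch_split _ _ hle] at n1 n2
    refine mul_ne_zero (div_ne_zero (pow_ne_zero _ (mul_ne_zero (h.param_ne_zero _ (by omega))
      (h.param_ne_zero _ le_rfl))) (mul_ne_zero (left_ne_zero_of_mul n1) (left_ne_zero_of_mul n2)))
      (inv_ne_zero (Finset.prod_ne_zero_iff.mpr fun i _ => mul_ne_zero
        (pow_ne_zero _ (hβ i i.2.le)) (h.qPoch_ratio_ne_zero (Nat.lt_succ_iff.mp (n i).isLt))))
  have := grPoly_independent (w := α (N + 2)) (β := fun i => α (i + 1)) (s := 1)
    (s' := 1 / α 0 ^ 2) h.ne_zero h.sq_pow_ne_one hβ (fun i hi => h.generic hi) one_ne_zero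
    (fun i hi e => h.generic' hi e) J (fun n => f n * normFactor q α fun k => n k) ?_
  · funext n
    exact (mul_eq_zero.mp (congrFun this n)).resolve_right (hne n)
  · intro μ
    obtain ⟨m, rfl⟩ := (dualBoxEquiv J).surjective μ
    rw [← hf m, supportPt_dualBox h.param_ne_zero]
    refine Finset.sum_congr rfl fun n _ => ?_
    rw [discPoly, normGasperRahman_eq, mul_assoc]

end Admissible

/-! ### Duality -/

/-- The terminating `₄φ₃` series of a `q`-Racah polynomial. -/
def racahSum (Q : ℂ) (n m : ℕ) (X Y U V R : ℂ) : ℂ :=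
  ∑ k ∈ Finset.range (n + 1), qPoch (Q ^ (-(n : ℤ))) Q k * qPoch X Q k * qPoch Y Q k
    * qPoch (Q ^ (-(m : ℤ))) Q k / (qPoch V Q k * qPoch U Q k * qPoch R Q k * qPoch Q Q k) * Q ^ k

/-- Both series terminate at `min n m`, and the summand is symmetric under the exchange. -/
theorem racahSum_comm {Q : ℂ} (hQ : Q ≠ 0) (n m : ℕ) (X Y U V R : ℂ) :
    racahSum Q n m X Y U V R = racahSum Q m n Y X U V R := by
  have key : ∀ (n m : ℕ) (X Y : ℂ), racahSum Q n m X Y U V R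
      = ∑ k ∈ Finset.range (min n m + 1), qPoch (Q ^ (-(n : ℤ))) Q k * qPoch X Q k * qPoch Y Q k
    * qPoch (Q ^ (-(m : ℤ))) Q k / (qPoch V Q k * qPoch U Q k * qPoch R Q k * qPoch Q Q k)
      * Q ^ k := by
    intro n m X Y
    refine (Finset.sum_subset (Finset.range_mono (by omega)) fun k h1 h2 => ?_).symm
    rw [Finset.mem_range] at h1 h2
    rw [qPoch_neg_eq_zero hQ (by omega : m < k)]
    ring
  rw [key, key, min_comm]
  exact Finset.sum_congr rfl fun k _ => by ring

theorem partialSum_add_one {N : ℕ} (n : Fin N → ℕ) (i : Fin N) :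
    partialSum n (i + 1) = partialSum n i + n i := by
  have h : n i = ∑ l : Fin N, if l = i then n l else 0 := by simp
  rw [h, partialSum, partialSum, ← Finset.sum_add_distrib]
  refine Finset.sum_congr rfl fun l _ => ?_
  simp only [Fin.ext_iff]
  split_ifs <;> omega

/-- Each site is counted at most once: `n` contributes at sites up to `i`, the reversed `m` at the
sites after it. -/
theorem partialSum_bound {N : ℕ} {J n m : Fin N → ℕ} (hn : ∀ k, n k ≤ J k)
    (hm : ∀ k, m k ≤ J k.rev) (i : Fin N) :
    partialSum m i.rev + partialSum n i + n i ≤ diam J := by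
  rw [add_assoc, ← partialSum_add_one, partialSum, ← Equiv.sum_comp Fin.revPerm, partialSum, diam,
    ← Finset.sum_add_distrib]
  refine Finset.sum_le_sum fun l _ => ?_
  have h1 := hn l
  have h2 := hm l.rev
  rw [Fin.rev_rev] at h2
  simp only [Fin.revPerm_apply, Fin.val_rev]
  split_ifs <;> omega

theorem sum_partialSum_comm {N : ℕ} (n m : Fin N → ℕ) :
    ∑ i : Fin N, partialSum m i.rev * n i = ∑ i : Fin N, partialSum n i.rev * m i := by
  simp only [partialSum, Finset.sum_mul]
  rw [Finset.sum_comm]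
  refine Finset.sum_congr rfl fun l _ => Finset.sum_congr rfl fun i _ => ?_
  simp only [Fin.val_rev]
  split_ifs
  · ring
  · omega
  · omega
  · ring

theorem qPoch_ne_zero_of_le {a Q : ℂ} {k d : ℕ} (h : k ≤ d) (hd : qPoch a Q d ≠ 0) :
    qPoch a Q k ≠ 0 := by
  rw [qPoch_split a Q h] at hd
  exact left_ne_zero_of_mul hd

/-- Each factor is a quotient of shifted factorials starting at `a`. Multiplied by the common
denominators, both products run along the chain of lengths `partialSum m (N - i) + partialSum n i`,
one omitting the end `|m|`, the other the end `|n|`. -/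
theorem qPoch_telescope {N : ℕ} {J n m : Fin N → ℕ} (hn : ∀ k, n k ≤ J k)
    (hm : ∀ k, m k ≤ J k.rev) {a Q : ℂ} (ha : qPoch a Q (diam J) ≠ 0) :
    qPoch a Q (∑ i, m i)
        * ∏ i : Fin N, qPoch (a * Q ^ (partialSum m i.rev + partialSum n i)) Q (n i)
      = qPoch a Q (∑ i, n i)
        * ∏ i : Fin N, qPoch (a * Q ^ (partialSum n i.rev + partialSum m i)) Q (m i) := by
  have hne : ∏ i : Fin N, qPoch a Q (partialSum m i.rev + partialSum n i) ≠ 0 :=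
    Finset.prod_ne_zero_iff.mpr fun i _ =>
      qPoch_ne_zero_of_le ((Nat.le_add_right _ _).trans (partialSum_bound hn hm i)) ha
  have e : ∀ n m : Fin N → ℕ,
      (∏ i : Fin N, qPoch (a * Q ^ (partialSum m i.rev + partialSum n i)) Q (n i))
        * ∏ i : Fin N, qPoch a Q (partialSum m i.rev + partialSum n i)
      = ∏ i ∈ Finset.range N, qPoch a Q (partialSum m (N - (i + 1)) + partialSum n (i + 1)) := by
    intro n m
    rw [← Finset.prod_mul_distrib, ← Fin.prod_univ_eq_prod_range
      (fun i => qPoch a Q (partialSum m (N - (i + 1)) + partialSum n (i + 1))) N]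
    refine Finset.prod_congr rfl fun i _ => ?_
    rw [partialSum_add_one, ← add_assoc, Fin.val_rev, qPoch_split a Q (Nat.le_add_right _ (n i)),
      Nat.add_sub_cancel_left, mul_comm]
  have hrev : ∏ i : Fin N, qPoch a Q (partialSum m i.rev + partialSum n i)
      = ∏ i : Fin N, qPoch a Q (partialSum n i.rev + partialSum m i) := by
    rw [← Equiv.prod_comp Fin.revPerm]
    refine Finset.prod_congr rfl fun i _ => ?_
    rw [Fin.revPerm_apply, Fin.rev_rev, add_comm]
  have h1 := e n m
  have h2 := e m n
  rw [← hrev] at h2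
  have h3 := Finset.prod_range_succ (fun i => qPoch a Q (partialSum m (N - i) + partialSum n i)) N
  rw [Finset.prod_range_succ'] at h3
  simp only [Nat.sub_zero, partialSum_zero, add_zero, Nat.sub_self, zero_add, partialSum_self] at h3
  have h4 : ∏ i ∈ Finset.range N, qPoch a Q (partialSum m (N - i) + partialSum n i)
      = ∏ i ∈ Finset.range N, qPoch a Q (partialSum n (N - (i + 1)) + partialSum m (i + 1)) := by
    rw [← Finset.prod_range_reflect]
    refine Finset.prod_congr rfl fun i hi => ?_
    rw [Finset.mem_range] at hi
    rw [add_comm, show N - 1 - i = N - (i + 1) by omega, show N - (N - (i + 1)) = i + 1 by omega]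
  rw [h4] at h3
  refine mul_right_cancel₀ hne ?_
  rw [mul_assoc, mul_assoc, h1, h2]
  linear_combination h3

namespace Admissible

variable {N : ℕ} {q : ℂ} {α : ℕ → ℂ} {J : Fin N → ℕ}

theorem followVar_supportPt (h : Admissible q α J) (m : Fin N → ℕ) (i : Fin N) :
    followVar (α (N + 2)) (supportPt q α m) i
      = α (N + 1) * α (N + 2) / α (i + 2) * (q ^ 2) ^ partialSum m i.rev := by
  rw [followVar]
  split_ifs with hi
  · rw [supportPt, pow_mul, Fin.val_rev]
  · have : (i : ℕ) + 1 = N := by omega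
    rw [Fin.val_rev, this, Nat.sub_self, partialSum_zero, show (i : ℕ) + 2 = N + 1 by omega]
    have := h.param_ne_zero (N + 1) (by omega)
    field_simp

/-- The expansion is based at the parameter containing the next variable, which makes the node `c
Q^m`. The usual hypergeometric formula applies since the denominators are covered by the
normalization hypotheses and the bound on partial sums. -/
theorem siteFactor_supportPt (h : Admissible q α J) {n m : Fin N → ℕ} (hn : ∀ k, n k ≤ J k)
    (hm : ∀ k, m k ≤ J k.rev) (i : Fin N) :
    siteFactor (q ^ 2) (n i) (α (i + 1)) (α (i + 2)) (1 * (q ^ 2) ^ partialSum n i)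
        (1 / α 0 ^ 2 * (q ^ 2) ^ partialSum n i) (supportPt q α m i)
        (followVar (α (N + 2)) (supportPt q α m) i)
      = qPoch (α (N + 1) * α (N + 2) / α 0 ^ 2
          * (q ^ 2) ^ (partialSum m i.rev + partialSum n i)) (q ^ 2) (n i)
        * qPoch (α (N + 1) * α (N + 2)
          * (q ^ 2) ^ (partialSum m i.rev + partialSum n i)) (q ^ 2) (n i)
        * qPoch (α (i + 2) ^ 2 / α (i + 1) ^ 2) (q ^ 2) (n i)
        / (α (N + 1) * α (N + 2) / α (i + 1) * (q ^ 2) ^ partialSum m i.rev) ^ n i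
        * racahSum (q ^ 2) (n i) (m i.rev)
          (α (i + 2) ^ 2 / α 0 ^ 2 * (q ^ 2) ^ ((2 * partialSum n i + n i : ℕ) - 1 : ℤ))
          ((α (N + 1) * α (N + 2) / α (i + 1)) ^ 2
            * (q ^ 2) ^ (2 * partialSum m i.rev + m i.rev))
          (α (N + 1) * α (N + 2) * (q ^ 2) ^ (partialSum m i.rev + partialSum n i))
          (α (N + 1) * α (N + 2) / α 0 ^ 2 * (q ^ 2) ^ (partialSum m i.rev + partialSum n i))
          (α (i + 2) ^ 2 / α (i + 1) ^ 2) := by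
  have hQ := h.sq_ne_zero
  have a0 := h.param_ne_zero 0 (by omega)
  have a1 := h.param_ne_zero (i + 1) (by omega)
  have a2 := h.param_ne_zero (i + 2) (by omega)
  have a3 := h.param_ne_zero (N + 1) (by omega)
  have a4 := h.param_ne_zero (N + 2) (by omega)
  have hz : supportPt q α m i
      = α (N + 1) * α (N + 2) / α (i + 1) * (q ^ 2) ^ (partialSum m i.rev + m i.rev) := by
    rw [supportPt, pow_mul, ← partialSum_add_one, Fin.val_rev,
      show N - ((i : ℕ) + 1) + 1 = N - i by omega]
  have hle := partialSum_bound hn hm i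
  have hU := qPoch_ne_zero_of_le hle h.norm₁
  have hV := qPoch_ne_zero_of_le hle h.norm₂
  rw [qPoch_split _ _ (Nat.le_add_right _ (n i)), Nat.add_sub_cancel_left] at hU hV
  replace hU := right_ne_zero_of_mul hU
  replace hV := right_ne_zero_of_mul hV
  have hR := h.qPoch_ratio_ne_zero (hn i)
  have hA : (q ^ 2) ^ partialSum m i.rev ≠ 0 := pow_ne_zero _ hQ
  have hB : (q ^ 2) ^ partialSum n i ≠ 0 := pow_ne_zero _ hQ
  have hM : (q ^ 2) ^ m i.rev ≠ 0 := pow_ne_zero _ hQ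
  have hgz := h.generic_supportPt m i
  rw [siteFactor, h.followVar_supportPt]
  set c := α (N + 1) * α (N + 2) / α (i + 1) * (q ^ 2) ^ partialSum m i.rev with hc
  have hc0 : c ≠ 0 := mul_ne_zero (div_ne_zero (mul_ne_zero a3 a4) a1) hA
  have ec : α (i + 2) / α (i + 1) * (α (N + 1) * α (N + 2) / α (i + 2)
      * (q ^ 2) ^ partialSum m i.rev) = c := by rw [hc]; field_simp
  rw [ec, awPoly_swap h.ne_zero h.sq_pow_ne_one _ hgz (mul_ne_zero a1
    (mul_ne_zero one_ne_zero hB)) hc0]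
  have e1 : c * (α (i + 1) * (1 / α 0 ^ 2 * (q ^ 2) ^ partialSum n i))
      = α (N + 1) * α (N + 2) / α 0 ^ 2 * (q ^ 2) ^ (partialSum m i.rev + partialSum n i) := by
    rw [hc, pow_add]; field_simp
  have e2 : c * (α (i + 1) * (1 * (q ^ 2) ^ partialSum n i))
      = α (N + 1) * α (N + 2) * (q ^ 2) ^ (partialSum m i.rev + partialSum n i) := by
    rw [hc, pow_add]; field_simp
  have e3 : c * (α (i + 2) / α (i + 1) * (α (N + 1) * α (N + 2) / α (i + 2)
      * (q ^ 2) ^ partialSum m i.rev)⁻¹) = α (i + 2) ^ 2 / α (i + 1) ^ 2 := by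
    rw [hc]; field_simp
  rw [awPoly_eq _ _ _ _ _ _ _ (by rwa [e1]) (by rwa [e2]) (by rwa [e3])]
  rw [mul_assoc c (α (i + 1) * (1 / α 0 ^ 2 * (q ^ 2) ^ partialSum n i))]
  simp only [e1, e2, e3]
  congr 1
  rw [racahSum]
  have e4 : c * supportPt q α m i = (α (N + 1) * α (N + 2) / α (i + 1)) ^ 2
            * (q ^ 2) ^ (2 * partialSum m i.rev + m i.rev) := by
    rw [hc, hz, two_mul, pow_add, pow_add, pow_add]; ring
  -- This makes the series terminate at the node label as well as at the degree.
  have e5 : c * (supportPt q α m i)⁻¹ = (q ^ 2) ^ (-(m i.rev : ℤ)) := by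
    rw [hz, hc, zpow_neg, zpow_natCast, pow_add]; field_simp
  have e6 : c * (α (i + 1) * (1 / α 0 ^ 2 * (q ^ 2) ^ partialSum n i)
        * (α (i + 1) * (1 * (q ^ 2) ^ partialSum n i)))
      * (α (i + 2) / α (i + 1) * (α (N + 1) * α (N + 2) / α (i + 2)
      * (q ^ 2) ^ partialSum m i.rev)⁻¹) * (q ^ 2) ^ ((n i : ℤ) - 1)
      = α (i + 2) ^ 2 / α 0 ^ 2 * (q ^ 2) ^ ((2 * partialSum n i + n i : ℕ) - 1 : ℤ) := by
    rw [hc, zpow_sub₀ hQ, zpow_sub₀ hQ, zpow_natCast, zpow_natCast, pow_add _ (2 * _), two_mul,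
      pow_add]
    field_simp
  rw [e4, e5, e6]

/-- The discretized polynomials as products of `q`-Racah polynomials. -/
theorem discPoly_eq (h : Admissible q α J) {n m : Fin N → ℕ} (hn : ∀ k, n k ≤ J k)
    (hm : ∀ k, m k ≤ J k.rev) :
    discPoly q α n m
      = (qPoch (α (N + 1) * α (N + 2)) (q ^ 2) (∑ i, n i)
          * qPoch (α (N + 1) * α (N + 2) / α 0 ^ 2) (q ^ 2) (∑ i, n i))⁻¹
        * (∏ i : Fin N, qPoch (α (N + 1) * α (N + 2)
          * (q ^ 2) ^ (partialSum m i.rev + partialSum n i)) (q ^ 2) (n i))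
        * (∏ i : Fin N, qPoch (α (N + 1) * α (N + 2) / α 0 ^ 2
          * (q ^ 2) ^ (partialSum m i.rev + partialSum n i)) (q ^ 2) (n i))
        * ((q ^ 2) ^ ∑ i : Fin N, partialSum m i.rev * n i)⁻¹
        * ∏ i : Fin N, racahSum (q ^ 2) (n i) (m i.rev)
          (α (i + 2) ^ 2 / α 0 ^ 2 * (q ^ 2) ^ ((2 * partialSum n i + n i : ℕ) - 1 : ℤ))
          ((α (N + 1) * α (N + 2) / α (i + 1)) ^ 2
            * (q ^ 2) ^ (2 * partialSum m i.rev + m i.rev))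
          (α (N + 1) * α (N + 2) * (q ^ 2) ^ (partialSum m i.rev + partialSum n i))
          (α (N + 1) * α (N + 2) / α 0 ^ 2 * (q ^ 2) ^ (partialSum m i.rev + partialSum n i))
          (α (i + 2) ^ 2 / α (i + 1) ^ 2) := by
  have hprod : (α (N + 1) * α (N + 2)) ^ (∑ i, n i)
      = ∏ i : Fin N, (α (N + 1) * α (N + 2)) ^ n i := (Finset.prod_pow_eq_pow_sum _ _ _).symm
  have hprod' : (q ^ 2) ^ (∑ i : Fin N, partialSum m i.rev * n i)
      = ∏ i : Fin N, (q ^ 2) ^ (partialSum m i.rev * n i) :=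
    (Finset.prod_pow_eq_pow_sum _ _ _).symm
  rw [discPoly, normGasperRahman_eq, normFactor, grPoly_eq_prod, hprod, hprod', div_eq_inv_mul]
  simp only [mul_assoc]
  congr 1
  rw [← Finset.prod_inv_distrib, ← Finset.prod_inv_distrib]
  simp only [← Finset.prod_mul_distrib]
  refine Finset.prod_congr rfl fun i _ => ?_
  have := h.siteFactor_supportPt hn hm i
  rw [show (i : ℕ) + 1 + 1 = i + 2 from rfl, this]
  have a1 := h.param_ne_zero (i + 1) (by omega)
  have a3 := h.param_ne_zero (N + 1) (by omega)
  have a4 := h.param_ne_zero (N + 2) (by omega)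
  have hA : (q ^ 2) ^ partialSum m i.rev ≠ 0 := pow_ne_zero _ h.sq_ne_zero
  have hR := h.qPoch_ratio_ne_zero (hn i)
  generalize qPoch (α (i + 2) ^ 2 / α (i + 1) ^ 2) (q ^ 2) (n i) = R at *
  rw [mul_pow (α (N + 1) * α (N + 2) / α (i + 1)), div_pow (α (N + 1) * α (N + 2)),
    pow_mul (q ^ 2) (partialSum m i.rev)]
  have b1 := pow_ne_zero (n i) a1
  have b2 := pow_ne_zero (n i) (mul_ne_zero a3 a4)
  have b3 := pow_ne_zero (n i) hA
  generalize α (i + 1) ^ n i = x at *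
  generalize (α (N + 1) * α (N + 2)) ^ n i = y at *
  generalize ((q ^ 2) ^ partialSum m i.rev) ^ n i = t at *
  field_simp

end Admissible

/-- The parameters of the dual polynomials. -/
def dualParam (N : ℕ) (q : ℂ) (α : ℕ → ℂ) (i : ℕ) : ℂ :=
  if i = 0 then α 0 else if i = N + 2 then α 1 / (α 0 * q)
    else α 0 * (α (N + 1) * α (N + 2)) * q / α (N + 2 - i)

theorem dualParam_zero (N : ℕ) (q : ℂ) (α : ℕ → ℂ) : dualParam N q α 0 = α 0 := rfl

theorem dualParam_last (N : ℕ) (q : ℂ) (α : ℕ → ℂ) :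
    dualParam N q α (N + 2) = α 1 / (α 0 * q) := by
  rw [dualParam, if_neg (by omega), if_pos rfl]

theorem dualParam_of_le {N i : ℕ} (h0 : 0 < i) (h : i ≤ N + 1) (q : ℂ) (α : ℕ → ℂ) :
    dualParam N q α i = α 0 * (α (N + 1) * α (N + 2)) * q / α (N + 2 - i) := by
  rw [dualParam, if_neg (by omega), if_neg (by omega)]

namespace Admissible

variable {N : ℕ} {q : ℂ} {α : ℕ → ℂ} {J : Fin N → ℕ}

theorem dualParam_mul (h : Admissible q α J) :
    dualParam N q α (N + 1) * dualParam N q α (N + 2) = α (N + 1) * α (N + 2) := by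
  rw [dualParam_last, dualParam_of_le (by omega) le_rfl, show N + 2 - (N + 1) = 1 by omega]
  have := h.param_ne_zero 0 (by omega)
  have := h.param_ne_zero 1 (by omega)
  have := h.ne_zero
  field_simp

/-- The product of the last two parameters is preserved, so the normalization hypotheses carry over;
the two genericity hypotheses are interchanged, both being read at the first site. -/
theorem dual (h : Admissible q α J) : Admissible q (dualParam N q α) fun k => J k.rev where
  ne_zero := h.ne_zero
  pow_ne_one := h.pow_ne_one
  param_ne_zero k hk := by
    have h0 := h.param_ne_zero 0 (by omega)
    rw [dualParam]
    split_ifs with h1 h2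
    · exact h0
    · exact div_ne_zero (h.param_ne_zero 1 (by omega)) (mul_ne_zero h0 h.ne_zero)
    · exact div_ne_zero (mul_ne_zero (mul_ne_zero h0 (mul_ne_zero (h.param_ne_zero _ (by omega))
        (h.param_ne_zero _ (by omega)))) h.ne_zero) (h.param_ne_zero _ (by omega))
  ratio k := by
    rw [← h.ratio, dualParam_of_le (by omega) (by omega), dualParam_of_le (by omega) (by omega),
      Fin.val_rev, show N + 2 - ((k : ℕ) + 2) = N - (k + 1) + 1 by omega,
      show N + 2 - ((k : ℕ) + 1) = N - (k + 1) + 2 by omega]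
    have := h.param_ne_zero 0 (by omega)
    have := h.param_ne_zero (N + 1) (by omega)
    have := h.param_ne_zero (N + 2) (by omega)
    have := h.param_ne_zero (N - (k + 1) + 1) (by omega)
    have := h.param_ne_zero (N - (k + 1) + 2) (by omega)
    have := h.ne_zero
    field_simp
  norm₁ := by
    rw [h.dualParam_mul, show diam (fun k : Fin N => J k.rev) = diam J from
      Equiv.sum_comp Fin.revPerm J]
    exact h.norm₁
  norm₂ := by
    rw [h.dualParam_mul, show diam (fun k : Fin N => J k.rev) = diam J from
      Equiv.sum_comp Fin.revPerm J]
    exact h.norm₂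
  gen₁ e he := by
    rw [dualParam_last] at he
    apply h.generic' (Nat.zero_le N) (-(e + 1))
    have hQ := h.sq_ne_zero
    have h0 := h.param_ne_zero 0 (by omega)
    have h3 := h.ne_zero
    rw [zpow_neg, zpow_add₀ hQ, zpow_one, ← he]
    have := h.param_ne_zero 1 (by omega)
    simp only [zero_add]
    field_simp
  gen₂ e he := by
    rw [dualParam_zero, dualParam_of_le (by omega) le_rfl, show N + 2 - (N + 1) = 1 by omega] at he
    apply (h.generic (Nat.zero_le N)).2 (1 - e)
    have hQ := h.sq_ne_zero
    have h0 := h.param_ne_zero 0 (by omega)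
    have h3 := h.ne_zero
    have := h.param_ne_zero 1 (by omega)
    have := h.param_ne_zero (N + 1) (by omega)
    have := h.param_ne_zero (N + 2) (by omega)
    rw [zpow_sub₀ hQ, zpow_one, ← he]
    simp only [zero_add]
    field_simp

/-- Duality between degree labels and support labels. -/
theorem discPoly_dual (h : Admissible q α J) {n m : Fin N → ℕ} (hn : ∀ k, n k ≤ J k)
    (hm : ∀ k, m k ≤ J k.rev) :
    discPoly q (dualParam N q α) m n = discPoly q α n m := by
  rw [h.dual.discPoly_eq hm (fun k => by rw [Fin.rev_rev]; exact hn k), h.discPoly_eq hn hm,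
    h.dualParam_mul, dualParam_zero, sum_partialSum_comm n m]
  have t1 := qPoch_telescope hn hm h.norm₁
  have t2 := qPoch_telescope hn hm h.norm₂
  have hsn : ∑ i, n i ≤ diam J := Finset.sum_le_sum fun k _ => hn k
  have hsm : ∑ i, m i ≤ diam J :=
    (Finset.sum_le_sum fun k _ => hm k).trans (Equiv.sum_comp Fin.revPerm J).le
  have u1 := qPoch_ne_zero_of_le hsn h.norm₁
  have u2 := qPoch_ne_zero_of_le hsm h.norm₁
  have v1 := qPoch_ne_zero_of_le hsn h.norm₂
  have v2 := qPoch_ne_zero_of_le hsm h.norm₂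
  congr 1
  · congr 1
    generalize (∏ i : Fin N, qPoch (α (N + 1) * α (N + 2)
      * (q ^ 2) ^ (partialSum m i.rev + partialSum n i)) (q ^ 2) (n i)) = P1 at *
    generalize (∏ i : Fin N, qPoch (α (N + 1) * α (N + 2) / α 0 ^ 2
      * (q ^ 2) ^ (partialSum m i.rev + partialSum n i)) (q ^ 2) (n i)) = P2 at *
    generalize (∏ i : Fin N, qPoch (α (N + 1) * α (N + 2)
      * (q ^ 2) ^ (partialSum n i.rev + partialSum m i)) (q ^ 2) (m i)) = P3 at *
    generalize (∏ i : Fin N, qPoch (α (N + 1) * α (N + 2) / α 0 ^ 2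
      * (q ^ 2) ^ (partialSum n i.rev + partialSum m i)) (q ^ 2) (m i)) = P4 at *
    generalize qPoch (α (N + 1) * α (N + 2)) (q ^ 2) (∑ i, n i) = x1 at *
    generalize qPoch (α (N + 1) * α (N + 2)) (q ^ 2) (∑ i, m i) = x2 at *
    generalize qPoch (α (N + 1) * α (N + 2) / α 0 ^ 2) (q ^ 2) (∑ i, n i) = y1 at *
    generalize qPoch (α (N + 1) * α (N + 2) / α 0 ^ 2) (q ^ 2) (∑ i, m i) = y2 at *
    have w1 : P1 = x1 * P3 / x2 := by rw [eq_div_iff u2]; linear_combination t1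
    have w2 : P2 = y1 * P4 / y2 := by rw [eq_div_iff v2]; linear_combination t2
    rw [w1, w2]
    field_simp
  · rw [← Equiv.prod_comp Fin.revPerm]
    refine Finset.prod_congr rfl fun i _ => ?_
    have a0 := h.param_ne_zero 0 (by omega)
    have a1 := h.param_ne_zero (i + 1) (by omega)
    have a2 := h.param_ne_zero (i + 2) (by omega)
    have a3 := h.param_ne_zero (N + 1) (by omega)
    have a4 := h.param_ne_zero (N + 2) (by omega)
    have hQ := h.sq_ne_zero
    have hq := h.ne_zero
    rw [racahSum_comm hQ, Fin.revPerm_apply, Fin.rev_rev]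
    have p1 : dualParam N q α ((i.rev : ℕ) + 2)
        = α 0 * (α (N + 1) * α (N + 2)) * q / α (i + 1) := by
      rw [dualParam_of_le (by omega) (by rw [Fin.val_rev]; omega), Fin.val_rev]
      congr 2; omega
    have p2 : dualParam N q α ((i.rev : ℕ) + 1)
        = α 0 * (α (N + 1) * α (N + 2)) * q / α (i + 2) := by
      rw [dualParam_of_le (by omega) (by rw [Fin.val_rev]; omega), Fin.val_rev]
      congr 2; omega
    rw [p1, p2, add_comm (partialSum n i)]
    congr 1
    · rw [zpow_sub₀ hQ, zpow_natCast, zpow_one]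
      field_simp
    · rw [zpow_sub₀ hQ, zpow_natCast, zpow_one]
      field_simp
    · field_simp

theorem eigenvalue_dual [NeZero N] (h : Admissible q α J) (m : Fin N → ℕ) :
    eigenvalue q (dualParam N q α) N (∑ i, m i) = 2 * x1 q α m := by
  rw [eigenvalue, x1, supportPt, dualParam_zero, dualParam_of_le (by omega) le_rfl,
    show N + 2 - (N + 1) = 1 by omega, Fin.val_zero, Nat.sub_zero, partialSum_self, pow_mul]
  have := h.param_ne_zero 0 (by omega)
  have := h.param_ne_zero 1 (by omega)
  have := h.param_ne_zero (N + 1) (by omega)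
  have := h.param_ne_zero (N + 2) (by omega)
  have := h.ne_zero
  have := pow_ne_zero (∑ i, m i) h.sq_ne_zero
  simp only [zero_add]
  generalize (q ^ 2) ^ (∑ i, m i) = x at *
  field_simp
  ring

end Admissible

/-! ### Tridiagonal pairs of operators and the `q`-Onsager relations -/

theorem comm_qComm_qComm_apply {V : Type*} [AddCommGroup V] [Module ℂ V] {q : ℂ} (hq : q ≠ 0)
    (A B : Module.End ℂ V) (x : V) :
    comm A (qComm q⁻¹ A (qComm q A B)) x
      = A (A (A (B x))) - (q ^ 2 + (q ^ 2)⁻¹ + 1) • A (A (B (A x)))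
        + (q ^ 2 + (q ^ 2)⁻¹ + 1) • A (B (A (A x))) - B (A (A (A x))) := by
  simp only [comm, qComm, LinearMap.sub_apply, Module.End.mul_apply, LinearMap.smul_apply,
    map_sub, map_smul, inv_inv, smul_sub, smul_smul]
  match_scalars <;> field_simp <;> ring

/-- The condition on two consecutive eigenvalues that makes the `q`-Onsager relation hold. -/
def IsOnsagerPair (q ρ s t : ℂ) : Prop :=
  s ^ 3 - (q ^ 2 + (q ^ 2)⁻¹ + 1) * s ^ 2 * t + (q ^ 2 + (q ^ 2)⁻¹ + 1) * s * t ^ 2 - t ^ 3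
    = ρ * (s - t)

/-- On `v i` the coefficient of `v j` in the relation is `b i j` times the difference of the two
sides of `IsOnsagerPair` at `(θ j, θ i)`. The family `v` need not be independent. -/
theorem onsager_relation_of_tridiagonal {V ι : Type*} [AddCommGroup V] [Module ℂ V] [Fintype ι]
    {q ρ : ℂ} (hq : q ≠ 0) {A B : Module.End ℂ V} {v : ι → V} {θ : ι → ℂ} {b : ι → ι → ℂ}
    (hA : ∀ i, A (v i) = θ i • v i) (hB : ∀ i, B (v i) = ∑ j, b i j • v j)
    (hb : ∀ i j, b i j ≠ 0 → IsOnsagerPair q ρ (θ j) (θ i)) {x : V}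
    (hx : x ∈ Submodule.span ℂ (Set.range v)) :
    comm A (qComm q⁻¹ A (qComm q A B)) x = (ρ • comm A B) x := by
  refine LinearMap.eqOn_span (f := comm A (qComm q⁻¹ A (qComm q A B))) (g := ρ • comm A B)
    ?_ hx
  rintro _ ⟨i, rfl⟩
  rw [comm_qComm_qComm_apply hq]
  simp only [comm, LinearMap.smul_apply, LinearMap.sub_apply, Module.End.mul_apply, hA, hB,
    map_sum, map_smul, Finset.smul_sum, smul_smul, ← Finset.sum_sub_distrib,
    ← Finset.sum_add_distrib, ← sub_smul, ← add_smul]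
  refine Finset.sum_congr rfl fun j _ => ?_
  congr 1
  by_cases h : b i j = 0
  · simp [h]
  · have := hb i j h
    rw [IsOnsagerPair] at this
    linear_combination b i j * this

theorem exists_onsager_hom {V : Type*} [AddCommGroup V] [Module ℂ V] (q ρ : ℂ)
    (S : Submodule ℂ V) (A : Fin 2 → Module.End ℂ V) (hS : ∀ i, ∀ x ∈ S, A i x ∈ S)
    (hA : ∀ i j, i ≠ j → ∀ x ∈ S,
      comm (A i) (qComm q⁻¹ (A i) (qComm q (A i) (A j))) x = (ρ • comm (A i) (A j)) x) :
    ∃ φ : QOnsager q ρ →ₐ[ℂ] Module.End ℂ S,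
      ∀ i x, ((φ (QOnsager.W q ρ i) x : S) : V) = A i x := by
  refine ⟨RingQuot.liftAlgHom ℂ ⟨FreeAlgebra.lift ℂ fun i => (A i).restrict (hS i), ?_⟩, ?_⟩
  · rintro _ _ ⟨i, j, hij⟩
    ext x
    have := hA i j hij x x.2
    simpa [comm, qComm] using this
  · intro i x
    simp [QOnsager.W]

/-- A matrix `R` satisfying tridiagonal recurrences in both indices makes its row space a module
over the `q`-Onsager algebra, in two ways. -/
theorem exists_operators_of_recurrences {I K : Type*} [Fintype I] [Fintype K] {q ρ : ℂ}
    (hq : q ≠ 0) {R : I → K → ℂ} {μ : I → ℂ} {θ : K → ℂ} {b : I → I → ℂ} {c : K → K → ℂ}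
    (hrow : ∀ i k, θ k * R i k = ∑ j, b i j * R j k)
    (hcol : ∀ i k, μ i * R i k = ∑ l, c k l * R i l)
    (hb : ∀ i j, b i j ≠ 0 → IsOnsagerPair q ρ (μ j) (μ i))
    (hc : ∀ k l, c k l ≠ 0 → IsOnsagerPair q ρ (θ k) (θ l)) :
    ∃ A B : Module.End ℂ (K → ℂ),
      (∀ i k, A (R i) k = θ k * R i k) ∧ (∀ i, B (R i) = μ i • R i) ∧
      (∀ x ∈ Submodule.span ℂ (Set.range R), A x ∈ Submodule.span ℂ (Set.range R)) ∧
      (∀ x ∈ Submodule.span ℂ (Set.range R), B x ∈ Submodule.span ℂ (Set.range R)) ∧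
      (∀ x, comm A (qComm q⁻¹ A (qComm q A B)) x = (ρ • comm A B) x) ∧
      ∀ x ∈ Submodule.span ℂ (Set.range R),
        comm B (qComm q⁻¹ B (qComm q B A)) x = (ρ • comm B A) x := by
  classical
  have hA : ∀ i, LinearMap.mulLeft ℂ θ (R i) = ∑ j, b i j • R j := by
    intro i
    ext k
    simp [hrow]
  have hB : ∀ i, Matrix.mulVecLin (Matrix.of c) (R i) = μ i • R i := by
    intro i
    ext k
    simp [hcol, Matrix.mulVec, dotProduct]
  have hmem : ∀ i, R i ∈ Submodule.span ℂ (Set.range R) := fun i => Submodule.subset_span ⟨i, rfl⟩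
  refine ⟨LinearMap.mulLeft ℂ θ, Matrix.mulVecLin (Matrix.of c), fun i k => rfl, hB, ?_, ?_, ?_,
    ?_⟩
  · intro x hx
    refine (Submodule.span_le (p := (Submodule.span ℂ (Set.range R)).comap
      (LinearMap.mulLeft ℂ θ))).mpr ?_ hx
    rintro _ ⟨i, rfl⟩
    rw [SetLike.mem_coe, Submodule.mem_comap, hA]
    exact Submodule.sum_mem _ fun j _ => Submodule.smul_mem _ _ (hmem j)
  · intro x hx
    refine (Submodule.span_le (p := (Submodule.span ℂ (Set.range R)).comap
      (Matrix.mulVecLin (Matrix.of c)))).mpr ?_ hx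
    rintro _ ⟨i, rfl⟩
    rw [SetLike.mem_coe, Submodule.mem_comap, hB]
    exact Submodule.smul_mem _ _ (hmem i)
  -- Indicator functions are eigenvectors of multiplication, so this relation holds on the whole
  -- function space, with the transpose of `c` as matrix.
  · intro x
    refine onsager_relation_of_tridiagonal hq (v := fun k => Pi.single k (1 : ℂ)) (θ := θ)
      (b := fun k l => c l k) ?_ ?_ (fun k l h => hc l k h) ?_
    · intro k
      ext l
      by_cases h : l = k
      · subst h; simp
      · simp [h]
    · intro k
      ext l
      simp [Matrix.mulVec, dotProduct, Pi.single_apply]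
    · have := (Pi.basisFun ℂ K).span_eq
      rw [show ⇑(Pi.basisFun ℂ K) = fun k => Pi.single k (1 : ℂ) from
        funext fun k => Pi.basisFun_apply ℂ K k] at this
      rw [this]
      trivial
  -- Here the eigenvectors are the rows of `R`, so the relation is obtained on their span.
  · intro x hx
    exact onsager_relation_of_tridiagonal hq hB hA hb hx

theorem iSupIndep_span_of_eigenvectors {V ι : Type*} [AddCommGroup V] [Module ℂ V]
    {B : Module.End ℂ V} {v : ι → V} {d : ι → ℕ} {μ : ℕ → ℂ} (hμ : Function.Injective μ)
    (hB : ∀ i, B (v i) = μ (d i) • v i) (D : ℕ) :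
    iSupIndep fun p : Fin (D + 1) => Submodule.span ℂ {f | ∃ i, d i = p ∧ f = v i} := by
  refine (B.eigenspaces_iSupIndep.comp (hμ.comp Fin.val_injective)).mono fun p => ?_
  rw [Submodule.span_le]
  rintro _ ⟨i, hi, rfl⟩
  refine Module.End.mem_eigenspace_iff.mpr ?_
  rw [hB, hi]
  rfl

theorem iSup_span_degree {V ι : Type*} [AddCommGroup V] [Module ℂ V] {v : ι → V} {d : ι → ℕ}
    {D : ℕ} (hd : ∀ i, d i ≤ D) :
    ⨆ p : Fin (D + 1), Submodule.span ℂ {f | ∃ i, d i = p ∧ f = v i}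
      = Submodule.span ℂ (Set.range v) := by
  rw [← Submodule.span_iUnion]
  congr 1
  ext f
  simp only [Set.mem_iUnion, Set.mem_ofPred_eq, Set.mem_range]
  constructor
  · rintro ⟨p, i, -, rfl⟩
    exact ⟨i, rfl⟩
  · rintro ⟨i, rfl⟩
    exact ⟨⟨d i, Nat.lt_succ_of_le (hd i)⟩, i, rfl, rfl⟩

/-! ### The two modules -/

/-- Reversing the sequence of sizes twice gives back the original box. -/
def doubleDualBoxEquiv {N : ℕ} (J : Fin N → ℕ) : DualBox (fun k => J k.rev) ≃ Box J :=
  Equiv.piCongrRight fun k => finCongr (by simp only [Fin.rev_rev])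

theorem doubleDualBoxEquiv_apply {N : ℕ} (J : Fin N → ℕ) (m : DualBox fun k => J k.rev)
    (k : Fin N) : (doubleDualBoxEquiv J m k : ℕ) = m k := rfl

theorem doubleDualBoxEquiv_symm_apply {N : ℕ} (J : Fin N → ℕ) (n : Box J)
    (k : Fin N) : ((doubleDualBoxEquiv J).symm n k : ℕ) = n k := rfl

theorem sum_box_le {N : ℕ} {J : Fin N → ℕ} (n : Box J) : ∑ k, (n k : ℕ) ≤ diam J :=
  Finset.sum_le_sum fun k _ => Nat.lt_succ_iff.mp (n k).isLt

theorem sum_dualBox_le {N : ℕ} {J : Fin N → ℕ} (m : DualBox J) : ∑ k, (m k : ℕ) ≤ diam J :=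
  (Finset.sum_le_sum fun k _ => Nat.lt_succ_iff.mp (m k).isLt).trans
    (Equiv.sum_comp Fin.revPerm J).le

theorem starSpace_eq {N : ℕ} (q : ℂ) (α : ℕ → ℂ) (J : Fin N → ℕ) :
    starSpace q α J = Submodule.span ℂ (Set.range (polyOfLabel q α J)) :=
  iSup_span_degree sum_box_le

theorem dualSpace_eq {N : ℕ} (q : ℂ) (α : ℕ → ℂ) (J : Fin N → ℕ) :
    dualSpace q α J = Submodule.span ℂ (Set.range (polyOfDualLabel q α J)) :=
  iSup_span_degree sum_dualBox_le

namespace Admissible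

variable {N : ℕ} {q : ℂ} {α : ℕ → ℂ} {J : Fin N → ℕ}

/-- Two equal eigenvalues at `k ≠ l` would force `α (N + 1) ^ 2 / α 0 ^ 2 = Q^{1-k-l}`, contrary to
genericity. -/
theorem eigenvalue_injective (h : Admissible q α J) :
    Function.Injective fun k => 1 / 2 * eigenvalue q α N k := by
  intro k l hkl
  by_contra hne
  have hQ := h.sq_ne_zero
  have h0 := h.param_ne_zero 0 (by omega)
  have h1 := h.param_ne_zero (N + 1) (by omega)
  have hq := h.ne_zero
  have hk := pow_ne_zero k hQ
  have hl := pow_ne_zero l hQ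
  have hd : (q ^ 2) ^ k ≠ (q ^ 2) ^ l := by
    intro e
    have := zpow_ne_one_of_pow h.sq_pow_ne_one (e := (k : ℤ) - l) (by omega)
    rw [zpow_sub₀ hQ, zpow_natCast, zpow_natCast, e, div_self hl] at this
    exact this rfl
  refine h.gen₂ (1 - k - l) ?_
  rw [zpow_sub₀ hQ, zpow_sub₀ hQ, zpow_natCast, zpow_natCast, zpow_one]
  simp only [eigenvalue] at hkl
  generalize (q ^ 2) ^ k = x at *
  generalize (q ^ 2) ^ l = y at *
  field_simp at hkl ⊢
  refine mul_left_cancel₀ (sub_ne_zero.mpr hd) ?_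
  linear_combination hkl

/-- The cubic factors as `(s - t)(s² - (q² + q⁻²) s t + t² - ρ)`. For neighbouring eigenvalues the
second factor vanishes; as the coefficients of `Q^{-k}` and `Q^k` have product one, the factors `1 /
2` account for the `4` in `ρ`. -/
theorem isOnsagerPair_eigenvalue (h : Admissible q α J) {k l : ℕ} (hkl : |(k : ℤ) - l| ≤ 1) :
    IsOnsagerPair q (-(q ^ 2 - (q ^ 2)⁻¹) ^ 2 / 4) (1 / 2 * eigenvalue q α N k)
      (1 / 2 * eigenvalue q α N l) := by
  have hQ := h.sq_ne_zero
  have h0 := h.param_ne_zero 0 (by omega)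
  have h1 := h.param_ne_zero (N + 1) (by omega)
  have hq := h.ne_zero
  rw [abs_le] at hkl
  have key : ∀ k : ℕ, IsOnsagerPair q (-(q ^ 2 - (q ^ 2)⁻¹) ^ 2 / 4) (1 / 2 * eigenvalue q α N k)
      (1 / 2 * eigenvalue q α N (k + 1)) := by
    intro k
    have hk := pow_ne_zero k hQ
    simp only [IsOnsagerPair, eigenvalue, pow_succ (q ^ 2)]
    generalize (q ^ 2) ^ k = x at *
    field_simp
    ring
  rcases (by omega : k = l ∨ l = k + 1 ∨ k = l + 1) with rfl | rfl | rfl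
  · rw [IsOnsagerPair]; ring
  · exact key k
  · have := key l
    rw [IsOnsagerPair] at this ⊢
    linear_combination -this

/-- The recurrence in the support label for the dual parameters, carried over by duality. -/
theorem exists_degree_recurrence [NeZero N] (h : Admissible q α J) (n : Box J) :
    ∃ c : Box J → ℂ,
      (∀ n', c n' ≠ 0 → |((∑ i, (n' i : ℕ) : ℕ) : ℤ) - (∑ i, (n i : ℕ) : ℕ)| ≤ 1) ∧
      ∀ m : DualBox J, 2 * x1 q α (fun k => m k) * polyOfLabel q α J n m
        = ∑ n', c n' * polyOfLabel q α J n' m := by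
  obtain ⟨c, hc, hrec⟩ := h.dual.exists_dual_recurrence ((doubleDualBoxEquiv J).symm n)
  refine ⟨fun n' => c ((doubleDualBoxEquiv J).symm n'), fun n' hn' => ?_, fun m => ?_⟩
  · have := hc _ hn'
    simpa only [doubleDualBoxEquiv_symm_apply] using this
  · have hn : ∀ (n : Box J) (k), (n k : ℕ) ≤ J k := fun n k => Nat.lt_succ_iff.mp (n k).isLt
    have hm : ∀ k, (m k : ℕ) ≤ J k.rev := fun k => Nat.lt_succ_iff.mp (m k).isLt
    have := hrec fun k => m k
    rw [h.eigenvalue_dual] at this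
    simp only [doubleDualBoxEquiv_symm_apply] at this
    rw [h.discPoly_dual (hn n) hm] at this
    rw [polyOfLabel, this, ← Equiv.sum_comp (doubleDualBoxEquiv J).symm]
    refine Finset.sum_congr rfl fun n' _ => ?_
    simp only [doubleDualBoxEquiv_symm_apply]
    rw [h.discPoly_dual (hn n') hm]
    rfl

theorem linearIndependent_polyOfLabel (h : Admissible q α J) :
    LinearIndependent ℂ (polyOfLabel q α J) := by
  rw [Fintype.linearIndependent_iff]
  intro f hf
  refine congrFun (h.independent f fun m => ?_)
  have := congrFun hf m
  simpa [polyOfLabel] using this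

theorem linearIndependent_polyOfDualLabel (h : Admissible q α J) :
    LinearIndependent ℂ (polyOfDualLabel q α J) := by
  rw [Fintype.linearIndependent_iff]
  intro f hf
  refine congrFun (h.dual.independent f fun n => ?_)
  have := congrFun hf (doubleDualBoxEquiv J n)
  simp only [Finset.sum_apply, Pi.smul_apply, polyOfDualLabel, smul_eq_mul, Pi.zero_apply,
    doubleDualBoxEquiv_apply] at this
  rw [← this]
  refine Finset.sum_congr rfl fun m _ => ?_
  rw [h.discPoly_dual (fun k => ?_) fun k => Nat.lt_succ_iff.mp (m k).isLt]
  exact Nat.lt_succ_iff.mp (doubleDualBoxEquiv J n k).isLt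

theorem exists_star_operators [NeZero N] (h : Admissible q α J) :
    ∃ A B : Module.End ℂ (DualBox J → ℂ),
      (∀ n m, A (polyOfLabel q α J n) m = x1 q α (fun k => m k) * polyOfLabel q α J n m) ∧
      (∀ n : Box J, B (polyOfLabel q α J n)
        = (1 / 2 * eigenvalue q α N (∑ k, (n k : ℕ))) • polyOfLabel q α J n) ∧
      ∃ φ : QOnsager q (-(q ^ 2 - (q ^ 2)⁻¹) ^ 2 / 4) →ₐ[ℂ] Module.End ℂ (starSpace q α J),
        ∀ x : starSpace q α J, (φ (QOnsager.W q _ 0) x).1 = A x ∧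
          (φ (QOnsager.W q _ 1) x).1 = B x := by
  choose b hb hrow using h.exists_degree_recurrence
  choose c hc hcol using h.exists_dual_recurrence
  have hθ : ∀ m : DualBox J, x1 q α (fun k => m k)
      = 1 / 2 * eigenvalue q (dualParam N q α) N (∑ k, (m k : ℕ)) := fun m => by
    rw [h.eigenvalue_dual]; ring
  obtain ⟨A, B, hA, hB, hAS, hBS, hAB, hBA⟩ := exists_operators_of_recurrences
    (ρ := -(q ^ 2 - (q ^ 2)⁻¹) ^ 2 / 4) h.ne_zero
    (R := polyOfLabel q α J) (μ := fun n => 1 / 2 * eigenvalue q α N (∑ k, (n k : ℕ)))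
    (θ := fun m => x1 q α fun k => m k) (b := fun n n' => 1 / 2 * b n n')
    (c := fun m m' => 1 / 2 * c m m')
    (fun n m => by
      simp only [mul_assoc, ← Finset.mul_sum]
      rw [← hrow]; ring)
    (fun n m => by
      simp only [mul_assoc, ← Finset.mul_sum]
      exact congrArg _ (hcol m fun k => n k))
    (fun n n' hn => h.isOnsagerPair_eigenvalue (hb n n' (right_ne_zero_of_mul hn)))
    (fun m m' hm => by
      simp only [hθ]
      refine h.dual.isOnsagerPair_eigenvalue ?_
      rw [abs_sub_comm]
      exact hc m m' (right_ne_zero_of_mul hm))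
  refine ⟨A, B, hA, hB, ?_⟩
  rw [← starSpace_eq] at hAS hBS hBA
  obtain ⟨φ, hφ⟩ := exists_onsager_hom q (-(q ^ 2 - (q ^ 2)⁻¹) ^ 2 / 4) (starSpace q α J) ![A, B]
    (fun i => by fin_cases i <;> assumption)
    (fun i j hij x hx => by
      fin_cases i <;> fin_cases j
      · exact absurd rfl hij
      · exact hAB x
      · exact hBA x hx
      · exact absurd rfl hij)
  exact ⟨φ, fun x => ⟨hφ 0 x, hφ 1 x⟩⟩

theorem exists_dual_operators [NeZero N] (h : Admissible q α J) :
    ∃ A B : Module.End ℂ (Box J → ℂ),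
      (∀ m : DualBox J, A (polyOfDualLabel q α J m)
        = (1 / 2 * eigenvalue q (dualParam N q α) N (∑ k, (m k : ℕ))) • polyOfDualLabel q α J m) ∧
      (∀ m n, B (polyOfDualLabel q α J m) n
        = 1 / 2 * eigenvalue q α N (∑ k, (n k : ℕ)) * polyOfDualLabel q α J m n) ∧
      ∃ φ : QOnsager q (-(q ^ 2 - (q ^ 2)⁻¹) ^ 2 / 4) →ₐ[ℂ] Module.End ℂ (dualSpace q α J),
        ∀ x : dualSpace q α J, (φ (QOnsager.W q _ 0) x).1 = A x ∧
          (φ (QOnsager.W q _ 1) x).1 = B x := by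
  choose b hb hrow using h.exists_degree_recurrence
  choose c hc hcol using h.exists_dual_recurrence
  -- For the transposed matrix the roles are exchanged: `W₁` is a multiplication operator and `W₀`
  -- acts through the recurrence in the degree label.
  obtain ⟨B, A, hB, hA, hBS, hAS, hBA, hAB⟩ := exists_operators_of_recurrences
    (ρ := -(q ^ 2 - (q ^ 2)⁻¹) ^ 2 / 4) h.ne_zero
    (R := polyOfDualLabel q α J)
    (μ := fun m => 1 / 2 * eigenvalue q (dualParam N q α) N (∑ k, (m k : ℕ)))
    (θ := fun n => 1 / 2 * eigenvalue q α N (∑ k, (n k : ℕ)))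
    (b := fun m m' => 1 / 2 * c m m') (c := fun n n' => 1 / 2 * b n n')
    (fun m n => by
      simp only [mul_assoc, ← Finset.mul_sum]
      exact congrArg _ (hcol m fun k => n k))
    (fun m n => by
      simp only [mul_assoc, ← Finset.mul_sum]
      rw [h.eigenvalue_dual]
      exact congrArg _ (hrow n m))
    (fun m m' hm => h.dual.isOnsagerPair_eigenvalue (hc m m' (right_ne_zero_of_mul hm)))
    (fun n n' hn => by
      refine h.isOnsagerPair_eigenvalue ?_
      rw [abs_sub_comm]
      exact hb n n' (right_ne_zero_of_mul hn))
  refine ⟨A, B, hA, hB, ?_⟩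
  rw [← dualSpace_eq] at hAS hBS hAB
  obtain ⟨φ, hφ⟩ := exists_onsager_hom q (-(q ^ 2 - (q ^ 2)⁻¹) ^ 2 / 4) (dualSpace q α J) ![A, B]
    (fun i => by fin_cases i <;> assumption)
    (fun i j hij x hx => by
      fin_cases i <;> fin_cases j
      · exact absurd rfl hij
      · exact hAB x hx
      · exact hBA x
      · exact absurd rfl hij)
  exact ⟨φ, fun x => ⟨hφ 0 x, hφ 1 x⟩⟩

end Admissible

end GasperRahman

end

/-! ### Assembly of the proposition -/

theorem mainTheorem4 (N : ℕ) [NeZero N] (q : ℂ) (hq0 : q ≠ 0)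
    (hq : ∀ k : ℕ, 0 < k → q ^ k ≠ 1)
    (α : ℕ → ℂ) (hα : ∀ k ≤ N + 2, α k ≠ 0)
    (twoJ : Fin N → ℕ) (hJ : ∀ k, 0 < twoJ k)
    (hratio : ∀ k : Fin N, α (k + 2) / α (k + 1) = q ^ (-(twoJ k : ℤ)))
    (hnorm₁ : GasperRahman.qPoch (α (N + 1) * α (N + 2)) (q ^ 2) (GasperRahman.diam twoJ) ≠ 0)
    (hnorm₂ : GasperRahman.qPoch (α (N + 1) * α (N + 2) / α 0 ^ 2) (q ^ 2)
      (GasperRahman.diam twoJ) ≠ 0)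
    (hgen₁ : ∀ e : ℤ, α (N + 2) ^ 2 ≠ (q ^ 2) ^ e)
    (hgen₂ : ∀ e : ℤ, α (N + 1) ^ 2 / α 0 ^ 2 ≠ (q ^ 2) ^ e) :
    -- the sums of the graded pieces are direct
    (iSupIndep (GasperRahman.starDegree q α twoJ) ∧
      iSupIndep (GasperRahman.dualDegree q α twoJ)) ∧
    -- the module of discretized polynomials, as functions of the support label
    (∃ φ : GasperRahman.QOnsager q (-(q ^ 2 - (q ^ 2)⁻¹) ^ 2 / 4) →ₐ[ℂ]
        Module.End ℂ (GasperRahman.starSpace q α twoJ),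
      ∀ (n : GasperRahman.Box twoJ) (m : GasperRahman.DualBox twoJ),
        (φ (GasperRahman.QOnsager.W q _ 0) (GasperRahman.starVec q α twoJ n)).1 m
          = GasperRahman.x1 q α (fun k => m k)
            * GasperRahman.discPoly q α (fun k => n k) (fun k => m k) ∧
        (φ (GasperRahman.QOnsager.W q _ 1) (GasperRahman.starVec q α twoJ n)).1 m
          = GasperRahman.halfQDiff q α (fun k => n k) (fun k => m k)) ∧
    -- the module of discretized polynomials, as functions of the degree label
    (∃ φ : GasperRahman.QOnsager q (-(q ^ 2 - (q ^ 2)⁻¹) ^ 2 / 4) →ₐ[ℂ]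
        Module.End ℂ (GasperRahman.dualSpace q α twoJ),
      ∀ (n : GasperRahman.Box twoJ) (m : GasperRahman.DualBox twoJ),
        (φ (GasperRahman.QOnsager.W q _ 0) (GasperRahman.dualVec q α twoJ m)).1 n
          = GasperRahman.x1 q α (fun k => m k)
            * GasperRahman.discPoly q α (fun k => n k) (fun k => m k) ∧
        (φ (GasperRahman.QOnsager.W q _ 1) (GasperRahman.dualVec q α twoJ m)).1 n
          = GasperRahman.halfQDiff q α (fun k => n k) (fun k => m k)) ∧
    -- both modules have finite dimension `∏ (2 j_k + 1)`
    FiniteDimensional ℂ (GasperRahman.starSpace q α twoJ) ∧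
    FiniteDimensional ℂ (GasperRahman.dualSpace q α twoJ) ∧
    Module.finrank ℂ (GasperRahman.starSpace q α twoJ) = ∏ k, (twoJ k + 1) ∧
    Module.finrank ℂ (GasperRahman.dualSpace q α twoJ) = ∏ k, (twoJ k + 1) := by
  have h : GasperRahman.Admissible q α twoJ :=
    ⟨hq0, hq, hα, hratio, hnorm₁, hnorm₂, hgen₁, hgen₂⟩
  obtain ⟨A, B, hA, hB, φ, hφ⟩ := h.exists_star_operators
  obtain ⟨A', B', hA', hB', φ', hφ'⟩ := h.exists_dual_operators
  -- The graded pieces lie in eigenspaces of the operator giving `W₁` for degree labels, and of the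
  -- one giving `W₀` for support labels.
  refine ⟨⟨GasperRahman.iSupIndep_span_of_eigenvectors h.eigenvalue_injective hB _,
    GasperRahman.iSupIndep_span_of_eigenvectors h.dual.eigenvalue_injective hA' _⟩,
    ⟨φ, fun n m => ⟨?_, ?_⟩⟩, ⟨φ', fun n m => ⟨?_, ?_⟩⟩, inferInstance, inferInstance, ?_, ?_⟩
  · rw [(hφ _).1]
    exact hA n m
  · rw [(hφ _).2, h.halfQDiff_eq]
    exact congrFun (hB n) m
  · rw [(hφ' _).1]
    refine (congrFun (hA' m) n).trans ?_
    rw [h.eigenvalue_dual, Pi.smul_apply, smul_eq_mul, ← mul_assoc, one_div,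
      inv_mul_cancel₀ two_ne_zero, one_mul]
    rfl
  · rw [(hφ' _).2, h.halfQDiff_eq]
    exact hB' m n
  · rw [GasperRahman.starSpace_eq, finrank_span_eq_card h.linearIndependent_polyOfLabel,
      Fintype.card_pi]
    simp only [Fintype.card_fin]
  · rw [GasperRahman.dualSpace_eq, finrank_span_eq_card h.linearIndependent_polyOfDualLabel,
      Fintype.card_pi]
    simp only [Fintype.card_fin]
    exact Equiv.prod_comp Fin.revPerm fun k => twoJ k + 1
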